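/- Let $d,m\ge 1$ and let $(\Omega,\mu)$ be a $\sigma$-finite measure space. A quasi-Banach function space over $\Omega$ is an order ideal $X\subseteq L^0(\Omega)$ with a quasi-norm such that $|\xi|\le|\eta|$ implies $\|\xi\|_X\le\|\eta\|_X$, $X$ contains some $\xi>0$ a.e., and $X$ has the Fatou property ($0\le\xi_n\uparrow\xi$ a.e. with $\xi_n\in X$, $\sup_n\|\xi_n\|_X<\infty$ implies $\xi\in X$ and $\|\xi\|_X=\sup_n\|\xi_n\|_X$). It is order-continuous if $0\le\xi_n\uparrow\xi\in X$ implies $\|\xi_n-\xi\|_X\to0$, and $p$-convex if $\|(\sum_{k}|\xi_k|^p)^{1/p}\|_X\le(\sum_{k}\|\xi_k\|_X^p)^{1/p}$ for all finite families in $X$. Let $\vec X=(X_1,\dots,X_m)$ be quasi-Banach function spaces over $\Omega$ such that their product $X=\prod_jX_j=\{\xi:|\xi|\le\prod_j\xi_j,\ 0\le\xi_j\in X_j\}$ with $\|\xi\|_X=\inf\{\prod_j\|\xi_j\|_{X_j}:|\xi|\le\prod_j\xi_j,\ 0\le\xi_j\in X_j\}$ is also a quasi-Banach function space. Cubes are half-open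 with sides parallel to the axes; $\langle f\rangle_{s,Q}=(\frac1{|Q|}\int_Q|f|^s\,dx)^{1/s}$. For a collection $\mathcal D$ of cubes, $\vec s\in(0,\infty)^n$ and scalar functions put $M^{\mathcal D}_{\vec s}(h_1,\dots,h_n)(x)=\sup_{Q\in\mathcal D}\prod_j\langle h_j\rangle_{s_j,Q}\mathbf 1_Q(x)$. For functions $f_j:\mathbb R^d\to X_j$ let $\widetilde M^{\mathcal D}_{\vec r}(\vec f)(x)=\sup_{Q\in\mathcal D}\prod_{j=1}^m\langle f_j\rangle_{r_j,Q}\mathbf 1_Q(x)$ with averages and supremum taken in the lattice sense, i.e. $\widetilde M^{\mathcal D}_{\vec r}(\vec f)(x,\omega)=M^{\mathcal D}_{\vec r}(\vec f(\cdot,\omega))(x)$. Omit $\mathcal D$ if it consists of all cubes. $L^p(\mathbb R^d;X_j)$ and $L^p_{\rm loc}(\mathbb R^d;X_j)$ denote the Bochner spaces of strongly measurable functions. Let $\vec r\in(0,\infty)^m$ and $\frac1r=\sum_j\frac1{r_j}$. Suppose that $X$ is order-continuous and that $\vec X\in\mathrm{HL}_{\vec r}$: each $X_j$ is $r_j$-convex,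 and for some $\vec p$ with $r_j<p_j\le\infty$, $\frac1p=\sum_j\frac1{p_j}$, the operators $\widetilde M^{\mathcal D}_{\vec r}:\prod_jL^{p_j}(\mathbb R^d;X_j)\to L^p(\mathbb R^d;X)$ are bounded uniformly over all finite collections $\mathcal D$ of cubes. Then there is a constant $C$ depending only on $\vec X,\vec r,d,m$ such that for every $q\in[r,\infty)$ for which $X$ is $q$-convex and all $f_j\in L^{r_j}_{\rm loc}(\mathbb R^d;X_j)$, $1\le j\le m$ (with $\|\cdot\|_X=\infty$ outside $X$): (1) for all $g\in L^q_{\rm loc}(\mathbb R^d)$, $$\big\|\,\|\widetilde M_{\vec r}(\vec f)\|_X\cdot g\,\big\|_{L^q(\mathbb R^d)}\le C\,\big\|M_{(\vec r,q)}(\|f_1\|_{X_1},\dots,\|f_m\|_{X_m},g)\big\|_{L^q(\mathbb R^d)},$$ and $\widetilde M_{\vec r}(\vec f)\cdot g\in L^q(\mathbb R^d;X)$ if the right-hand side is finite; (2) in particular $$\big\|\widetilde M_{\vec r}(\vec f)\big\|_{L^q(\mathbb R^d;X)}\le C\,\big\|M_{\vec r}(\|f_1\|_{X_1},\dots,\|f_m\|_{X_m})\big\|_{L^q(\mathbb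 R^d)},$$ and $\widetilde M_{\vec r}(\vec f)\in L^q(\mathbb R^d;X)$ if the right-hand side is finite; (3) for every finite collection $\mathcal D$ of standard dyadic cubes there is a sparse $\mathcal S\subseteq\mathcal D$ (there are pairwise disjoint measurable $E_Q\subseteq Q$, $Q\in\mathcal S$, with $|E_Q|\ge\frac12|Q|$) such that for all $x\in\mathbb R^d$ $$\big\|\widetilde M^{\mathcal D}_{\vec r}(\vec f)(x)\big\|_X\le C\Big(\sum_{Q\in\mathcal S}\prod_{j=1}^m\langle\|f_j\|_{X_j}\rangle_{r_j,Q}^q\,\mathbf 1_Q(x)\Big)^{1/q}.$$ -/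

import Mathlib

open MeasureTheory Set Filter Topology
open scoped ENNReal NNReal

noncomputable section

namespace SparseHL

/-! ### Quasi-Banach function spaces

An element of `L⁰(Ω)` is represented by an a.e. strongly measurable function `Ω → 𝕜`; all notions
below are invariant under a.e. equality (by the ideal property). -/

/-- A real-valued function regarded as a `𝕜`-valued one. -/
def lift (𝕜 : Type*) [RCLike 𝕜] {Ω : Type*} (u : Ω → ℝ) : Ω → 𝕜 := fun ω => (u ω : 𝕜)

/-- The data of a function space: the set of its elements and its functional `‖·‖`, of which only
the values on the carrier matter. -/
structure FnSpace (Ω 𝕜 : Type*) where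
  carrier : Set (Ω → 𝕜)
  nrm : (Ω → 𝕜) → ℝ

/-- `0 ≤ u n ↑ v` almost everywhere, for measurable functions. -/
def IncreasesTo {Ω : Type*} [MeasurableSpace Ω] (μ : Measure Ω) (u : ℕ → Ω → ℝ) (v : Ω → ℝ) :
    Prop :=
  (∀ n, AEStronglyMeasurable (u n) μ) ∧ AEStronglyMeasurable v μ ∧
    ∀ᵐ ω ∂μ, 0 ≤ u 0 ω ∧ Monotone (fun n => u n ω) ∧
      Tendsto (fun n => u n ω) atTop (𝓝 (v ω))

/-- `X` is a quasi-Banach function space over `(Ω, μ)`: an order ideal of `L⁰(Ω)` with a quasi-norm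
that is compatible with the order, has a weak order unit and the Fatou property. -/
structure IsQBFS {Ω 𝕜 : Type*} [MeasurableSpace Ω] [RCLike 𝕜] (μ : Measure Ω)
    (X : FnSpace Ω 𝕜) : Prop where
  meas : ∀ ξ ∈ X.carrier, AEStronglyMeasurable ξ μ
  zero_mem : (0 : Ω → 𝕜) ∈ X.carrier
  add_mem : ∀ ξ ∈ X.carrier, ∀ η ∈ X.carrier, ξ + η ∈ X.carrier
  smul_mem : ∀ (c : 𝕜), ∀ ξ ∈ X.carrier, c • ξ ∈ X.carrier
  ideal : ∀ η ∈ X.carrier, ∀ ξ : Ω → 𝕜, AEStronglyMeasurable ξ μ →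
    (∀ᵐ ω ∂μ, ‖ξ ω‖ ≤ ‖η ω‖) → ξ ∈ X.carrier
  nrm_nonneg : ∀ ξ ∈ X.carrier, 0 ≤ X.nrm ξ
  nrm_eq_zero : ∀ ξ ∈ X.carrier, (X.nrm ξ = 0 ↔ ξ =ᵐ[μ] 0)
  nrm_smul : ∀ (c : 𝕜), ∀ ξ ∈ X.carrier, X.nrm (c • ξ) = ‖c‖ * X.nrm ξ
  nrm_add : ∃ K : ℝ, ∀ ξ ∈ X.carrier, ∀ η ∈ X.carrier,
    X.nrm (ξ + η) ≤ K * (X.nrm ξ + X.nrm η)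
  compat : ∀ ξ ∈ X.carrier, ∀ η ∈ X.carrier,
    (∀ᵐ ω ∂μ, ‖ξ ω‖ ≤ ‖η ω‖) → X.nrm ξ ≤ X.nrm η
  weak_unit : ∃ u : Ω → ℝ, lift 𝕜 u ∈ X.carrier ∧ ∀ᵐ ω ∂μ, 0 < u ω
  fatou : ∀ (u : ℕ → Ω → ℝ) (v : Ω → ℝ), IncreasesTo μ u v →
    (∀ n, lift 𝕜 (u n) ∈ X.carrier) → BddAbove (range fun n => X.nrm (lift 𝕜 (u n))) →
    lift 𝕜 v ∈ X.carrier ∧ X.nrm (lift 𝕜 v) = ⨆ n, X.nrm (lift 𝕜 (u n))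

/-- Order-continuity: `0 ≤ u n ↑ v` with `v ∈ X` implies `‖u n - v‖ → 0`. -/
def OrderContinuous {Ω 𝕜 : Type*} [MeasurableSpace Ω] [RCLike 𝕜] (μ : Measure Ω)
    (X : FnSpace Ω 𝕜) : Prop :=
  ∀ (u : ℕ → Ω → ℝ) (v : Ω → ℝ), IncreasesTo μ u v → lift 𝕜 v ∈ X.carrier →
    Tendsto (fun n => X.nrm (lift 𝕜 (u n) - lift 𝕜 v)) atTop (𝓝 0)

/-- `p`-convexity (with constant one). -/
def PConvex {Ω 𝕜 : Type*} [RCLike 𝕜] (X : FnSpace Ω 𝕜) (p : ℝ) : Prop :=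
  ∀ (n : ℕ) (ξ : Fin n → Ω → 𝕜), (∀ k, ξ k ∈ X.carrier) →
    X.nrm (lift 𝕜 fun ω => (∑ k, ‖ξ k ω‖ ^ p) ^ (1 / p)) ≤ (∑ k, X.nrm (ξ k) ^ p) ^ (1 / p)

/-- `u` is a tuple with `0 ≤ u j ∈ X j` and `|ξ| ≤ ∏ j, u j` almost everywhere. -/
def Dominates {Ω 𝕜 : Type*} [MeasurableSpace Ω] [RCLike 𝕜] (μ : Measure Ω) {m : ℕ}
    (X : Fin m → FnSpace Ω 𝕜) (ξ : Ω → 𝕜) (u : Fin m → Ω → ℝ) : Prop :=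
  (∀ j, lift 𝕜 (u j) ∈ (X j).carrier) ∧ (∀ j, ∀ᵐ ω ∂μ, 0 ≤ u j ω) ∧
    ∀ᵐ ω ∂μ, ‖ξ ω‖ ≤ ∏ j, u j ω

/-- The product `∏ j, X j` with its functional. -/
def prodSpace {Ω 𝕜 : Type*} [MeasurableSpace Ω] [RCLike 𝕜] (μ : Measure Ω) {m : ℕ}
    (X : Fin m → FnSpace Ω 𝕜) : FnSpace Ω 𝕜 where
  carrier := {ξ | AEStronglyMeasurable ξ μ ∧ ∃ u, Dominates μ X ξ u}
  nrm := fun ξ => sInf {c | ∃ u, Dominates μ X ξ u ∧ c = ∏ j, (X j).nrm (lift 𝕜 (u j))}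

/-- An `m`-tuple of quasi-Banach function spaces: all factors and their product are such spaces. -/
def IsQBFSTuple {Ω 𝕜 : Type*} [MeasurableSpace Ω] [RCLike 𝕜] (μ : Measure Ω) {m : ℕ}
    (X : Fin m → FnSpace Ω 𝕜) : Prop :=
  (∀ j, IsQBFS μ (X j)) ∧ IsQBFS μ (prodSpace μ X)

/-- `‖ξ‖_X`, with the value `∞` for `ξ ∉ X`. -/
def eNrm {Ω 𝕜 : Type*} (X : FnSpace Ω 𝕜) (ξ : Ω → 𝕜) : ℝ≥0∞ :=
  open scoped Classical in if ξ ∈ X.carrier then ENNReal.ofReal (X.nrm ξ) else ∞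

/-- `‖u‖_X` for a function `u` with values in `[0, ∞]`, with the value `∞` if `u` is not
(a.e. equal to) an element of `X`. -/
def eNrmPos {Ω 𝕜 : Type*} [MeasurableSpace Ω] [RCLike 𝕜] (μ : Measure Ω) (X : FnSpace Ω 𝕜)
    (u : Ω → ℝ≥0∞) : ℝ≥0∞ :=
  open scoped Classical in
    if ∀ᵐ ω ∂μ, u ω < ∞ then eNrm X (lift 𝕜 fun ω => (u ω).toReal) else ∞

/-! ### Bochner spaces -/

/-- `f` represents a strongly measurable function `ℝᵈ → X`, i.e. an element of `L⁰(ℝᵈ; X)`: it is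
jointly measurable, and `x ↦ f x` is `X`-valued and an a.e. limit in `X` of `X`-valued simple
functions. (Each strongly measurable `ℝᵈ → X` has a jointly measurable representative.) -/
def StronglyMeas {Ω 𝕜 : Type*} [MeasurableSpace Ω] [RCLike 𝕜] (μ : Measure Ω) {d : ℕ}
    (X : FnSpace Ω 𝕜) (f : (Fin d → ℝ) → Ω → 𝕜) : Prop :=
  AEStronglyMeasurable (Function.uncurry f) ((volume : Measure (Fin d → ℝ)).prod μ) ∧
  (∀ᵐ x, f x ∈ X.carrier) ∧
  ∃ s : ℕ → SimpleFunc (Fin d → ℝ) (Ω → 𝕜), (∀ n x, s n x ∈ X.carrier) ∧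
    ∀ᵐ x, Tendsto (fun n => X.nrm (s n x - f x)) atTop (𝓝 0)

/-- `‖f‖_{Lᵖ(ℝᵈ; X)}`. -/
def bochnerNorm {Ω 𝕜 : Type*} {d : ℕ} (X : FnSpace Ω 𝕜) (p : ℝ≥0∞)
    (f : (Fin d → ℝ) → Ω → 𝕜) : ℝ≥0∞ :=
  eLpNorm (fun x => eNrm X (f x)) p volume

/-- `f ∈ Lᵖ(ℝᵈ; X)`. -/
def MemBochner {Ω 𝕜 : Type*} [MeasurableSpace Ω] [RCLike 𝕜] (μ : Measure Ω) {d : ℕ}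
    (X : FnSpace Ω 𝕜) (p : ℝ≥0∞) (f : (Fin d → ℝ) → Ω → 𝕜) : Prop :=
  StronglyMeas μ X f ∧ bochnerNorm X p f < ∞

/-- `f ∈ Lᵖ_loc(ℝᵈ; X)`. -/
def MemBochnerLoc {Ω 𝕜 : Type*} [MeasurableSpace Ω] [RCLike 𝕜] (μ : Measure Ω) {d : ℕ}
    (X : FnSpace Ω 𝕜) (p : ℝ≥0∞) (f : (Fin d → ℝ) → Ω → 𝕜) : Prop :=
  StronglyMeas μ X f ∧ ∀ K : Set (Fin d → ℝ), IsCompact K →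
    eLpNorm (fun x => eNrm X (f x)) p (volume.restrict K) < ∞

/-- `g ∈ Lᵖ_loc(ℝᵈ)`. -/
def MemLpLoc {𝕜 : Type*} [RCLike 𝕜] {d : ℕ} (p : ℝ≥0∞) (g : (Fin d → ℝ) → 𝕜) : Prop :=
  AEStronglyMeasurable g volume ∧ ∀ K : Set (Fin d → ℝ), IsCompact K →
    eLpNorm g p (volume.restrict K) < ∞

/-! ### Cubes and maximal operators -/

/-- The half-open cubes with sides parallel to the axes. -/
def cubes (d : ℕ) : Set (Set (Fin d → ℝ)) :=
  {Q | ∃ (a : Fin d → ℝ) (l : ℝ), 0 < l ∧ Q = univ.pi fun i => Ico (a i) (a i + l)}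

/-- The standard dyadic grid. -/
def dyadicCubes (d : ℕ) : Set (Set (Fin d → ℝ)) :=
  {Q | ∃ (k : ℤ) (n : Fin d → ℤ),
    Q = univ.pi fun i => Ico ((2 : ℝ) ^ (-k) * n i) ((2 : ℝ) ^ (-k) * (n i + 1))}

/-- A collection of cubes is sparse if there are pairwise disjoint measurable sets `E Q ⊆ Q` with
`|E Q| ≥ |Q| / 2`. -/
def IsSparse {d : ℕ} (S : Set (Set (Fin d → ℝ))) : Prop :=
  ∃ E : Set (Fin d → ℝ) → Set (Fin d → ℝ),
    (∀ Q ∈ S, MeasurableSet (E Q) ∧ E Q ⊆ Q ∧ volume Q / 2 ≤ volume (E Q)) ∧ S.PairwiseDisjoint E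

/-- The average `⟨h⟩_{s,Q}` of a nonnegative function. -/
def avg {d : ℕ} (s : ℝ) (Q : Set (Fin d → ℝ)) (h : (Fin d → ℝ) → ℝ≥0∞) : ℝ≥0∞ :=
  ((∫⁻ x in Q, h x ^ s) / volume Q) ^ (1 / s)

/-- The multisublinear maximal operator `M_s^𝒬 (h₁, …, hₙ)` over the cubes in `𝒬`. -/
def multiMax {d n : ℕ} (𝒬 : Set (Set (Fin d → ℝ))) (s : Fin n → ℝ)
    (h : Fin n → (Fin d → ℝ) → ℝ≥0∞) (x : Fin d → ℝ) : ℝ≥0∞ :=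
  ⨆ Q ∈ 𝒬, Q.indicator (fun _ => ∏ j, avg (s j) Q (h j)) x

/-- The multisublinear lattice maximal operator over the cubes in `𝒬`, i.e. the maximal operator in
the variable `x` for fixed `ω`. -/
def latticeMax {Ω 𝕜 : Type*} [RCLike 𝕜] {d m : ℕ} (𝒬 : Set (Set (Fin d → ℝ))) (r : Fin m → ℝ)
    (f : Fin m → (Fin d → ℝ) → Ω → 𝕜) (x : Fin d → ℝ) (ω : Ω) : ℝ≥0∞ :=
  multiMax 𝒬 r (fun j y => ‖f j y ω‖ₑ) x

/-- The `r`-Hardy--Littlewood property of `X` (on `ℝᵈ`). -/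
def HL {Ω 𝕜 : Type*} [MeasurableSpace Ω] [RCLike 𝕜] (μ : Measure Ω) (d : ℕ) {m : ℕ}
    (X : Fin m → FnSpace Ω 𝕜) (r : Fin m → ℝ) : Prop :=
  (∀ j, PConvex (X j) (r j)) ∧
  ∃ p : Fin m → ℝ≥0∞, (∀ j, ENNReal.ofReal (r j) < p j) ∧
    ∃ C : ℝ≥0, ∀ D : Finset (Set (Fin d → ℝ)), (D : Set (Set (Fin d → ℝ))) ⊆ cubes d →
      ∀ f : Fin m → (Fin d → ℝ) → Ω → 𝕜, (∀ j, MemBochner μ (X j) (p j) (f j)) →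
        eLpNorm (fun x => eNrmPos μ (prodSpace μ X) (latticeMax (D : Set (Set (Fin d → ℝ))) r f x))
            (∑ j, (p j)⁻¹)⁻¹ volume
          ≤ C * ∏ j, bochnerNorm (X j) (p j) (f j)

end SparseHL

end

open SparseHL

/-!
The proof rests on one weak-type estimate, from which a sparse bound follows by induction over a
finite family of dyadic cubes; everything else is passage from finite dyadic families to all
cubes.

All quasi-norms are handled through `eNrmPos μ X`, a functional on `[0, ∞]`-valued functions
which is monotone, homogeneous, `p`-convex and satisfies the Fatou property and Fatou's lemma.

*Integral convexity* (`exists_eNrmPos_avg_le`). If `X` is `r`-convex, the lattice-valued average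
`⟨f⟩_{r,Q}` has norm at most a constant times the scalar average `⟨‖f‖⟩_{r,Q}`. For simple
functions this is `r`-convexity. In general, simple functions converging to `f` in norm
converge, along a subsequence, almost everywhere on `Q × Ω`, because norm convergence implies
convergence in measure; after a truncation Fatou's lemma in both variables gives the claim.

*Weak type* (`exists_volume_lt_latticeMax_le`). Let `D` be a finite family of cubes of a dyadic
grid inside a cube `Q` of that grid, and let `a j = ⟨‖f j‖⟩_{r j,Q}`. On the Calderón–Zygmund
cubes of `‖f j‖` at height `t a j`, and on the cubes of a fine level off these, `f j` is
replaced by its lattice-valued average. The maximal function over `D` is unchanged outside the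
Calderón–Zygmund cubes, which fill only a small part of `Q`. The averaged functions take
finitely many values, of norm at most a constant times `a j`, so the Hardy–Littlewood property
and Chebyshev's inequality show that the norm of the maximal function exceeds `A ∏ a j` on at
most half of `Q`. No interpolation is needed, and exponents `p j = ∞` need no separate
treatment.

*Sparse domination* (`exists_sparse_eNrmPos_latticeMax_le`). For a maximal cube `Q₀` of the
family, let `B` be the exceptional set of the weak-type estimate. The cubes inside `Q₀` not
contained in `B` contribute at most `A ∏ a j` at each point, so they are charged to `Q₀` with
`E Q₀ = Q₀ \ B`, and the remaining cubes form a smaller family. The contributions are added by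
`q`-convexity.

*All cubes* (`eLpNorm_eNrmPos_latticeMax_mul_le`). The supremum over all cubes is an increasing
limit of suprema over finite families. By the one-third trick such a family is controlled by
families in `2 ^ d` translated dyadic grids, where the sparse bound applies. The sparse sum,
integrated against `|g| ^ q`, is at most twice the integral of the `q`-th power of the weighted
maximal function since the sets `E Q` are disjoint and fill half of `Q`. The constants
`(2 ^ (d + 1)) ^ (1 / q)` are bounded for `q ≥ r`. The estimate without weight is the case `g = 1`.

*Membership* (`memBochner_smul_latticeMax`). The maximal function over a finite family is a
simple function of `x`, and by order-continuity these simple functions converge in norm to the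
maximal function over all cubes wherever the latter has finite norm.
-/

namespace SparseHL

/-! ### The quasi-norm on `[0, ∞]`-valued functions -/

section

section

variable {Ω 𝕜 : Type*} [RCLike 𝕜]

@[simp] lemma norm_lift (u : Ω → ℝ) (ω : Ω) : ‖lift 𝕜 u ω‖ = |u ω| := by
  simp [lift]

@[simp] lemma enorm_lift_toReal (u : Ω → ℝ≥0∞) (ω : Ω) :
    ‖lift 𝕜 (fun ω => (u ω).toReal) ω‖ₑ = ENNReal.ofReal (u ω).toReal := by
  rw [← ofReal_norm, norm_lift, abs_of_nonneg ENNReal.toReal_nonneg]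

end

lemma eNrm_of_mem {Ω 𝕜 : Type*} {X : FnSpace Ω 𝕜} {ξ : Ω → 𝕜}
    (h : ξ ∈ X.carrier) : eNrm X ξ = ENNReal.ofReal (X.nrm ξ) := by
  simp [eNrm, h]

lemma mem_of_eNrm_ne_top {Ω 𝕜 : Type*} {X : FnSpace Ω 𝕜} {ξ : Ω → 𝕜}
    (h : eNrm X ξ ≠ ∞) : ξ ∈ X.carrier := by
  by_contra h'
  simp [eNrm, h'] at h

variable {Ω 𝕜 : Type*} [MeasurableSpace Ω] [RCLike 𝕜] {μ : Measure Ω} {X : FnSpace Ω 𝕜}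

lemma aestronglyMeasurable_lift {u : Ω → ℝ} (hu : AEMeasurable u μ) :
    AEStronglyMeasurable (lift 𝕜 u) μ :=
  (RCLike.measurable_ofReal.comp_aemeasurable hu).aestronglyMeasurable

lemma eNrmPos_of_mem {u : Ω → ℝ≥0∞} (hu : ∀ᵐ ω ∂μ, u ω < ∞)
    (h : lift 𝕜 (fun ω => (u ω).toReal) ∈ X.carrier) :
    eNrmPos μ X u = ENNReal.ofReal (X.nrm (lift 𝕜 fun ω => (u ω).toReal)) := by
  rw [eNrmPos, if_pos hu, eNrm_of_mem h]

lemma ae_lt_top_of_eNrmPos {u : Ω → ℝ≥0∞} (h : eNrmPos μ X u ≠ ∞) : ∀ᵐ ω ∂μ, u ω < ∞ := by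
  by_contra h'
  simp only [eNrmPos, if_neg h', ne_eq, not_true_eq_false] at h

lemma mem_of_eNrmPos {u : Ω → ℝ≥0∞} (h : eNrmPos μ X u ≠ ∞) :
    lift 𝕜 (fun ω => (u ω).toReal) ∈ X.carrier := by
  have h' := ae_lt_top_of_eNrmPos h
  simp only [eNrmPos, if_pos h'] at h
  exact mem_of_eNrm_ne_top h

namespace IsQBFS

lemma eNrmPos_mono (hX : IsQBFS μ X) {u v : Ω → ℝ≥0∞} (hu : AEMeasurable u μ)
    (h : ∀ᵐ ω ∂μ, u ω ≤ v ω) : eNrmPos μ X u ≤ eNrmPos μ X v := by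
  by_cases hv : eNrmPos μ X v = ∞
  · simp [hv]
  have hvf := ae_lt_top_of_eNrmPos hv
  have hvm := mem_of_eNrmPos hv
  have huf : ∀ᵐ ω ∂μ, u ω < ∞ := by
    filter_upwards [h, hvf] with ω h1 h2 using h1.trans_lt h2
  have hle : ∀ᵐ ω ∂μ, ‖lift 𝕜 (fun ω => (u ω).toReal) ω‖ ≤
      ‖lift 𝕜 (fun ω => (v ω).toReal) ω‖ := by
    filter_upwards [h, hvf] with ω h1 h2
    simpa [abs_of_nonneg] using ENNReal.toReal_mono h2.ne h1
  have hum := hX.ideal _ hvm _ (aestronglyMeasurable_lift hu.ennreal_toReal) hle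
  rw [eNrmPos_of_mem huf hum, eNrmPos_of_mem hvf hvm]
  exact ENNReal.ofReal_le_ofReal (hX.compat _ hum _ hvm hle)

lemma eNrmPos_congr (hX : IsQBFS μ X) {u v : Ω → ℝ≥0∞} (hu : AEMeasurable u μ)
    (h : ∀ᵐ ω ∂μ, u ω = v ω) : eNrmPos μ X u = eNrmPos μ X v :=
  le_antisymm (hX.eNrmPos_mono hu (h.mono fun _ h => h.le))
    (hX.eNrmPos_mono (hu.congr h) (h.mono fun _ h => h.ge))

lemma mem_congr_norm (hX : IsQBFS μ X) {ξ η : Ω → 𝕜} (hξ : AEStronglyMeasurable ξ μ)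
    (h : ∀ᵐ ω ∂μ, ‖ξ ω‖ = ‖η ω‖) (hη : η ∈ X.carrier) : ξ ∈ X.carrier :=
  hX.ideal _ hη _ hξ (h.mono fun _ h => h.le)

lemma nrm_congr_norm (hX : IsQBFS μ X) {ξ η : Ω → 𝕜} (hξ : ξ ∈ X.carrier)
    (h : ∀ᵐ ω ∂μ, ‖ξ ω‖ = ‖η ω‖) (hη : η ∈ X.carrier) : X.nrm ξ = X.nrm η :=
  le_antisymm (hX.compat _ hξ _ hη (h.mono fun _ h => h.le))
    (hX.compat _ hη _ hξ (h.mono fun _ h => h.ge))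

lemma eNrmPos_enorm (hX : IsQBFS μ X) {ξ : Ω → 𝕜} (hξ : AEStronglyMeasurable ξ μ) :
    eNrmPos μ X (fun ω => ‖ξ ω‖ₑ) = eNrm X ξ := by
  have hf : ∀ᵐ ω ∂μ, ‖ξ ω‖ₑ < ∞ := ae_of_all _ fun ω => enorm_lt_top
  have hn : ∀ᵐ ω ∂μ, ‖lift 𝕜 (fun ω => (‖ξ ω‖ₑ).toReal) ω‖ = ‖ξ ω‖ :=
    ae_of_all _ fun ω => by simp
  by_cases h : ξ ∈ X.carrier
  · have h' := hX.mem_congr_norm (aestronglyMeasurable_lift hξ.enorm.ennreal_toReal) hn h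
    rw [eNrmPos_of_mem hf h', eNrm_of_mem h, hX.nrm_congr_norm h' hn h]
  · have : eNrm X ξ = ∞ := by simp [eNrm, h]
    rw [this]
    by_contra h'
    exact h (hX.mem_congr_norm hξ (hn.mono fun _ h => h.symm) (mem_of_eNrmPos h'))

lemma eNrmPos_zero (hX : IsQBFS μ X) : eNrmPos μ X (fun _ => 0) = 0 := by
  have h0 : lift 𝕜 (fun _ : Ω => (0 : ℝ≥0∞).toReal) = (0 : Ω → 𝕜) := by
    ext; simp [lift]
  rw [eNrmPos_of_mem (by simp) (h0 ▸ hX.zero_mem), h0,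
    (hX.nrm_eq_zero _ hX.zero_mem).2 (ae_eq_refl _), ENNReal.ofReal_zero]

lemma ae_eq_zero_of_eNrmPos (hX : IsQBFS μ X) {u : Ω → ℝ≥0∞} (h : eNrmPos μ X u = 0) :
    ∀ᵐ ω ∂μ, u ω = 0 := by
  have ht : eNrmPos μ X u ≠ ∞ := by simp [h]
  have hf := ae_lt_top_of_eNrmPos ht
  have hm := mem_of_eNrmPos ht
  rw [eNrmPos_of_mem hf hm, ENNReal.ofReal_eq_zero] at h
  have := (hX.nrm_eq_zero _ hm).1 (le_antisymm h (hX.nrm_nonneg _ hm))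
  filter_upwards [this, hf] with ω h1 h2
  have h3 : (u ω).toReal = 0 := by simpa [lift] using h1
  exact (ENNReal.toReal_eq_zero_iff _).1 h3 |>.resolve_right h2.ne

lemma eNrmPos_const_mul_le (hX : IsQBFS μ X) (c : ℝ≥0) (u : Ω → ℝ≥0∞) :
    eNrmPos μ X (fun ω => c * u ω) ≤ c * eNrmPos μ X u := by
  rcases eq_or_ne c 0 with rfl | hc
  · simp [hX.eNrmPos_zero]
  by_cases hu : eNrmPos μ X u = ∞
  · simp [hu, ENNReal.mul_top, hc]
  have hf := ae_lt_top_of_eNrmPos hu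
  have hm := mem_of_eNrmPos hu
  have he : lift 𝕜 (fun ω => ((c : ℝ≥0∞) * u ω).toReal)
      = ((c : ℝ) : 𝕜) • lift 𝕜 (fun ω => (u ω).toReal) := by
    ext ω; simp [lift]
  have hf' : ∀ᵐ ω ∂μ, (c : ℝ≥0∞) * u ω < ∞ :=
    hf.mono fun ω h => ENNReal.mul_lt_top ENNReal.coe_lt_top h
  rw [eNrmPos_of_mem hf' (he ▸ hX.smul_mem _ _ hm), he, hX.nrm_smul _ _ hm,
    eNrmPos_of_mem hf hm, ENNReal.ofReal_mul (norm_nonneg _)]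
  simp

lemma eNrmPos_const_mul (hX : IsQBFS μ X) (c : ℝ≥0) (u : Ω → ℝ≥0∞) :
    eNrmPos μ X (fun ω => c * u ω) = c * eNrmPos μ X u := by
  rcases eq_or_ne c 0 with rfl | hc
  · simp [hX.eNrmPos_zero]
  refine le_antisymm (hX.eNrmPos_const_mul_le c u) ?_
  have h := hX.eNrmPos_const_mul_le c⁻¹ (fun ω => c * u ω)
  have hc' : (c : ℝ≥0∞) ≠ 0 := by simpa using hc
  have he : (fun ω => ((c⁻¹ : ℝ≥0) : ℝ≥0∞) * ((c : ℝ≥0∞) * u ω)) = u := by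
    ext ω
    rw [ENNReal.coe_inv hc, ← mul_assoc, ENNReal.inv_mul_cancel hc' ENNReal.coe_ne_top, one_mul]
  rw [he, ENNReal.coe_inv hc] at h
  calc (c : ℝ≥0∞) * eNrmPos μ X u
      ≤ c * ((c : ℝ≥0∞)⁻¹ * eNrmPos μ X (fun ω => c * u ω)) := by gcongr
    _ = _ := by rw [← mul_assoc, ENNReal.mul_inv_cancel hc' ENNReal.coe_ne_top, one_mul]

/-- The Fatou property for a sequence that is known to have a finite supremum. -/
lemma eNrmPos_iSup_le_of_finite (hX : IsQBFS μ X) {u : ℕ → Ω → ℝ≥0∞}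
    (hu : ∀ n, AEMeasurable (u n) μ) (hm : ∀ᵐ ω ∂μ, Monotone fun n => u n ω)
    (hf : ∀ᵐ ω ∂μ, ⨆ n, u n ω < ∞) {B : ℝ≥0∞} (hB : B ≠ ∞) (h : ∀ n, eNrmPos μ X (u n) ≤ B) :
    eNrmPos μ X (fun ω => ⨆ n, u n ω) ≤ B := by
  have ht : ∀ n, eNrmPos μ X (u n) ≠ ∞ := fun n => ((h n).trans_lt hB.lt_top).ne
  have hmem := fun n => mem_of_eNrmPos (ht n)
  have hle : ∀ n, X.nrm (lift 𝕜 fun ω => (u n ω).toReal) ≤ B.toReal := fun n => by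
    have := h n
    rw [eNrmPos_of_mem (ae_lt_top_of_eNrmPos (ht n)) (hmem n)] at this
    exact (ENNReal.ofReal_le_iff_le_toReal hB).1 this
  have hinc : IncreasesTo μ (fun n ω => (u n ω).toReal) (fun ω => (⨆ n, u n ω).toReal) := by
    refine ⟨fun n => (hu n).ennreal_toReal.aestronglyMeasurable,
      (AEMeasurable.iSup hu).ennreal_toReal.aestronglyMeasurable, ?_⟩
    filter_upwards [hm, hf] with ω h1 h2
    have hfin : ∀ n, u n ω ≠ ∞ := fun n => ((le_iSup (fun n => u n ω) n).trans_lt h2).ne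
    refine ⟨ENNReal.toReal_nonneg, fun i j hij => ENNReal.toReal_mono (hfin j) (h1 hij), ?_⟩
    exact (ENNReal.tendsto_toReal h2.ne).comp (tendsto_atTop_iSup h1)
  have hbdd : BddAbove (range fun n => X.nrm (lift 𝕜 fun ω => (u n ω).toReal)) :=
    ⟨B.toReal, by rintro _ ⟨n, rfl⟩; exact hle n⟩
  obtain ⟨hv, hn⟩ := hX.fatou _ _ hinc hmem hbdd
  rw [eNrmPos_of_mem hf hv, hn]
  exact (ENNReal.ofReal_le_iff_le_toReal hB).2 (ciSup_le hle)

/-- The supremum of a norm-bounded increasing sequence is finite almost everywhere: with `v` the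
supremum and `w` a weak order unit, `min (v / j) w` has norm at most `B / j`, while it equals `w`
wherever `v = ∞`. -/
lemma ae_iSup_lt_top (hX : IsQBFS μ X) {u : ℕ → Ω → ℝ≥0∞}
    (hu : ∀ n, AEMeasurable (u n) μ) (hm : ∀ᵐ ω ∂μ, Monotone fun n => u n ω)
    {B : ℝ≥0∞} (hB : B ≠ ∞) (h : ∀ n, eNrmPos μ X (u n) ≤ B) :
    ∀ᵐ ω ∂μ, ⨆ n, u n ω < ∞ := by
  obtain ⟨w, hw, hw0⟩ := hX.weak_unit
  have hwm : AEMeasurable (fun ω => ENNReal.ofReal (w ω)) μ := by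
    have h1 := (hX.meas _ hw).enorm
    refine h1.congr (hw0.mono fun ω h => ?_)
    simp only
    rw [← ofReal_norm, norm_lift, abs_of_pos h]
  set v : ℕ → Ω → ℝ≥0∞ := fun j ω => ⨆ n, min (((j + 1 : ℝ≥0)⁻¹ : ℝ≥0) * u n ω)
    (ENNReal.ofReal (w ω)) with hv
  have hmeas : ∀ j n, AEMeasurable (fun ω => min (((j + 1 : ℝ≥0)⁻¹ : ℝ≥0) * u n ω)
      (ENNReal.ofReal (w ω))) μ := fun j n => ((hu n).const_mul _).min hwm
  have hN : ∀ j : ℕ, eNrmPos μ X (v j) ≤ ((j + 1 : ℝ≥0)⁻¹ : ℝ≥0) * B := by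
    intro j
    refine hX.eNrmPos_iSup_le_of_finite (hmeas j) ?_ ?_
      (ENNReal.mul_ne_top ENNReal.coe_ne_top hB) fun n => ?_
    · filter_upwards [hm] with ω h1 a b hab
      exact min_le_min_right _ (mul_le_mul_right (h1 hab) _)
    · exact ae_of_all _ fun ω => (iSup_le fun n => min_le_right _ _).trans_lt ENNReal.ofReal_lt_top
    · refine (hX.eNrmPos_mono (hmeas j n) (ae_of_all _ fun ω => min_le_left _ _)).trans ?_
      exact (hX.eNrmPos_const_mul_le _ _).trans (mul_le_mul_right (h n) _)
  have hz : eNrmPos μ X (fun ω => ⨅ j, v j ω) = 0 := by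
    have hvm : ∀ j, AEMeasurable (v j) μ := fun j => AEMeasurable.iSup (hmeas j)
    have hle : ∀ j : ℕ, eNrmPos μ X (fun ω => ⨅ j, v j ω) ≤ ((j + 1 : ℝ≥0)⁻¹ : ℝ≥0) * B :=
      fun j => (hX.eNrmPos_mono (AEMeasurable.iInf hvm)
        (ae_of_all _ fun ω => iInf_le (fun j => v j ω) j)).trans (hN j)
    have hlim : Tendsto (fun j : ℕ => (((j + 1 : ℝ≥0)⁻¹ : ℝ≥0) : ℝ≥0∞) * B) atTop
        (𝓝 (((0 : ℝ≥0) : ℝ≥0∞) * B)) := by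
      refine ENNReal.Tendsto.mul_const ?_ (Or.inr hB)
      refine ENNReal.tendsto_coe.2 ?_
      have := tendsto_one_div_add_atTop_nhds_zero_nat (𝕜 := ℝ≥0)
      simpa [one_div] using this
    refine le_antisymm ?_ zero_le
    simpa using ge_of_tendsto' hlim hle
  filter_upwards [hX.ae_eq_zero_of_eNrmPos hz, hw0, hm] with ω h1 h2 h3
  by_contra hcon
  rw [not_lt_top_iff] at hcon
  have : ∀ j, v j ω = ENNReal.ofReal (w ω) := by
    intro j
    simp only [hv]
    refine le_antisymm (iSup_le fun n => min_le_right _ _) ?_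
    have hj : (((j + 1 : ℝ≥0)⁻¹ : ℝ≥0) : ℝ≥0∞) * ⨆ n, u n ω = ∞ := by
      rw [hcon, ENNReal.mul_top]
      simp only [ne_eq, ENNReal.coe_eq_zero, inv_eq_zero]
      positivity
    rw [ENNReal.mul_iSup] at hj
    have hlt : ENNReal.ofReal (w ω) < ⨆ n, (((j + 1 : ℝ≥0)⁻¹ : ℝ≥0) : ℝ≥0∞) * u n ω := by
      rw [hj]; exact ENNReal.ofReal_lt_top
    obtain ⟨n, hn⟩ := lt_iSup_iff.1 hlt
    exact le_iSup_of_le n (le_min hn.le le_rfl)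
  simp only [this, ciInf_const, ENNReal.ofReal_eq_zero] at h1
  exact absurd h2 (not_lt.2 h1)

/-- The Fatou property in terms of `[0, ∞]`-valued functions. -/
lemma eNrmPos_iSup (hX : IsQBFS μ X) {u : ℕ → Ω → ℝ≥0∞}
    (hu : ∀ n, AEMeasurable (u n) μ) (hm : ∀ᵐ ω ∂μ, Monotone fun n => u n ω) :
    eNrmPos μ X (fun ω => ⨆ n, u n ω) = ⨆ n, eNrmPos μ X (u n) := by
  refine le_antisymm ?_ (iSup_le fun n => hX.eNrmPos_mono (hu n)
    (ae_of_all _ fun ω => le_iSup (fun n => u n ω) n))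
  by_cases hB : ⨆ n, eNrmPos μ X (u n) = ∞
  · simp [hB]
  exact hX.eNrmPos_iSup_le_of_finite hu hm
    (hX.ae_iSup_lt_top hu hm hB (le_iSup fun n => eNrmPos μ X (u n))) hB
    (le_iSup fun n => eNrmPos μ X (u n))

lemma eNrmPos_liminf_le (hX : IsQBFS μ X) {u : ℕ → Ω → ℝ≥0∞}
    (hu : ∀ n, AEMeasurable (u n) μ) :
    eNrmPos μ X (fun ω => liminf (fun n => u n ω) atTop)
      ≤ liminf (fun n => eNrmPos μ X (u n)) atTop := by
  simp only [liminf_eq_iSup_iInf_of_nat]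
  have hmeas : ∀ n, AEMeasurable (fun ω => ⨅ i, ⨅ (_ : i ≥ n), u i ω) μ := fun n =>
    AEMeasurable.biInf _ (to_countable _) fun i _ => hu i
  rw [hX.eNrmPos_iSup hmeas]
  · refine iSup_mono fun n => le_iInf₂ fun i hi => ?_
    exact hX.eNrmPos_mono (hmeas n) (ae_of_all _ fun ω => iInf₂_le i hi)
  · exact ae_of_all _ fun ω a b hab => le_iInf₂ fun i hi => iInf₂_le i (hab.trans hi)

lemma sum_mem (hX : IsQBFS μ X) {ι : Type*} (s : Finset ι) {ξ : ι → Ω → 𝕜}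
    (h : ∀ i ∈ s, ξ i ∈ X.carrier) : ∑ i ∈ s, ξ i ∈ X.carrier := by
  classical
  induction s using Finset.induction_on with
  | empty => simpa using hX.zero_mem
  | insert a s ha ih =>
    rw [Finset.sum_insert ha]
    exact hX.add_mem _ (h a (Finset.mem_insert_self _ _)) _
      (ih fun i hi => h i (Finset.mem_insert_of_mem hi))

lemma lift_norm_mem (hX : IsQBFS μ X) {ξ : Ω → 𝕜} (h : ξ ∈ X.carrier) :
    lift 𝕜 (fun ω => ‖ξ ω‖) ∈ X.carrier :=
  hX.mem_congr_norm (aestronglyMeasurable_lift (hX.meas _ h).norm.aemeasurable)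
    (ae_of_all _ fun ω => by simp) h

/-- The `ℓᵖ`-sum of finitely many elements is dominated by a multiple of the sum of their
moduli, hence it is an element. -/
lemma lift_sum_rpow_mem (hX : IsQBFS μ X) {p : ℝ} (hp : 0 < p) {n : ℕ} {ξ : Fin n → Ω → 𝕜}
    (h : ∀ k, ξ k ∈ X.carrier) :
    lift 𝕜 (fun ω => (∑ k, ‖ξ k ω‖ ^ p) ^ (1 / p)) ∈ X.carrier := by
  refine hX.ideal _ (hX.smul_mem (((n : ℝ) ^ (1 / p) : ℝ) : 𝕜) _
    (hX.sum_mem Finset.univ fun k _ => hX.lift_norm_mem (h k))) _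
    (aestronglyMeasurable_lift ?_) (ae_of_all _ fun ω => ?_)
  · refine AEMeasurable.pow_const ?_ _
    exact Finset.aemeasurable_fun_sum _ fun k _ => (hX.meas _ (h k)).norm.aemeasurable.pow_const _
  · have hS : (∑ k, lift 𝕜 (fun ω => ‖ξ k ω‖)) ω = ((∑ k, ‖ξ k ω‖ : ℝ) : 𝕜) := by
      simp [lift]
    have hnn : 0 ≤ ∑ k, ‖ξ k ω‖ := Finset.sum_nonneg fun k _ => norm_nonneg _
    rw [norm_lift, Pi.smul_apply, hS, smul_eq_mul, norm_mul, RCLike.norm_ofReal,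
      RCLike.norm_ofReal, abs_of_nonneg (by positivity), abs_of_nonneg (by positivity),
      abs_of_nonneg hnn]
    calc (∑ k, ‖ξ k ω‖ ^ p) ^ (1 / p) ≤ (∑ _k : Fin n, (∑ k, ‖ξ k ω‖) ^ p) ^ (1 / p) := by
          gcongr with k
          exact Finset.single_le_sum (f := fun k => ‖ξ k ω‖) (fun k _ => norm_nonneg _)
            (Finset.mem_univ k)
      _ = (n : ℝ) ^ (1 / p) * ∑ k, ‖ξ k ω‖ := by
          rw [Finset.sum_const, Finset.card_univ, Fintype.card_fin, nsmul_eq_mul,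
            Real.mul_rpow (by positivity) (by positivity), ← Real.rpow_mul hnn,
            mul_one_div_cancel hp.ne', Real.rpow_one]

/-- `p`-convexity in terms of `[0, ∞]`-valued functions. -/
lemma eNrmPos_sum_rpow_le (hX : IsQBFS μ X) {p : ℝ} (hp : 0 < p) (hc : PConvex X p)
    {ι : Type*} (s : Finset ι) {u : ι → Ω → ℝ≥0∞} (hu : ∀ i ∈ s, AEMeasurable (u i) μ) :
    eNrmPos μ X (fun ω => (∑ i ∈ s, u i ω ^ p) ^ (1 / p))
      ≤ (∑ i ∈ s, eNrmPos μ X (u i) ^ p) ^ (1 / p) := by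
  by_cases ht : ∃ i ∈ s, eNrmPos μ X (u i) = ∞
  · obtain ⟨i, hi, h⟩ := ht
    have : ∑ i ∈ s, eNrmPos μ X (u i) ^ p = ∞ := by
      rw [ENNReal.sum_eq_top]
      exact ⟨i, hi, by simp [h, hp]⟩
    simp [this, hp]
  push Not at ht
  let e := s.equivFin.symm
  set ξ : Fin s.card → Ω → 𝕜 := fun k => lift 𝕜 fun ω => (u (e k) ω).toReal with hξ
  have hmem : ∀ k, ξ k ∈ X.carrier := fun k => mem_of_eNrmPos (ht _ (e k).2)
  have hfin : ∀ᵐ ω ∂μ, ∀ i ∈ s, u i ω < ∞ :=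
    (ae_ball_iff (s.countable_toSet)).2 fun i hi => ae_lt_top_of_eNrmPos (ht i hi)
  have hcv := hc _ ξ hmem
  have hmem' := hX.lift_sum_rpow_mem hp hmem
  have hfin' : ∀ᵐ ω ∂μ, (∑ i ∈ s, u i ω ^ p) ^ (1 / p) < ∞ := by
    filter_upwards [hfin] with ω h
    refine ENNReal.rpow_lt_top_of_nonneg (by positivity) (ENNReal.sum_lt_top.2 fun i hi => ?_).ne
    exact ENNReal.rpow_lt_top_of_nonneg hp.le (h i hi).ne
  have heq : ∀ᵐ ω ∂μ, ‖lift 𝕜 (fun ω => ((∑ i ∈ s, u i ω ^ p) ^ (1 / p)).toReal) ω‖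
      = ‖lift 𝕜 (fun ω => (∑ k, ‖ξ k ω‖ ^ p) ^ (1 / p)) ω‖ := by
    filter_upwards [hfin] with ω h
    rw [norm_lift, norm_lift]
    congr 1
    rw [← ENNReal.toReal_rpow, ENNReal.toReal_sum fun i hi =>
      (ENNReal.rpow_lt_top_of_nonneg hp.le (h i hi).ne).ne]
    congr 1
    rw [← Finset.sum_coe_sort s, ← Equiv.sum_comp e]
    refine Finset.sum_congr rfl fun k _ => ?_
    simp [hξ, ENNReal.toReal_rpow]
  have hmeas : AEMeasurable (fun ω => (∑ i ∈ s, u i ω ^ p) ^ (1 / p)) μ :=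
    (Finset.aemeasurable_fun_sum _ fun i hi => (hu i hi).pow_const _).pow_const _
  have hmem'' := hX.mem_congr_norm (aestronglyMeasurable_lift hmeas.ennreal_toReal) heq hmem'
  rw [eNrmPos_of_mem hfin' hmem'', hX.nrm_congr_norm hmem'' heq hmem']
  have hR : (∑ i ∈ s, eNrmPos μ X (u i) ^ p) ^ (1 / p)
      = ENNReal.ofReal ((∑ k, X.nrm (ξ k) ^ p) ^ (1 / p)) := by
    have hnn : ∀ k, 0 ≤ X.nrm (ξ k) := fun k => hX.nrm_nonneg _ (hmem k)
    rw [← ENNReal.ofReal_rpow_of_nonneg (Finset.sum_nonneg fun k _ => Real.rpow_nonneg (hnn k) _)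
      (by positivity), ENNReal.ofReal_sum_of_nonneg fun k _ => Real.rpow_nonneg (hnn k) _]
    congr 1
    rw [← Finset.sum_coe_sort s, ← Equiv.sum_comp e]
    refine Finset.sum_congr rfl fun k _ => ?_
    rw [← ENNReal.ofReal_rpow_of_nonneg (hnn k) hp.le,
      eNrmPos_of_mem (ae_lt_top_of_eNrmPos (ht _ (e k).2)) (hmem k)]
  rw [hR]
  exact ENNReal.ofReal_le_ofReal hcv

/-- The quasi-triangle inequality for the `[0, ∞]`-valued quasi-norm. -/
lemma exists_eNrm_add_le (hX : IsQBFS μ X) : ∃ K : ℝ≥0, 1 ≤ K ∧ ∀ ξ η : Ω → 𝕜,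
    eNrm X (ξ + η) ≤ K * (eNrm X ξ + eNrm X η) := by
  obtain ⟨K, hK⟩ := hX.nrm_add
  refine ⟨max K.toNNReal 1, le_max_right _ _, fun ξ η => ?_⟩
  have hne : ((max K.toNNReal 1 : ℝ≥0) : ℝ≥0∞) ≠ 0 := by
    have : (1 : ℝ≥0) ≤ max K.toNNReal 1 := le_max_right _ _
    exact_mod_cast (zero_lt_one.trans_le this).ne'
  by_cases hξ : ξ ∈ X.carrier
  swap
  · simp [eNrm, hξ]
  by_cases hη : η ∈ X.carrier
  swap
  · simp [eNrm, hη]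
  rw [eNrm_of_mem hξ, eNrm_of_mem hη, eNrm_of_mem (hX.add_mem _ hξ _ hη),
    ← ENNReal.ofReal_add (hX.nrm_nonneg _ hξ) (hX.nrm_nonneg _ hη), ← ENNReal.ofReal_coe_nnreal,
    ← ENNReal.ofReal_mul (by positivity)]
  refine ENNReal.ofReal_le_ofReal ((hK ξ hξ η hη).trans ?_)
  have h0 : 0 ≤ X.nrm ξ + X.nrm η := add_nonneg (hX.nrm_nonneg _ hξ) (hX.nrm_nonneg _ hη)
  refine mul_le_mul_of_nonneg_right ?_ h0
  rw [NNReal.coe_max]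
  exact (Real.le_coe_toNNReal K).trans (le_max_left _ _)

end IsQBFS

/-- Hölder's inequality for the product of function spaces. -/
lemma eNrmPos_prod_le {m : ℕ} {X : Fin m → FnSpace Ω 𝕜} (hX : IsQBFSTuple μ X)
    {u : Fin m → Ω → ℝ≥0∞} (hu : ∀ j, AEMeasurable (u j) μ)
    (hfin : ∀ j, eNrmPos μ (X j) (u j) ≠ ∞) :
    eNrmPos μ (prodSpace μ X) (fun ω => ∏ j, u j ω) ≤ ∏ j, eNrmPos μ (X j) (u j) := by
  have hf : ∀ᵐ ω ∂μ, ∀ j, u j ω < ∞ := ae_all_iff.2 fun j => ae_lt_top_of_eNrmPos (hfin j)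
  have hmem := fun j => mem_of_eNrmPos (hfin j)
  have hD : Dominates μ X (lift 𝕜 fun ω => (∏ j, u j ω).toReal)
      (fun j ω => (u j ω).toReal) := by
    refine ⟨hmem, fun j => ae_of_all _ fun ω => ENNReal.toReal_nonneg, ae_of_all _ fun ω => ?_⟩
    rw [norm_lift, abs_of_nonneg ENNReal.toReal_nonneg, ENNReal.toReal_prod]
  have hmeas : AEMeasurable (fun ω => ∏ j, u j ω) μ :=
    Finset.aemeasurable_fun_prod _ fun j _ => hu j
  have hmem' : lift 𝕜 (fun ω => (∏ j, u j ω).toReal) ∈ (prodSpace μ X).carrier :=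
    ⟨aestronglyMeasurable_lift hmeas.ennreal_toReal, _, hD⟩
  have hlt : ∀ᵐ ω ∂μ, ∏ j, u j ω < ∞ := by
    filter_upwards [hf] with ω h using ENNReal.prod_lt_top fun j _ => h j
  rw [eNrmPos_of_mem hlt hmem']
  have hR : ∏ j, eNrmPos μ (X j) (u j)
      = ENNReal.ofReal (∏ j, (X j).nrm (lift 𝕜 fun ω => (u j ω).toReal)) := by
    rw [ENNReal.ofReal_prod_of_nonneg fun j _ => (hX.1 j).nrm_nonneg _ (hmem j)]
    exact Finset.prod_congr rfl fun j _ =>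
      eNrmPos_of_mem (ae_lt_top_of_eNrmPos (hfin j)) (hmem j)
  rw [hR]
  refine ENNReal.ofReal_le_ofReal (csInf_le ⟨0, ?_⟩ ⟨_, hD, rfl⟩)
  rintro _ ⟨v, hv, rfl⟩
  exact Finset.prod_nonneg fun j _ => (hX.1 j).nrm_nonneg _ (hv.1 j)

end

/-! ### Convergence in quasi-norm and convergence almost everywhere -/

section

variable {Ω 𝕜 : Type*} [MeasurableSpace Ω] [RCLike 𝕜] {μ : Measure Ω} {X : FnSpace Ω 𝕜} {d : ℕ}

namespace IsQBFS

/-- A sequence tending to zero in quasi-norm has a subsequence tending to zero almost everywhere: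
if `∑ k, ‖u (φ k)‖ ^ p < ∞`, then `p`-convexity bounds the norms of the partial sums of
`∑ k, u (φ k) ^ p`, so this series converges almost everywhere. -/
lemma exists_subseq_ae_tendsto (hX : IsQBFS μ X) {p : ℝ} (hp : 0 < p) (hc : PConvex X p)
    {u : ℕ → Ω → ℝ≥0∞} (hu : ∀ n, AEMeasurable (u n) μ)
    (h : Tendsto (fun n => eNrmPos μ X (u n)) atTop (𝓝 0)) :
    ∃ φ : ℕ → ℕ, StrictMono φ ∧ ∀ᵐ ω ∂μ, Tendsto (fun k => u (φ k) ω) atTop (𝓝 0) := by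
  have hpow : Tendsto (fun n => eNrmPos μ X (u n) ^ p) atTop (𝓝 0) := by
    have := (ENNReal.continuous_rpow_const (y := p)).continuousAt.tendsto.comp h
    simpa [Function.comp_def, ENNReal.zero_rpow_of_pos hp] using this
  obtain ⟨φ, hφ, hφ'⟩ := extraction_forall_of_eventually'
    (P := fun k n => eNrmPos μ X (u n) ^ p ≤ (2⁻¹ : ℝ≥0∞) ^ k) fun k => by
      have : (0 : ℝ≥0∞) < 2⁻¹ ^ k := ENNReal.pow_pos (by simp) _
      exact eventually_atTop.1 (hpow.eventually (ge_mem_nhds this))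
  refine ⟨φ, hφ, ?_⟩
  set v : ℕ → Ω → ℝ≥0∞ := fun l ω => (∑ k ∈ Finset.range l, u (φ k) ω ^ p) ^ (1 / p) with hv
  have hvm : ∀ l, AEMeasurable (v l) μ := fun l =>
    (Finset.aemeasurable_fun_sum _ fun k _ => (hu _).pow_const _).pow_const _
  have hB : ∀ l, eNrmPos μ X (v l) ≤ 2 ^ (1 / p) := by
    intro l
    refine (hX.eNrmPos_sum_rpow_le hp hc _ fun k _ => hu _).trans ?_
    refine ENNReal.rpow_le_rpow ?_ (by positivity)
    calc ∑ k ∈ Finset.range l, eNrmPos μ X (u (φ k)) ^ p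
        ≤ ∑ k ∈ Finset.range l, (2⁻¹ : ℝ≥0∞) ^ k := Finset.sum_le_sum fun k _ => hφ' k
      _ ≤ ∑' k, (2⁻¹ : ℝ≥0∞) ^ k := ENNReal.sum_le_tsum _
      _ = 2 := by rw [ENNReal.tsum_geometric, ENNReal.one_sub_inv_two, inv_inv]
  have hfin := hX.ae_iSup_lt_top hvm (ae_of_all _ fun ω a b hab => by
    simp only [hv]
    refine ENNReal.rpow_le_rpow ?_ (by positivity)
    exact Finset.sum_le_sum_of_subset (Finset.range_mono hab))
    (ENNReal.rpow_ne_top_of_nonneg (by positivity) (by simp)) hB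
  filter_upwards [hfin] with ω hω
  have hsum : ∑' k, u (φ k) ω ^ p ≠ ∞ := by
    rw [ENNReal.tsum_eq_iSup_nat]
    refine ((iSup_le fun l => ?_).trans_lt
      (ENNReal.rpow_lt_top_of_nonneg hp.le hω.ne)).ne
    have h1 : ∑ k ∈ Finset.range l, u (φ k) ω ^ p = v l ω ^ p := by
      simp only [hv]
      rw [← ENNReal.rpow_mul, one_div_mul_cancel hp.ne', ENNReal.rpow_one]
    rw [h1]
    exact ENNReal.rpow_le_rpow (le_iSup (fun n => v n ω) l) hp.le
  have h1 := ENNReal.tendsto_atTop_zero_of_tsum_ne_top hsum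
  have h2 := (ENNReal.continuous_rpow_const (y := 1 / p)).continuousAt.tendsto.comp h1
  have h3 : (0 : ℝ≥0∞) ^ (1 / p) = 0 := ENNReal.zero_rpow_of_pos (by positivity)
  rw [h3] at h2
  refine h2.congr fun k => ?_
  rw [Function.comp_apply, ← ENNReal.rpow_mul, mul_one_div_cancel hp.ne', ENNReal.rpow_one]

/-- Convergence to zero in quasi-norm implies convergence to zero in measure, for every finite
measure that is absolutely continuous with respect to `μ`. -/
lemma tendsto_lintegral_min_one (hX : IsQBFS μ X) {p : ℝ} (hp : 0 < p) (hc : PConvex X p)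
    {u : ℕ → Ω → ℝ≥0∞} (hu : ∀ n, AEMeasurable (u n) μ)
    (h : Tendsto (fun n => eNrmPos μ X (u n)) atTop (𝓝 0)) {ν : Measure Ω} [IsFiniteMeasure ν]
    (hν : ν ≪ μ) : Tendsto (fun n => ∫⁻ ω, min 1 (u n ω) ∂ν) atTop (𝓝 0) := by
  refine tendsto_of_subseq_tendsto fun ns hns => ?_
  obtain ⟨φ, -, hφ⟩ := hX.exists_subseq_ae_tendsto hp hc (fun n => hu (ns n)) (h.comp hns)
  refine ⟨φ, ?_⟩
  have : Tendsto (fun k => ∫⁻ ω, min 1 (u (ns (φ k)) ω) ∂ν) atTop (𝓝 (∫⁻ _, 0 ∂ν)) := by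
    refine tendsto_lintegral_of_dominated_convergence' (fun _ => 1)
      (fun k => aemeasurable_const.min ((hu _).mono_ac hν))
      (fun k => ae_of_all _ fun ω => min_le_left _ _) (by simp) ?_
    filter_upwards [hν.ae_le hφ] with ω hω
    have := (tendsto_const_nhds (x := (1 : ℝ≥0∞))).min hω
    simpa using this
  simpa using this

lemma sub_mem (hX : IsQBFS μ X) {ξ η : Ω → 𝕜} (hξ : ξ ∈ X.carrier) (hη : η ∈ X.carrier) :
    ξ - η ∈ X.carrier := by
  have := hX.add_mem _ hξ _ (hX.smul_mem (-1) _ hη)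
  rwa [neg_one_smul, ← sub_eq_add_neg] at this

lemma eNrm_sub_comm (hX : IsQBFS μ X) {ξ η : Ω → 𝕜} (hξ : ξ ∈ X.carrier) (hη : η ∈ X.carrier) :
    eNrm X (ξ - η) = eNrm X (η - ξ) := by
  rw [eNrm_of_mem (hX.sub_mem hξ hη), eNrm_of_mem (hX.sub_mem hη hξ),
    hX.nrm_congr_norm (hX.sub_mem hξ hη) (ae_of_all _ fun ω => ?_) (hX.sub_mem hη hξ)]
  simp [norm_sub_rev]

end IsQBFS

lemma aestronglyMeasurable_uncurry_simpleFunc {α : Type*} [MeasurableSpace α] {ρ : Measure α}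
    [SFinite ρ] [SFinite μ] (s : SimpleFunc α (Ω → 𝕜)) (hs : ∀ x, AEStronglyMeasurable (s x) μ) :
    AEStronglyMeasurable (Function.uncurry fun x => s x) (ρ.prod μ) := by
  classical
  have h : (Function.uncurry fun x => s x) = fun z : α × Ω => ∑ v ∈ s.range,
      ((s ⁻¹' {v}) ×ˢ (univ : Set Ω)).indicator (fun z => v z.2) z := by
    ext ⟨x, ω⟩
    rw [Finset.sum_eq_single (s x)]
    · simp
    · intro v _ hv
      simp [hv.symm]
    · intro h
      exact absurd (SimpleFunc.mem_range_self s x) h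
  rw [h]
  refine Finset.aestronglyMeasurable_fun_sum _ fun v hv => ?_
  obtain ⟨x, rfl⟩ := SimpleFunc.mem_range.1 hv
  exact (hs x).comp_snd.indicator ((s.measurableSet_preimage _).prod MeasurableSet.univ)

/-- For a strongly measurable `f`, simple functions converging to `f` in quasi-norm have a
subsequence which converges jointly almost everywhere on sets of finite measure. -/
lemma exists_subseq_ae_prod_tendsto [SigmaFinite μ] (hX : IsQBFS μ X) {p : ℝ} (hp : 0 < p)
    (hc : PConvex X p) {f : (Fin d → ℝ) → Ω → 𝕜}
    (hfm : AEStronglyMeasurable (Function.uncurry f) ((volume : Measure (Fin d → ℝ)).prod μ))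
    (hf : ∀ᵐ x, f x ∈ X.carrier) {s : ℕ → SimpleFunc (Fin d → ℝ) (Ω → 𝕜)}
    (hs : ∀ n x, s n x ∈ X.carrier)
    (hlim : ∀ᵐ x, Tendsto (fun n => X.nrm (s n x - f x)) atTop (𝓝 0))
    {P : Set (Fin d → ℝ)} (hP : volume P ≠ ∞) :
    ∃ φ : ℕ → ℕ, StrictMono φ ∧ ∀ᵐ z ∂((volume.restrict P).prod μ),
      Tendsto (fun k => s (φ k) z.1 z.2) atTop (𝓝 (f z.1 z.2)) := by
  set ρ : Measure (Fin d → ℝ) := volume.restrict P with hρ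
  have : IsFiniteMeasure ρ := ⟨by simpa [hρ] using hP.lt_top⟩
  set ν := μ.toFinite
  have hνμ : ν ≪ μ := toFinite_absolutelyContinuous μ
  have hac : ρ.prod ν ≪ volume.prod μ :=
    Measure.AbsolutelyContinuous.prod Measure.absolutelyContinuous_restrict hνμ
  have hac' : ρ.prod μ ≪ ρ.prod ν :=
    Measure.AbsolutelyContinuous.prod (Measure.AbsolutelyContinuous.refl ρ)
      (absolutelyContinuous_toFinite μ)
  set G : ℕ → (Fin d → ℝ) × Ω → ℝ≥0∞ := fun n z => min 1 ‖s n z.1 z.2 - f z.1 z.2‖ₑ with hG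
  have hGm : ∀ n, AEMeasurable (G n) (ρ.prod ν) := fun n => by
    have h1 := aestronglyMeasurable_uncurry_simpleFunc (ρ := ρ) (μ := ν) (s n)
      fun x => (hX.meas _ (hs n x)).mono_ac hνμ
    exact aemeasurable_const.min (h1.sub (hfm.mono_ac hac)).enorm
  have hGi : Tendsto (fun n => ∫⁻ z, G n z ∂(ρ.prod ν)) atTop (𝓝 0) := by
    have h1 : ∀ n, ∫⁻ z, G n z ∂(ρ.prod ν) = ∫⁻ x, ∫⁻ ω, G n (x, ω) ∂ν ∂ρ := fun n =>
      lintegral_prod _ (hGm n)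
    simp only [h1]
    have : Tendsto (fun n => ∫⁻ x, ∫⁻ ω, G n (x, ω) ∂ν ∂ρ) atTop (𝓝 (∫⁻ _, 0 ∂ρ)) := by
      refine tendsto_lintegral_of_dominated_convergence' (fun _ => ν univ)
        (fun n => (hGm n).lintegral_prod_right') (fun n => ae_of_all _ fun x => ?_) ?_ ?_
      · calc ∫⁻ ω, G n (x, ω) ∂ν ≤ ∫⁻ _, 1 ∂ν := lintegral_mono fun ω => min_le_left _ _
          _ = ν univ := by simp
      · rw [lintegral_const]
        exact ENNReal.mul_ne_top (measure_ne_top _ _) (measure_ne_top _ _)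
      · filter_upwards [ae_restrict_of_ae hf, ae_restrict_of_ae hlim] with x hx1 hx2
        have hm := fun n => hX.sub_mem (hs n x) hx1
        refine hX.tendsto_lintegral_min_one hp hc (u := fun n ω => ‖s n x ω - f x ω‖ₑ)
          (fun n => (hX.meas _ (hm n)).enorm) ?_ hνμ
        have h2 := ENNReal.tendsto_ofReal hx2
        rw [ENNReal.ofReal_zero] at h2
        refine h2.congr fun n => ?_
        rw [← eNrm_of_mem (hm n), ← hX.eNrmPos_enorm (hX.meas _ (hm n))]
        rfl
    simpa using this
  obtain ⟨φ, hφ, hφ'⟩ := extraction_forall_of_eventually'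
    (P := fun k n => ∫⁻ z, G n z ∂(ρ.prod ν) ≤ (2⁻¹ : ℝ≥0∞) ^ k) fun k => by
      have : (0 : ℝ≥0∞) < 2⁻¹ ^ k := ENNReal.pow_pos (by simp) _
      exact eventually_atTop.1 (hGi.eventually (ge_mem_nhds this))
  refine ⟨φ, hφ, hac'.ae_le ?_⟩
  have hsum : ∫⁻ z, ∑' k, G (φ k) z ∂(ρ.prod ν) ≠ ∞ := by
    rw [lintegral_tsum fun k => hGm _]
    refine ((ENNReal.tsum_le_tsum hφ').trans_lt ?_).ne
    rw [ENNReal.tsum_geometric, ENNReal.one_sub_inv_two, inv_inv]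
    simp
  filter_upwards [ae_lt_top' (AEMeasurable.tsum fun k => hGm (φ k)) hsum] with z hz
  have h1 := ENNReal.tendsto_atTop_zero_of_tsum_ne_top hz.ne
  rw [tendsto_iff_edist_tendsto_0]
  refine h1.congr' ?_
  filter_upwards [h1.eventually (gt_mem_nhds (zero_lt_one (α := ℝ≥0∞)))] with k hk
  rw [edist_eq_enorm_sub]
  rcases min_lt_iff.1 hk with h | h
  · exact absurd h (lt_irrefl _)
  · exact min_eq_right h.le

/-- The lattice-valued `r`-average of a simple function is controlled by `r`-convexity. -/
lemma eNrmPos_lintegral_simpleFunc_le {α : Type*} [MeasurableSpace α] {ρ : Measure α}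
    [IsFiniteMeasure ρ] (hX : IsQBFS μ X) {r : ℝ} (hr : 0 < r) (hc : PConvex X r)
    (t : SimpleFunc α (Ω → 𝕜)) (ht : ∀ x, t x ∈ X.carrier) :
    eNrmPos μ X (fun ω => (∫⁻ x, ‖t x ω‖ₑ ^ r ∂ρ) ^ (1 / r))
      ≤ (∫⁻ x, eNrm X (t x) ^ r ∂ρ) ^ (1 / r) := by
  have hint : ∀ g : (Ω → 𝕜) → ℝ≥0∞, ∫⁻ x, g (t x) ∂ρ = ∑ v ∈ t.range, g v * ρ (t ⁻¹' {v}) := by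
    intro g
    rw [← SimpleFunc.map_lintegral, ← SimpleFunc.lintegral_eq_lintegral]
    rfl
  set c : (Ω → 𝕜) → ℝ≥0 := fun v => (ρ (t ⁻¹' {v}) ^ (1 / r)).toNNReal
  have hcc : ∀ v, ((c v : ℝ≥0) : ℝ≥0∞) ^ r = ρ (t ⁻¹' {v}) := fun v => by
    rw [ENNReal.coe_toNNReal (ENNReal.rpow_ne_top_of_nonneg (by positivity) (measure_ne_top _ _)),
      ← ENNReal.rpow_mul, one_div_mul_cancel hr.ne', ENNReal.rpow_one]
  have hv : ∀ v ∈ t.range, v ∈ X.carrier := fun v hv => by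
    obtain ⟨x, rfl⟩ := SimpleFunc.mem_range.1 hv
    exact ht x
  have h1 : ∀ ω, ∫⁻ x, ‖t x ω‖ₑ ^ r ∂ρ = ∑ v ∈ t.range, ((c v : ℝ≥0∞) * ‖v ω‖ₑ) ^ r := by
    intro ω
    rw [hint fun v => ‖v ω‖ₑ ^ r]
    refine Finset.sum_congr rfl fun v _ => ?_
    rw [ENNReal.mul_rpow_of_nonneg _ _ hr.le, hcc, mul_comm]
  simp only [h1]
  refine (hX.eNrmPos_sum_rpow_le hr hc _ fun v hv' =>
    ((hX.meas _ (hv v hv')).enorm).const_mul _).trans (le_of_eq ?_)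
  rw [hint fun v => eNrm X v ^ r]
  congr 1
  refine Finset.sum_congr rfl fun v hv' => ?_
  rw [hX.eNrmPos_const_mul, hX.eNrmPos_enorm (hX.meas _ (hv v hv')),
    ENNReal.mul_rpow_of_nonneg _ _ hr.le, hcc, mul_comm]

end

/-! ### Integral form of convexity -/

section

variable {Ω 𝕜 : Type*} [MeasurableSpace Ω] [RCLike 𝕜] {μ : Measure Ω} {X : FnSpace Ω 𝕜} {d : ℕ}

lemma rpow_liminf {r : ℝ} (hr : 0 < r) (a : ℕ → ℝ≥0∞) :
    (liminf a atTop) ^ r = liminf (fun n => a n ^ r) atTop := by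
  refine OrderIso.liminf_apply (ENNReal.orderIsoRpow r hr) ?_ ?_ ?_ ?_ <;> isBoundedDefault

lemma aemeasurable_avg [SFinite μ] {f : (Fin d → ℝ) → Ω → 𝕜}
    (hf : AEStronglyMeasurable (Function.uncurry f) ((volume : Measure (Fin d → ℝ)).prod μ))
    (r : ℝ) (P : Set (Fin d → ℝ)) : AEMeasurable (fun ω => avg r P fun y => ‖f y ω‖ₑ) μ := by
  have hac : (volume.restrict P).prod μ ≪ (volume : Measure (Fin d → ℝ)).prod μ :=
    Measure.AbsolutelyContinuous.prod Measure.absolutelyContinuous_restrict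
      (Measure.AbsolutelyContinuous.refl μ)
  have h : AEMeasurable (fun z : (Fin d → ℝ) × Ω => ‖f z.1 z.2‖ₑ ^ r)
      ((volume.restrict P).prod μ) := ((hf.mono_ac hac).enorm).pow_const r
  exact (h.lintegral_prod_left'.div_const _).pow_const _

/-- Where `h = liminf ‖s k‖` vanishes so does `f`; elsewhere `‖s k‖` is eventually at most
`4 K² h`; and `h ≤ K ‖f‖`. -/
lemma liminf_eNrm_facts {K : ℝ≥0} (hK : 1 ≤ K)
    (hKX : ∀ ξ η : Ω → 𝕜, eNrm X (ξ + η) ≤ K * (eNrm X ξ + eNrm X η))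
    (hX : IsQBFS μ X) {s : ℕ → Ω → 𝕜} {ξ : Ω → 𝕜} (hξ : ξ ∈ X.carrier)
    (hs : ∀ n, s n ∈ X.carrier) (hlim : Tendsto (fun n => eNrm X (s n - ξ)) atTop (𝓝 0)) :
    liminf (fun n => eNrm X (s n)) atTop ≤ K * eNrm X ξ ∧
    (liminf (fun n => eNrm X (s n)) atTop = 0 → eNrm X ξ = 0) ∧
    (liminf (fun n => eNrm X (s n)) atTop ≠ 0 → ∀ᶠ n in atTop,
      eNrm X (s n) ≤ 4 * K ^ 2 * liminf (fun n => eNrm X (s n)) atTop) := by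
  set h := liminf (fun n => eNrm X (s n)) atTop with hh
  set a := eNrm X ξ with ha
  have hat : a ≠ ∞ := by rw [ha, eNrm_of_mem hξ]; exact ENNReal.ofReal_ne_top
  have hK0 : (K : ℝ≥0∞) ≠ 0 := by exact_mod_cast (zero_lt_one.trans_le hK).ne'
  have h1 : ∀ n, eNrm X (s n) ≤ K * (a + eNrm X (s n - ξ)) := fun n => by
    have := hKX ξ (s n - ξ)
    rwa [add_sub_cancel] at this
  have h2 : ∀ n, a ≤ K * (eNrm X (s n) + eNrm X (s n - ξ)) := fun n => by
    have := hKX (s n) (ξ - s n)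
    rwa [add_sub_cancel, hX.eNrm_sub_comm hξ (hs n)] at this
  have hi : h ≤ K * a := by
    have ht : Tendsto (fun n => (K : ℝ≥0∞) * (a + eNrm X (s n - ξ))) atTop
        (𝓝 (K * (a + 0))) :=
      ENNReal.Tendsto.const_mul (tendsto_const_nhds.add hlim) (Or.inr ENNReal.coe_ne_top)
    rw [add_zero] at ht
    exact (liminf_le_liminf (Eventually.of_forall h1)).trans ht.liminf_eq.le
  -- for `a ≠ 0` the error is eventually at most `a / (2 K)` and can be absorbed
  have hii : a ≠ 0 → a ≤ 2 * K * h := fun ha0 => by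
    have hpos : 0 < a / (2 * K) :=
      ENNReal.div_pos ha0 (ENNReal.mul_ne_top (by simp) ENNReal.coe_ne_top)
    have hev : ∀ᶠ n in atTop, a / (2 * K) ≤ eNrm X (s n) := by
      filter_upwards [hlim.eventually (ge_mem_nhds hpos)] with n hn
      have h3 : a ≤ K * eNrm X (s n) + a / 2 := by
        refine (h2 n).trans ?_
        rw [mul_add]
        gcongr
        calc (K : ℝ≥0∞) * eNrm X (s n - ξ) ≤ K * (a / (2 * K)) := by gcongr
          _ = a / 2 := by
            rw [mul_comm (2 : ℝ≥0∞), ← mul_div_assoc,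
              ENNReal.mul_div_mul_left _ _ hK0 ENNReal.coe_ne_top]
      have h4 : a / 2 ≤ K * eNrm X (s n) := by
        have h5 : a / 2 + a / 2 ≤ K * eNrm X (s n) + a / 2 := by rwa [ENNReal.add_halves]
        exact (ENNReal.add_le_add_iff_right (ENNReal.div_ne_top hat (by simp))).1 h5
      refine ENNReal.div_le_of_le_mul ?_
      calc a = a / 2 + a / 2 := (ENNReal.add_halves a).symm
        _ ≤ K * eNrm X (s n) + K * eNrm X (s n) := add_le_add h4 h4
        _ = eNrm X (s n) * (2 * K) := by ring
    have h6 : a / (2 * K) ≤ h := le_liminf_of_le (by isBoundedDefault) hev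
    have := (ENNReal.div_le_iff (by simp [hK0]) (ENNReal.mul_ne_top (by simp)
      ENNReal.coe_ne_top)).1 h6
    rwa [mul_comm] at this
  refine ⟨hi, fun h0 => ?_, fun h0 => ?_⟩
  · by_contra ha0
    have := hii ha0
    rw [h0, mul_zero] at this
    exact ha0 (le_antisymm this zero_le)
  · have ha0 : a ≠ 0 := fun ha0 => h0 (by simpa [ha0] using hi)
    filter_upwards [hlim.eventually (ge_mem_nhds (pos_iff_ne_zero.2 ha0))] with n hn
    calc eNrm X (s n) ≤ K * (a + a) := (h1 n).trans (by gcongr)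
      _ = 2 * K * a := by ring
      _ ≤ 2 * K * (2 * K * h) := by gcongr; exact hii ha0
      _ = 4 * K ^ 2 * h := by ring

/-- Integral form of `r`-convexity, up to a constant. Simple functions converging to `f` are
truncated where their norm is much larger than the lower limit `h` of these norms; then Fatou's
lemma in `x`, the Fatou property of `X` and `r`-convexity give the estimate. -/
theorem exists_eNrmPos_avg_le [SigmaFinite μ] (hX : IsQBFS μ X) {r : ℝ} (hr : 0 < r)
    (hc : PConvex X r) : ∃ c : ℝ≥0, ∀ f : (Fin d → ℝ) → Ω → 𝕜, StronglyMeas μ X f →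
      ∀ P : Set (Fin d → ℝ), volume P ≠ 0 → volume P ≠ ∞ →
        eNrmPos μ X (fun ω => avg r P fun y => ‖f y ω‖ₑ) ≤ c * avg r P fun y => eNrm X (f y) := by
  obtain ⟨K, hK, hKX⟩ := hX.exists_eNrm_add_le
  refine ⟨4 * K ^ 2 * K, fun f ⟨hfm, hf, s, hs, hlim⟩ P hP0 hP => ?_⟩
  set ρ : Measure (Fin d → ℝ) := volume.restrict P with hρ
  have hfin : IsFiniteMeasure ρ := ⟨by simpa [hρ] using hP.lt_top⟩
  obtain ⟨φ, hφ, hae⟩ := exists_subseq_ae_prod_tendsto hX hr hc hfm hf hs hlim hP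
  set H : ℕ → (Fin d → ℝ) → ℝ≥0∞ := fun k x => eNrm X (s (φ k) x) with hH
  have hHm : ∀ k, Measurable (H k) := fun k => ((s (φ k)).map (eNrm X)).measurable
  set h : (Fin d → ℝ) → ℝ≥0∞ := fun x => liminf (fun k => H k x) atTop with hh
  have hhm : Measurable h := Measurable.liminf hHm
  have hfacts : ∀ᵐ x ∂ρ, h x ≤ K * eNrm X (f x) ∧ (h x = 0 → eNrm X (f x) = 0) ∧
      (h x ≠ 0 → ∀ᶠ k in atTop, H k x ≤ 4 * K ^ 2 * h x) := by
    filter_upwards [ae_restrict_of_ae hf, ae_restrict_of_ae hlim] with x hx1 hx2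
    refine liminf_eNrm_facts hK hKX hX hx1 (fun k => hs (φ k) x) ?_
    have h2 := (ENNReal.tendsto_ofReal hx2).comp hφ.tendsto_atTop
    rw [ENNReal.ofReal_zero] at h2
    exact h2.congr fun k => (eNrm_of_mem (hX.sub_mem (hs (φ k) x) hx1)).symm
  set A : ℕ → Set (Fin d → ℝ) := fun k => {x | H k x ≤ 4 * K ^ 2 * h x} with hA
  have hAm : ∀ k, MeasurableSet (A k) := fun k =>
    measurableSet_le (hHm k) (hhm.const_mul _)
  set t : ℕ → SimpleFunc (Fin d → ℝ) (Ω → 𝕜) := fun k => (s (φ k)).restrict (A k) with ht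
  have htx : ∀ k x, t k x = (A k).indicator (s (φ k)) x := fun k x =>
    SimpleFunc.restrict_apply _ (hAm k) x
  have htmem : ∀ k x, t k x ∈ X.carrier := fun k x => by
    rw [htx]
    by_cases hx : x ∈ A k
    · simpa [hx] using hs (φ k) x
    · simpa [hx] using hX.zero_mem
  have hac : ρ.prod μ ≪ (volume : Measure (Fin d → ℝ)).prod μ :=
    Measure.AbsolutelyContinuous.prod Measure.absolutelyContinuous_restrict
      (Measure.AbsolutelyContinuous.refl μ)
  have hfm' : AEStronglyMeasurable (Function.uncurry f) (ρ.prod μ) := hfm.mono_ac hac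
  -- `f` vanishes almost everywhere on `{h = 0} × Ω`
  have hzero : ∀ᵐ z ∂(ρ.prod μ), h z.1 = 0 → f z.1 z.2 = 0 := by
    have hZ : MeasurableSet {x | h x = 0} := hhm (measurableSet_singleton 0)
    have hm : AEMeasurable (fun z : (Fin d → ℝ) × Ω =>
        ({x | h x = 0} ×ˢ (univ : Set Ω)).indicator (fun z => ‖f z.1 z.2‖ₑ) z) (ρ.prod μ) :=
      hfm'.enorm.indicator (hZ.prod MeasurableSet.univ)
    have h0 : ∫⁻ z, ({x | h x = 0} ×ˢ (univ : Set Ω)).indicator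
        (fun z => ‖f z.1 z.2‖ₑ) z ∂(ρ.prod μ) = 0 := by
      rw [lintegral_prod _ hm]
      refine (lintegral_congr_ae ?_).trans lintegral_zero
      filter_upwards [hfacts, ae_restrict_of_ae hf] with x hx hxm
      by_cases hx0 : h x = 0
      · have h1 := hx.2.1 hx0
        rw [eNrm_of_mem hxm, ENNReal.ofReal_eq_zero] at h1
        have h2 := (hX.nrm_eq_zero _ hxm).1 (le_antisymm h1 (hX.nrm_nonneg _ hxm))
        refine (lintegral_congr_ae ?_).trans lintegral_zero
        filter_upwards [h2] with ω hω
        simp [hω]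
      · simp [hx0]
    filter_upwards [(lintegral_eq_zero_iff' hm).1 h0] with z hz hz0
    simpa [hz0] using hz
  have hpt : ∀ᵐ z ∂(ρ.prod μ), ‖f z.1 z.2‖ₑ ^ r ≤ liminf (fun k => ‖t k z.1 z.2‖ₑ ^ r) atTop := by
    filter_upwards [hzero, hae, Measure.quasiMeasurePreserving_fst.ae hfacts] with z h1 h2 h3
    by_cases h0 : h z.1 = 0
    · simp [h1 h0, hr]
    have h4 : Tendsto (fun k => ‖s (φ k) z.1 z.2‖ₑ ^ r) atTop (𝓝 (‖f z.1 z.2‖ₑ ^ r)) :=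
      (ENNReal.continuous_rpow_const (y := r)).continuousAt.tendsto.comp h2.enorm
    rw [← h4.liminf_eq]
    refine (liminf_congr ?_).le
    filter_upwards [h3.2.2 h0] with k hk
    have hk' : z.1 ∈ A k := hk
    rw [htx, indicator_of_mem hk']
  have hF : ∀ᵐ ω ∂μ, (∫⁻ x, ‖f x ω‖ₑ ^ r ∂ρ) ^ (1 / r)
      ≤ liminf (fun k => (∫⁻ x, ‖t k x ω‖ₑ ^ r ∂ρ) ^ (1 / r)) atTop := by
    have hsw := Measure.measurePreserving_swap (μ := μ) (ν := ρ) |>.quasiMeasurePreserving.ae hpt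
    filter_upwards [Measure.ae_ae_of_ae_prod hsw] with ω hω
    rw [← rpow_liminf (by positivity)]
    refine ENNReal.rpow_le_rpow ?_ (by positivity)
    refine (lintegral_mono_ae hω).trans (lintegral_liminf_le fun k => ?_)
    exact ((t k).map fun v : Ω → 𝕜 => ‖v ω‖ₑ ^ r).measurable
  have htm : ∀ k, AEMeasurable (fun ω => (∫⁻ x, ‖t k x ω‖ₑ ^ r ∂ρ) ^ (1 / r)) μ := fun k => by
    have h1 := aestronglyMeasurable_uncurry_simpleFunc (ρ := ρ) (t k)
      fun x => hX.meas _ (htmem k x)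
    exact ((h1.enorm.pow_const r).lintegral_prod_left').pow_const _
  have hFm : AEMeasurable (fun ω => (∫⁻ x, ‖f x ω‖ₑ ^ r ∂ρ) ^ (1 / r)) μ :=
    ((hfm'.enorm.pow_const r).lintegral_prod_left').pow_const _
  have hbound : ∀ k, eNrmPos μ X (fun ω => (∫⁻ x, ‖t k x ω‖ₑ ^ r ∂ρ) ^ (1 / r))
      ≤ ((4 * K ^ 2 * K : ℝ≥0) : ℝ≥0∞) * (∫⁻ x, eNrm X (f x) ^ r ∂ρ) ^ (1 / r) := fun k => by
    refine (eNrmPos_lintegral_simpleFunc_le hX hr hc (t k) (htmem k)).trans ?_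
    have h1 : ∫⁻ x, eNrm X (t k x) ^ r ∂ρ
        ≤ ((4 * K ^ 2 * K : ℝ≥0) : ℝ≥0∞) ^ r * ∫⁻ x, eNrm X (f x) ^ r ∂ρ := by
      rw [← lintegral_const_mul' _ _ (ENNReal.rpow_ne_top_of_nonneg hr.le ENNReal.coe_ne_top)]
      refine lintegral_mono_ae ?_
      filter_upwards [hfacts] with x hx
      rw [← ENNReal.mul_rpow_of_nonneg _ _ hr.le]
      refine ENNReal.rpow_le_rpow ?_ hr.le
      rw [htx]
      by_cases hxA : x ∈ A k
      · rw [indicator_of_mem hxA]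
        calc eNrm X (s (φ k) x) ≤ 4 * K ^ 2 * h x := hxA
          _ ≤ 4 * K ^ 2 * (K * eNrm X (f x)) := by gcongr; exact hx.1
          _ = _ := by push_cast; ring
      · rw [indicator_of_notMem hxA, eNrm_of_mem hX.zero_mem,
          (hX.nrm_eq_zero _ hX.zero_mem).2 (ae_eq_refl _), ENNReal.ofReal_zero]
        exact zero_le
    refine (ENNReal.rpow_le_rpow h1 (by positivity)).trans (le_of_eq ?_)
    rw [ENNReal.mul_rpow_of_nonneg _ _ (by positivity), ← ENNReal.rpow_mul,
      mul_one_div_cancel hr.ne', ENNReal.rpow_one]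
  have hmain : eNrmPos μ X (fun ω => (∫⁻ x, ‖f x ω‖ₑ ^ r ∂ρ) ^ (1 / r))
      ≤ ((4 * K ^ 2 * K : ℝ≥0) : ℝ≥0∞) * (∫⁻ x, eNrm X (f x) ^ r ∂ρ) ^ (1 / r) := by
    refine (hX.eNrmPos_mono hFm hF).trans ((hX.eNrmPos_liminf_le htm).trans ?_)
    refine (liminf_le_liminf (Eventually.of_forall hbound)).trans ?_
    rw [liminf_const]
  set v : ℝ≥0 := ((volume P)⁻¹ ^ (1 / r)).toNNReal
  have hv : ∀ F : (Fin d → ℝ) → ℝ≥0∞, avg r P F = v * (∫⁻ x, F x ^ r ∂ρ) ^ (1 / r) := fun F => by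
    rw [ENNReal.coe_toNNReal (ENNReal.rpow_ne_top_of_nonneg (by positivity)
      (ENNReal.inv_ne_top.2 hP0)), ← ENNReal.mul_rpow_of_nonneg _ _ (by positivity), avg,
      mul_comm, div_eq_mul_inv]
  simp only [hv]
  rw [hX.eNrmPos_const_mul, mul_left_comm]
  gcongr

end

/-! ### Translated dyadic grids -/

section

variable {d : ℕ}

/-- The index of the cube of side length `2 ^ (-k)` containing `x` in the standard dyadic grid
translated by `τ`. -/
noncomputable def gridIdx (τ : Fin d → ℝ) (k : ℤ) (x : Fin d → ℝ) : Fin d → ℤ :=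
  fun i => ⌊(2 : ℝ) ^ k * (x i - τ i)⌋

/-- The cube of side length `2 ^ (-k)` containing `x` in the standard dyadic grid translated
by `τ`. -/
def gridCube (τ : Fin d → ℝ) (k : ℤ) (x : Fin d → ℝ) : Set (Fin d → ℝ) :=
  {y | gridIdx τ k y = gridIdx τ k x}

/-- The standard dyadic grid translated by `τ`. -/
def grid (τ : Fin d → ℝ) : Set (Set (Fin d → ℝ)) :=
  {Q | ∃ k x, Q = gridCube τ k x}

lemma mem_gridCube_self (τ : Fin d → ℝ) (k : ℤ) (x : Fin d → ℝ) : x ∈ gridCube τ k x := rfl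

lemma gridCube_eq_of_mem {τ : Fin d → ℝ} {k : ℤ} {x y : Fin d → ℝ} (h : y ∈ gridCube τ k x) :
    gridCube τ k y = gridCube τ k x := by
  have h' : gridIdx τ k y = gridIdx τ k x := h
  simp only [gridCube, h']

lemma gridIdx_eq_iff {τ : Fin d → ℝ} {k : ℤ} {x : Fin d → ℝ} {n : Fin d → ℤ} :
    gridIdx τ k x = n ↔ ∀ i, τ i + 2 ^ (-k) * n i ≤ x i ∧ x i < τ i + 2 ^ (-k) * (n i + 1) := by
  have hk : (0 : ℝ) < 2 ^ k := by positivity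
  simp only [funext_iff, gridIdx, Int.floor_eq_iff, zpow_neg]
  refine forall_congr' fun i => and_congr ?_ ?_
  · rw [← le_sub_iff_add_le', inv_mul_le_iff₀ hk]
  · rw [← sub_lt_iff_lt_add' (a := x i), lt_inv_mul_iff₀ hk]

lemma gridCube_eq_pi (τ : Fin d → ℝ) (k : ℤ) (x : Fin d → ℝ) :
    gridCube τ k x = univ.pi fun i => Ico (τ i + 2 ^ (-k) * gridIdx τ k x i)
      (τ i + 2 ^ (-k) * gridIdx τ k x i + 2 ^ (-k)) := by
  ext y
  simp only [gridCube, Set.mem_ofPred_eq, gridIdx_eq_iff, Set.mem_pi, mem_univ, true_imp_iff,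
    mem_Ico, mul_add, mul_one, add_assoc]

lemma gridCube_mono (τ : Fin d → ℝ) {k l : ℤ} (h : k ≤ l) (x : Fin d → ℝ) :
    gridCube τ l x ⊆ gridCube τ k x := by
  obtain ⟨j, rfl⟩ := Int.le.dest h
  intro y hy
  have hy' : gridIdx τ (k + j) y = gridIdx τ (k + j) x := hy
  have key : ∀ z : Fin d → ℝ, ∀ i, gridIdx τ k z i = gridIdx τ (k + j) z i / (2 ^ j : ℕ) := by
    intro z i
    simp only [gridIdx]
    rw [← Int.floor_div_natCast]
    congr 1
    rw [zpow_add₀ two_ne_zero, zpow_natCast]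
    push_cast
    field_simp
  change gridIdx τ k y = gridIdx τ k x
  ext i
  rw [key, key, hy']

lemma measurableSet_gridCube (τ : Fin d → ℝ) (k : ℤ) (x : Fin d → ℝ) :
    MeasurableSet (gridCube τ k x) := by
  rw [gridCube_eq_pi]
  exact MeasurableSet.univ_pi fun i => measurableSet_Ico

lemma volume_gridCube (τ : Fin d → ℝ) (k : ℤ) (x : Fin d → ℝ) :
    volume (gridCube τ k x) = ENNReal.ofReal (2 ^ (-k)) ^ d := by
  rw [gridCube_eq_pi, volume_pi_pi]
  simp

lemma volume_gridCube_succ (τ : Fin d → ℝ) (k : ℤ) (x y : Fin d → ℝ) :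
    volume (gridCube τ k x) = 2 ^ d * volume (gridCube τ (k + 1) y) := by
  rw [volume_gridCube, volume_gridCube, ← mul_pow]
  congr 1
  have h2 : (2 : ℝ≥0∞) = ENNReal.ofReal 2 := by simp
  rw [h2, ← ENNReal.ofReal_mul (by norm_num), neg_add, zpow_add₀ two_ne_zero]
  congr 1
  norm_num
  ring

lemma gridCube_mem_cubes (τ : Fin d → ℝ) (k : ℤ) (x : Fin d → ℝ) : gridCube τ k x ∈ cubes d :=
  ⟨_, 2 ^ (-k), by positivity, gridCube_eq_pi τ k x⟩

lemma grid_subset_cubes (τ : Fin d → ℝ) : grid τ ⊆ cubes d := by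
  rintro _ ⟨k, x, rfl⟩
  exact gridCube_mem_cubes τ k x

lemma dyadicCubes_subset_grid : dyadicCubes d ⊆ grid (0 : Fin d → ℝ) := by
  rintro _ ⟨k, n, rfl⟩
  refine ⟨k, fun i => 2 ^ (-k) * n i, ?_⟩
  have h : gridIdx (0 : Fin d → ℝ) k (fun i => 2 ^ (-k) * n i) = n := by
    rw [gridIdx_eq_iff]
    intro i
    have : (0 : ℝ) < 2 ^ k := by positivity
    simp [mul_add, this]
  rw [gridCube_eq_pi, h]
  simp [mul_add]

lemma volume_ne_zero_of_mem_cubes {Q : Set (Fin d → ℝ)} (hQ : Q ∈ cubes d) : volume Q ≠ 0 := by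
  obtain ⟨a, l, hl, rfl⟩ := hQ
  rw [volume_pi_pi]
  simp [Finset.prod_const, hl]

lemma volume_ne_top_of_mem_cubes {Q : Set (Fin d → ℝ)} (hQ : Q ∈ cubes d) : volume Q ≠ ∞ := by
  obtain ⟨a, l, hl, rfl⟩ := hQ
  rw [volume_pi_pi]
  simp [Finset.prod_const]

lemma measurableSet_of_mem_cubes {Q : Set (Fin d → ℝ)} (hQ : Q ∈ cubes d) : MeasurableSet Q := by
  obtain ⟨a, l, hl, rfl⟩ := hQ
  exact MeasurableSet.univ_pi fun i => measurableSet_Ico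

lemma finite_gridCube_of_subset (τ : Fin d → ℝ) (k : ℤ) (x : Fin d → ℝ) (l : ℤ) :
    (gridCube τ l '' gridCube τ k x).Finite := by
  have h : (gridIdx τ l '' gridCube τ k x).Finite := by
    refine (Set.finite_Icc (fun i => ⌊(2 : ℝ) ^ l * (2 ^ (-k) * gridIdx τ k x i)⌋)
      (fun i => ⌊(2 : ℝ) ^ l * (2 ^ (-k) * (gridIdx τ k x i + 1))⌋)).subset ?_
    rintro _ ⟨y, hy, rfl⟩
    have hy' := gridIdx_eq_iff.1 (show gridIdx τ k y = gridIdx τ k x from hy)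
    have hl : (0 : ℝ) < 2 ^ l := by positivity
    refine ⟨fun i => Int.floor_le_floor ?_, fun i => Int.floor_le_floor ?_⟩
    · exact mul_le_mul_of_nonneg_left (by linarith [(hy' i).1]) hl.le
    · exact mul_le_mul_of_nonneg_left (by linarith [(hy' i).2]) hl.le
  refine (h.image fun n => {y | gridIdx τ l y = n}).subset ?_
  rintro _ ⟨y, hy, rfl⟩
  exact ⟨_, ⟨y, hy, rfl⟩, rfl⟩

/-- Two cubes of the same grid are nested or disjoint. -/
lemma grid_nested {τ : Fin d → ℝ} {Q R : Set (Fin d → ℝ)} (hQ : Q ∈ grid τ) (hR : R ∈ grid τ)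
    {x : Fin d → ℝ} (hxQ : x ∈ Q) (hxR : x ∈ R) : Q ⊆ R ∨ R ⊆ Q := by
  obtain ⟨k, y, rfl⟩ := hQ
  obtain ⟨l, z, rfl⟩ := hR
  rw [← gridCube_eq_of_mem hxQ, ← gridCube_eq_of_mem hxR]
  rcases le_total k l with h | h
  · exact Or.inr (gridCube_mono τ h x)
  · exact Or.inl (gridCube_mono τ h x)

/-! ### Stopping cubes -/

/-- `σ` assigns to the points of `Q` the cells of a finite partition of `Q` into cubes of the grid
translated by `τ`; points outside `Q` are assigned the empty set. -/
structure IsCellMap (τ : Fin d → ℝ) (Q : Set (Fin d → ℝ))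
    (σ : SimpleFunc (Fin d → ℝ) (Set (Fin d → ℝ))) : Prop where
  eq_empty : ∀ y ∉ Q, σ y = ∅
  mem_self : ∀ y ∈ Q, y ∈ σ y
  subset : ∀ y ∈ Q, σ y ⊆ Q
  mem_grid : ∀ y ∈ Q, σ y ∈ grid τ
  eq_of_mem : ∀ y, ∀ z ∈ σ y, σ z = σ y

open scoped Classical in
/-- The number of subdivisions of the cube of level `k` containing `x` until either a bad cube or
the level `k + N` is reached. -/
noncomputable def stopTime (τ : Fin d → ℝ) (k : ℤ) (N : ℕ) (bad : Set (Fin d → ℝ) → Prop)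
    (x : Fin d → ℝ) : ℕ :=
  Nat.find (p := fun i : ℕ => N ≤ i ∨ bad (gridCube τ (k + i) x)) ⟨N, Or.inl le_rfl⟩

section stopTime

variable {τ : Fin d → ℝ} {k : ℤ} {N : ℕ} {bad : Set (Fin d → ℝ) → Prop} {x y : Fin d → ℝ}

lemma stopTime_spec : N ≤ stopTime τ k N bad x ∨ bad (gridCube τ (k + stopTime τ k N bad x) x) := by
  classical
  exact Nat.find_spec (p := fun i : ℕ => N ≤ i ∨ bad (gridCube τ (k + i) x)) ⟨N, Or.inl le_rfl⟩

lemma stopTime_le : stopTime τ k N bad x ≤ N := by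
  classical
  exact Nat.find_min' _ (Or.inl le_rfl)

lemma not_bad_of_lt_stopTime {i : ℕ} (h : i < stopTime τ k N bad x) :
    ¬ bad (gridCube τ (k + i) x) := by
  classical
  exact fun hb => Nat.find_min (p := fun i : ℕ => N ≤ i ∨ bad (gridCube τ (k + i) x))
    ⟨N, Or.inl le_rfl⟩ h (Or.inr hb)

lemma stopTime_eq_of_mem (h : y ∈ gridCube τ (k + stopTime τ k N bad x) x) :
    stopTime τ k N bad y = stopTime τ k N bad x := by
  classical
  have hc : ∀ i : ℕ, i ≤ stopTime τ k N bad x → gridCube τ (k + i) y = gridCube τ (k + i) x :=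
    fun i hi => gridCube_eq_of_mem (gridCube_mono τ (by gcongr) x h)
  refine le_antisymm (Nat.find_min' _ ?_) ?_
  · rw [hc _ le_rfl]
    exact stopTime_spec
  · by_contra hlt
    push Not at hlt
    rcases stopTime_spec (τ := τ) (k := k) (N := N) (bad := bad) (x := y) with h1 | h1
    · exact absurd (h1.trans_lt hlt) (not_lt.2 stopTime_le)
    · rw [hc _ hlt.le] at h1
      exact not_bad_of_lt_stopTime hlt h1

end stopTime

/-- The Calderón–Zygmund stopping cubes at height `θ`, inside a cube `Q` of level `k` and down to
level `k + N`. The averages over the cells are bounded because the parent of a stopping cube was not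
selected, and a cube of level at most `k + N` containing a point whose cell has a small average is
a union of cells. -/
lemma exists_cellMap (τ : Fin d → ℝ) (k : ℤ) (x₀ : Fin d → ℝ) (N : ℕ) {r : ℝ} (hr : 0 < r)
    (F : (Fin d → ℝ) → ℝ≥0∞) {θ : ℝ≥0∞} (hθ : avg r (gridCube τ k x₀) F ≤ θ) :
    ∃ σ : SimpleFunc (Fin d → ℝ) (Set (Fin d → ℝ)), IsCellMap τ (gridCube τ k x₀) σ ∧
      (∀ y ∈ gridCube τ k x₀, avg r (σ y) F ≤ (2 ^ d) ^ (1 / r) * θ) ∧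
      ∀ l ≤ k + N, ∀ z, gridCube τ l z ⊆ gridCube τ k x₀ → ∀ x ∈ gridCube τ l z,
        avg r (σ x) F ≤ θ → ∀ y ∈ gridCube τ l z, σ y ⊆ gridCube τ l z := by
  classical
  set Q := gridCube τ k x₀ with hQ
  set bad : Set (Fin d → ℝ) → Prop := fun P => θ < avg r P F
  set T := stopTime τ k N bad with hT
  set S : (Fin d → ℝ) → Set (Fin d → ℝ) := fun x => gridCube τ (k + T x) x with hS
  have hQx : ∀ y ∈ Q, gridCube τ k y = Q := fun y hy => gridCube_eq_of_mem hy
  have hSQ : ∀ y ∈ Q, S y ⊆ Q := fun y hy => by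
    rw [← hQx y hy]
    exact gridCube_mono τ (by simp) y
  have hSmem : ∀ y, y ∈ S y := fun y => mem_gridCube_self τ _ y
  have hScongr : ∀ y, ∀ z ∈ S y, S z = S y := fun y z hz => by
    have h1 : T z = T y := stopTime_eq_of_mem hz
    simp only [hS, h1]
    exact gridCube_eq_of_mem hz
  have hfin : (S '' Q).Finite := by
    refine (Set.Finite.biUnion (Set.finite_Iic N) fun i _ =>
      finite_gridCube_of_subset τ k x₀ (k + (i : ℕ))).subset ?_
    rintro _ ⟨y, hy, rfl⟩
    exact mem_biUnion (show T y ∈ Iic N from stopTime_le) ⟨y, hy, rfl⟩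
  set σf : (Fin d → ℝ) → Set (Fin d → ℝ) := fun y => if y ∈ Q then S y else ∅ with hσf
  have hσQ : ∀ y ∈ Q, σf y = S y := fun y hy => if_pos hy
  have hσQ' : ∀ y ∉ Q, σf y = ∅ := fun y hy => if_neg hy
  have hQm : MeasurableSet Q := measurableSet_gridCube τ k x₀
  let σ : SimpleFunc (Fin d → ℝ) (Set (Fin d → ℝ)) :=
    { toFun := σf
      measurableSet_fiber' := fun P => by
        by_cases hP : ∃ y ∈ Q, S y = P
        · obtain ⟨y, hy, rfl⟩ := hP
          have : σf ⁻¹' {S y} = S y := by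
            ext z
            simp only [mem_preimage, mem_singleton_iff]
            constructor
            · intro h
              by_cases hz : z ∈ Q
              · rw [hσQ z hz] at h
                exact h ▸ hSmem z
              · rw [hσQ' z hz] at h
                exact absurd (hSmem y) (h ▸ notMem_empty y)
            · intro h
              rw [hσQ z (hSQ y hy h), hScongr y z h]
          rw [this]
          exact measurableSet_gridCube τ _ y
        · push Not at hP
          by_cases he : P = ∅
          · have : σf ⁻¹' {P} = Qᶜ := by
              ext z
              simp only [mem_preimage, mem_singleton_iff, mem_compl_iff]
              constructor
              · intro h hz
                exact hP z hz (by rw [← hσQ z hz, h])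
              · intro h
                rw [hσQ' z h, he]
            rw [this]
            exact hQm.compl
          · have : σf ⁻¹' {P} = ∅ := by
              ext z
              simp only [mem_preimage, mem_singleton_iff, mem_empty_iff_false, iff_false]
              intro h
              by_cases hz : z ∈ Q
              · exact hP z hz (by rw [← hσQ z hz, h])
              · exact he (by rw [← h, hσQ' z hz])
            rw [this]
            exact MeasurableSet.empty
      finite_range' := by
        refine (hfin.union (Set.finite_singleton ∅)).subset ?_
        rintro _ ⟨y, rfl⟩
        by_cases hy : y ∈ Q
        · exact Or.inl ⟨y, hy, (hσQ y hy).symm⟩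
        · exact Or.inr (hσQ' y hy) }
  have hσ : ∀ y ∈ Q, σ y = S y := hσQ
  refine ⟨σ, ⟨hσQ', fun y hy => ?_, fun y hy => ?_, fun y hy => ?_, fun y z hz => ?_⟩,
    fun y hy => ?_, ?_⟩
  · rw [hσ y hy]; exact hSmem y
  · rw [hσ y hy]; exact hSQ y hy
  · rw [hσ y hy]; exact ⟨_, _, rfl⟩
  · by_cases hy : y ∈ Q
    · rw [hσ y hy] at hz ⊢
      rw [hσ z (hSQ y hy hz), hScongr y z hz]
    · have : σ y = ∅ := hσQ' y hy
      rw [this] at hz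
      exact absurd hz (notMem_empty z)
  · rw [hσ y hy]
    have h2d : (1 : ℝ≥0∞) ≤ (2 ^ d) ^ (1 / r) :=
      ENNReal.one_le_rpow (one_le_pow₀ (by norm_num)) (by positivity)
    rcases Nat.eq_zero_or_pos (T y) with h0 | hpos
    · have : S y = Q := by simp only [hS, h0]; simpa using hQx y hy
      rw [this]
      exact hθ.trans (le_mul_of_one_le_left' h2d)
    · -- the parent of a stopping cube is not bad
      obtain ⟨i, hi⟩ := Nat.exists_eq_succ_of_ne_zero hpos.ne'
      have hnb : ¬ bad (gridCube τ (k + i) y) :=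
        not_bad_of_lt_stopTime (show i < T y by omega)
      have hnb' : avg r (gridCube τ (k + i) y) F ≤ θ := not_lt.1 hnb
      have hS' : S y = gridCube τ (k + i + 1) y := by
        simp only [hS, hi]; congr 1; push_cast; ring
      refine le_trans ?_ (mul_le_mul_right hnb' _)
      rw [hS', avg, avg, ← ENNReal.mul_rpow_of_nonneg _ _ (by positivity),
        volume_gridCube_succ τ (k + i) y y]
      refine ENNReal.rpow_le_rpow ?_ (by positivity)
      rw [← mul_div_assoc, ENNReal.mul_div_mul_left _ _ (by positivity)
        (ENNReal.pow_ne_top (by simp))]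
      refine ENNReal.div_le_div_right (lintegral_mono_set ?_) _
      exact gridCube_mono τ (by omega) y
  · intro l hl z hR x hx hgood y hy
    have hxQ := hR hx
    have hyQ := hR hy
    rw [hσ x hxQ] at hgood
    rw [hσ y hyQ]
    have hRx : gridCube τ l x = gridCube τ l z := gridCube_eq_of_mem hx
    have hRy : gridCube τ l y = gridCube τ l z := gridCube_eq_of_mem hy
    rcases le_total l (k + T y) with hlk | hlk
    · rw [← hRy]
      exact gridCube_mono τ hlk y
    · -- otherwise `x` lies in the stopping cube of `y`, which is then of level `k + N`
      have hxS : x ∈ S y := by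
        have h1 := gridCube_mono τ hlk y
        rw [hRy] at h1
        exact h1 hx
      have h2 : T x = T y := stopTime_eq_of_mem hxS
      rcases stopTime_spec (τ := τ) (k := k) (N := N) (bad := bad) (x := x) with h3 | h3
      · have h4 : l = k + T y := by
          have : (N : ℤ) ≤ T y := by rw [← h2]; exact_mod_cast h3
          omega
        rw [← hRy, h4]
      · exact absurd hgood (not_le.2 h3)

namespace IsCellMap

variable {τ : Fin d → ℝ} {Q : Set (Fin d → ℝ)} {σ : SimpleFunc (Fin d → ℝ) (Set (Fin d → ℝ))}

lemma measurableSet (h : IsCellMap τ Q σ) (y : Fin d → ℝ) : MeasurableSet (σ y) := by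
  by_cases hy : y ∈ Q
  · exact measurableSet_of_mem_cubes (grid_subset_cubes τ (h.mem_grid y hy))
  · rw [h.eq_empty y hy]; exact MeasurableSet.empty

lemma mem_iff (h : IsCellMap τ Q σ) {y z : Fin d → ℝ} : z ∈ σ y ↔ z ∈ Q ∧ σ z = σ y := by
  constructor
  · intro hz
    refine ⟨?_, h.eq_of_mem y z hz⟩
    by_contra hzQ
    have h1 := h.eq_of_mem y z hz
    rw [h.eq_empty z hzQ] at h1
    rw [← h1] at hz
    exact notMem_empty z hz
  · rintro ⟨hzQ, hz⟩
    rw [← hz]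
    exact h.mem_self z hzQ

lemma pairwiseDisjoint (h : IsCellMap τ Q σ) (s : Set (Set (Fin d → ℝ)))
    (hs : s ⊆ range σ) : s.PairwiseDisjoint id := by
  intro P hP P' hP' hne
  obtain ⟨y, rfl⟩ := hs hP
  obtain ⟨y', rfl⟩ := hs hP'
  refine Set.disjoint_left.2 fun z hz hz' => hne ?_
  exact (h.eq_of_mem y z hz).symm.trans (h.eq_of_mem y' z hz')

open scoped Classical in
/-- The integral over a union of cells is the sum of the integrals over the cells. -/
lemma setLIntegral_eq_sum (h : IsCellMap τ Q σ) {R : Set (Fin d → ℝ)} (hRQ : R ⊆ Q)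
    (hR : ∀ y ∈ R, σ y ⊆ R) (F : (Fin d → ℝ) → ℝ≥0∞) :
    ∫⁻ x in R, F x = ∑ P ∈ σ.range with P ⊆ R, ∫⁻ x in P, F x := by
  have hU : R = ⋃ P ∈ σ.range.filter (· ⊆ R), P := by
    ext z
    simp only [Finset.mem_filter, mem_iUnion, exists_prop]
    constructor
    · exact fun hz => ⟨σ z, ⟨SimpleFunc.mem_range_self σ z, hR z hz⟩, h.mem_self z (hRQ hz)⟩
    · rintro ⟨P, ⟨-, hP⟩, hz⟩
      exact hP hz
  have hs : ((σ.range.filter (· ⊆ R) : Finset _) : Set (Set (Fin d → ℝ))) ⊆ range σ := by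
    intro P hP
    exact SimpleFunc.mem_range.1 (Finset.mem_filter.1 (Finset.mem_coe.1 hP)).1
  conv_lhs => rw [hU]
  refine lintegral_biUnion_finset (t := id) (h.pairwiseDisjoint _ hs) (fun P hP => ?_) F
  obtain ⟨y, rfl⟩ := hs hP
  exact h.measurableSet y

lemma setLIntegral_avg_rpow (h : IsCellMap τ Q σ) {R : Set (Fin d → ℝ)} (hRQ : R ⊆ Q)
    (hR : ∀ y ∈ R, σ y ⊆ R) {r : ℝ} (hr : 0 < r) (F : (Fin d → ℝ) → ℝ≥0∞) :
    ∫⁻ y in R, avg r (σ y) F ^ r = ∫⁻ y in R, F y ^ r := by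
  classical
  rw [h.setLIntegral_eq_sum hRQ hR, h.setLIntegral_eq_sum hRQ hR]
  refine Finset.sum_congr rfl fun P hP => ?_
  obtain ⟨y, rfl⟩ := SimpleFunc.mem_range.1 (Finset.mem_filter.1 hP).1
  have h1 : ∫⁻ x in σ y, avg r (σ x) F ^ r = ∫⁻ _ in σ y, avg r (σ y) F ^ r :=
    setLIntegral_congr_fun (h.measurableSet y) fun x hx => by
      simp only [h.eq_of_mem y x hx]
  rw [h1, setLIntegral_const, avg, ← ENNReal.rpow_mul, one_div_mul_cancel hr.ne',
    ENNReal.rpow_one]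
  by_cases hy : y ∈ Q
  · have hc := grid_subset_cubes τ (h.mem_grid y hy)
    exact ENNReal.div_mul_cancel (volume_ne_zero_of_mem_cubes hc) (volume_ne_top_of_mem_cubes hc)
  · simp [h.eq_empty y hy]

/-- Replacing a function by its averages over the cells does not change its average over a union
of cells. -/
lemma avg_avg (h : IsCellMap τ Q σ) {R : Set (Fin d → ℝ)} (hRQ : R ⊆ Q)
    (hR : ∀ y ∈ R, σ y ⊆ R) {r : ℝ} (hr : 0 < r) (F : (Fin d → ℝ) → ℝ≥0∞) :
    avg r R (fun y => avg r (σ y) F) = avg r R F := by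
  rw [avg, avg, h.setLIntegral_avg_rpow hRQ hR hr]

/-- The cells on which the average of `F` exceeds `θ` satisfy the weak-type bound. -/
lemma volume_bad_le (h : IsCellMap τ Q σ) (hQ : MeasurableSet Q) {r : ℝ} (hr : 0 < r)
    (F : (Fin d → ℝ) → ℝ≥0∞) (θ : ℝ≥0∞) :
    θ ^ r * volume {x ∈ Q | θ < avg r (σ x) F} ≤ ∫⁻ x in Q, F x ^ r := by
  set O := {x ∈ Q | θ < avg r (σ x) F} with hO
  have hOQ : O ⊆ Q := fun x hx => hx.1
  have hOσ : ∀ y ∈ O, σ y ⊆ O := fun y hy z hz => by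
    obtain ⟨h1, h2⟩ := h.mem_iff.1 hz
    exact ⟨h1, by rw [h2]; exact hy.2⟩
  have hOm : MeasurableSet O := hQ.inter (σ.measurableSet_preimage {P | θ < avg r P F})
  calc θ ^ r * volume O = ∫⁻ _ in O, θ ^ r := by rw [setLIntegral_const]
    _ ≤ ∫⁻ x in O, avg r (σ x) F ^ r :=
        setLIntegral_mono' hOm fun x hx => ENNReal.rpow_le_rpow hx.2.le hr.le
    _ = ∫⁻ x in O, F x ^ r := h.setLIntegral_avg_rpow hOQ hOσ hr F
    _ ≤ ∫⁻ x in Q, F x ^ r := lintegral_mono_set hOQ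

end IsCellMap

end

/-! ### Averages and maximal functions -/

section

lemma ennreal_prod_rpow_eq_rpow_sum {ι : Type*} (s : Finset ι) {a : ℝ≥0∞} {e : ι → ℝ}
    (he : ∀ i ∈ s, 0 ≤ e i) : ∏ i ∈ s, a ^ e i = a ^ ∑ i ∈ s, e i := by
  classical
  induction s using Finset.induction_on with
  | empty => simp
  | insert b s hb ih =>
    rw [Finset.prod_insert hb, Finset.sum_insert hb,
      ih fun i hi => he i (Finset.mem_insert_of_mem hi),
      ENNReal.rpow_add_of_nonneg _ _ (he b (Finset.mem_insert_self _ _))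
        (Finset.sum_nonneg fun i hi => he i (Finset.mem_insert_of_mem hi))]

open scoped Classical in
/-- The map sending a point to the members of a finite family of measurable sets that contain it
is a simple function. -/
lemma exists_simpleFunc_filter_mem {α : Type*} [MeasurableSpace α] (D : Finset (Set α))
    (hD : ∀ Q ∈ D, MeasurableSet Q) :
    ∃ T : SimpleFunc α (Finset (Set α)), ∀ x, T x = D.filter (x ∈ ·) := by
  refine ⟨⟨fun x => D.filter (x ∈ ·), fun S => ?_, ?_⟩, fun x => rfl⟩
  · by_cases hS : S ⊆ D
    · have : (fun x => D.filter (x ∈ ·)) ⁻¹' {S} = ⋂ Q ∈ D, if Q ∈ S then Q else Qᶜ := by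
        ext x
        simp only [mem_preimage, mem_singleton_iff, mem_iInter, Finset.ext_iff, Finset.mem_filter]
        refine ⟨fun h Q hQ => ?_, fun h Q => ⟨fun hQ => ?_, fun hQ => ⟨hS hQ, ?_⟩⟩⟩
        · by_cases hQS : Q ∈ S
          · simpa [hQS] using ((h Q).2 hQS).2
          · simpa [hQS] using fun hx => hQS ((h Q).1 ⟨hQ, hx⟩)
        · by_contra hQS
          have := h Q hQ.1
          simp only [hQS, if_false] at this
          exact this hQ.2
        · simpa [hQ] using h Q (hS hQ)
      rw [this]
      refine MeasurableSet.biInter (Finset.countable_toSet D) fun Q hQ => ?_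
      split_ifs
      · exact hD Q hQ
      · exact (hD Q hQ).compl
    · have : (fun x => D.filter (x ∈ ·)) ⁻¹' {S} = ∅ := by
        ext x
        simp only [mem_preimage, mem_singleton_iff, mem_empty_iff_false, iff_false]
        rintro rfl
        exact hS (Finset.filter_subset _ _)
      rw [this]
      exact MeasurableSet.empty
  · refine (D.powerset.finite_toSet).subset ?_
    rintro _ ⟨x, rfl⟩
    exact Finset.mem_coe.2 (Finset.mem_powerset.2 (Finset.filter_subset _ _))

variable {d n : ℕ}

lemma le_multiMax {𝒬 : Set (Set (Fin d → ℝ))} {s : Fin n → ℝ} {h : Fin n → (Fin d → ℝ) → ℝ≥0∞}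
    {x : Fin d → ℝ} {Q : Set (Fin d → ℝ)} (hQ : Q ∈ 𝒬) (hx : x ∈ Q) :
    ∏ j, avg (s j) Q (h j) ≤ multiMax 𝒬 s h x := by
  refine le_iSup₂_of_le Q hQ ?_
  rw [indicator_of_mem hx]

lemma multiMax_le {𝒬 : Set (Set (Fin d → ℝ))} {s : Fin n → ℝ} {h : Fin n → (Fin d → ℝ) → ℝ≥0∞}
    {x : Fin d → ℝ} {b : ℝ≥0∞} (H : ∀ Q ∈ 𝒬, x ∈ Q → ∏ j, avg (s j) Q (h j) ≤ b) :
    multiMax 𝒬 s h x ≤ b := by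
  refine iSup₂_le fun Q hQ => ?_
  by_cases hx : x ∈ Q
  · rw [indicator_of_mem hx]; exact H Q hQ hx
  · rw [indicator_of_notMem hx]; exact zero_le

lemma multiMax_mono {𝒬 𝒬' : Set (Set (Fin d → ℝ))} (h𝒬 : 𝒬 ⊆ 𝒬') (s : Fin n → ℝ)
    (h : Fin n → (Fin d → ℝ) → ℝ≥0∞) (x : Fin d → ℝ) : multiMax 𝒬 s h x ≤ multiMax 𝒬' s h x :=
  multiMax_le fun _ hQ hx => le_multiMax (h𝒬 hQ) hx

open scoped Classical in
lemma multiMax_finset_eq_sup (D : Finset (Set (Fin d → ℝ))) (s : Fin n → ℝ)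
    (h : Fin n → (Fin d → ℝ) → ℝ≥0∞) (x : Fin d → ℝ) :
    multiMax (D : Set (Set (Fin d → ℝ))) s h x
      = (D.filter (x ∈ ·)).sup fun Q => ∏ j, avg (s j) Q (h j) := by
  refine le_antisymm (multiMax_le fun Q hQ hx => ?_) (Finset.sup_le fun Q hQ => ?_)
  · exact Finset.le_sup (f := fun Q => ∏ j, avg (s j) Q (h j))
      (Finset.mem_filter.2 ⟨hQ, hx⟩)
  · exact le_multiMax (Finset.mem_coe.2 (Finset.mem_filter.1 hQ).1) (Finset.mem_filter.1 hQ).2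

lemma avg_rpow {r : ℝ} (hr : 0 < r) (Q : Set (Fin d → ℝ)) (F : (Fin d → ℝ) → ℝ≥0∞) :
    avg r Q F ^ r = (∫⁻ x in Q, F x ^ r) / volume Q := by
  rw [avg, ← ENNReal.rpow_mul, one_div_mul_cancel hr.ne', ENNReal.rpow_one]

lemma avg_rpow_mul_volume {r : ℝ} (hr : 0 < r) {Q : Set (Fin d → ℝ)} (hQ : Q ∈ cubes d)
    (F : (Fin d → ℝ) → ℝ≥0∞) : avg r Q F ^ r * volume Q = ∫⁻ x in Q, F x ^ r := by
  rw [avg_rpow hr, ENNReal.div_mul_cancel (volume_ne_zero_of_mem_cubes hQ)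
    (volume_ne_top_of_mem_cubes hQ)]

/-- The averages over two nested cubes are comparable, up to the ratio of the volumes. -/
lemma avg_le_of_subset {r : ℝ} (hr : 0 < r) {P Q : Set (Fin d → ℝ)} (hPQ : P ⊆ Q)
    {c : ℝ≥0∞} (hc0 : c ≠ 0) (hc : c ≠ ∞) (hvol : volume Q ≤ c * volume P)
    (F : (Fin d → ℝ) → ℝ≥0∞) : avg r P F ≤ c ^ (1 / r) * avg r Q F := by
  rw [avg, avg, ← ENNReal.mul_rpow_of_nonneg _ _ (by positivity)]
  refine ENNReal.rpow_le_rpow ?_ (by positivity)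
  calc (∫⁻ x in P, F x ^ r) / volume P ≤ (∫⁻ x in Q, F x ^ r) / volume P :=
        ENNReal.div_le_div_right (lintegral_mono_set hPQ) _
    _ = c * (∫⁻ x in Q, F x ^ r) / (c * volume P) :=
        (ENNReal.mul_div_mul_left _ _ hc0 hc).symm
    _ ≤ c * (∫⁻ x in Q, F x ^ r) / volume Q := ENNReal.div_le_div_left hvol _
    _ = c * ((∫⁻ x in Q, F x ^ r) / volume Q) := by rw [mul_div_assoc]

lemma avg_eq_zero_of_subset {r : ℝ} (hr : 0 < r) {P Q : Set (Fin d → ℝ)} (hPQ : P ⊆ Q)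
    (hQ : Q ∈ cubes d) {F : (Fin d → ℝ) → ℝ≥0∞} (h : avg r Q F = 0) : avg r P F = 0 := by
  have h1 := avg_rpow_mul_volume hr hQ F
  rw [h, ENNReal.zero_rpow_of_pos hr, zero_mul] at h1
  have h2 : ∫⁻ x in P, F x ^ r = 0 := le_antisymm (h1 ▸ lintegral_mono_set hPQ) zero_le
  rw [avg, h2, ENNReal.zero_div, ENNReal.zero_rpow_of_pos (by positivity)]

variable {Ω 𝕜 : Type*} [MeasurableSpace Ω] [RCLike 𝕜] {μ : Measure Ω} {m : ℕ}

lemma aemeasurable_prod_avg [SFinite μ] {f : Fin m → (Fin d → ℝ) → Ω → 𝕜}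
    (hf : ∀ j, AEStronglyMeasurable (Function.uncurry (f j))
      ((volume : Measure (Fin d → ℝ)).prod μ)) (r : Fin m → ℝ) (Q : Set (Fin d → ℝ)) :
    AEMeasurable (fun ω => ∏ j, avg (r j) Q fun y => ‖f j y ω‖ₑ) μ :=
  Finset.aemeasurable_fun_prod _ fun j _ => aemeasurable_avg (hf j) (r j) Q

lemma aemeasurable_latticeMax [SFinite μ] {f : Fin m → (Fin d → ℝ) → Ω → 𝕜}
    (hf : ∀ j, AEStronglyMeasurable (Function.uncurry (f j))
      ((volume : Measure (Fin d → ℝ)).prod μ)) (r : Fin m → ℝ) {𝒬 : Set (Set (Fin d → ℝ))}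
    (h𝒬 : 𝒬.Countable) (x : Fin d → ℝ) : AEMeasurable (fun ω => latticeMax 𝒬 r f x ω) μ := by
  refine AEMeasurable.biSup _ h𝒬 fun Q _ => ?_
  by_cases hx : x ∈ Q
  · simpa only [indicator_of_mem hx] using aemeasurable_prod_avg hf r Q
  · simpa only [indicator_of_notMem hx] using aemeasurable_const

/-- If the lattice-valued average of one of the functions `f j` over `Q` vanishes, then so does the
lattice maximal function over cubes inside `Q`. -/
lemma eNrmPos_latticeMax_eq_zero [SFinite μ] {X : Fin m → FnSpace Ω 𝕜} (hX : IsQBFSTuple μ X)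
    {r : Fin m → ℝ} (hr : ∀ j, 0 < r j) {f : Fin m → (Fin d → ℝ) → Ω → 𝕜}
    (hf : ∀ j, AEStronglyMeasurable (Function.uncurry (f j))
      ((volume : Measure (Fin d → ℝ)).prod μ))
    {Q : Set (Fin d → ℝ)} (hQ : Q ∈ cubes d) {j : Fin m}
    (h0 : eNrmPos μ (X j) (fun ω => avg (r j) Q fun y => ‖f j y ω‖ₑ) = 0)
    (D : Finset (Set (Fin d → ℝ))) (hDQ : ∀ R ∈ D, R ⊆ Q) (x : Fin d → ℝ) :
    eNrmPos μ (prodSpace μ X) (latticeMax (D : Set (Set (Fin d → ℝ))) r f x) = 0 := by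
  rw [← hX.2.eNrmPos_zero]
  refine hX.2.eNrmPos_congr (aemeasurable_latticeMax hf r D.countable_toSet x) ?_
  filter_upwards [(hX.1 j).ae_eq_zero_of_eNrmPos h0] with ω hω
  refine le_antisymm (multiMax_le fun R hR _ => le_of_eq ?_) zero_le
  exact Finset.prod_eq_zero (Finset.mem_univ j)
    (avg_eq_zero_of_subset (hr j) (hDQ R hR) hQ hω)

/-- The levels of the cubes of a finite subfamily of a grid are bounded above. -/
lemma exists_level_bound {τ : Fin d → ℝ} (k : ℤ) (D : Finset (Set (Fin d → ℝ)))
    (hD : (D : Set (Set (Fin d → ℝ))) ⊆ grid τ) :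
    ∃ N : ℕ, ∀ R ∈ D, ∃ l ≤ k + N, ∃ z, R = gridCube τ l z := by
  choose! l z h using fun R (hR : R ∈ D) => hD (Finset.mem_coe.2 hR)
  refine ⟨D.sup fun R => (l R - k).toNat, fun R hR => ⟨l R, ?_, z R, h R hR⟩⟩
  have h1 : (l R - k).toNat ≤ D.sup fun R => (l R - k).toNat :=
    Finset.le_sup (f := fun R => (l R - k).toNat) hR
  have h2 := Int.self_le_toNat (l R - k)
  omega

end

/-! ### Averaging over cells -/

section

variable {Ω 𝕜 : Type*} [MeasurableSpace Ω] [RCLike 𝕜] {μ : Measure Ω} {d m : ℕ}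

/-- The function which on every cell of `σ` equals the lattice-valued average of `f` over
that cell. -/
noncomputable def cellAvg {Ω 𝕜 : Type*} [RCLike 𝕜]
    (σ : SimpleFunc (Fin d → ℝ) (Set (Fin d → ℝ))) (r : ℝ) (f : (Fin d → ℝ) → Ω → 𝕜) :
    SimpleFunc (Fin d → ℝ) (Ω → 𝕜) :=
  σ.map fun P => lift 𝕜 fun ω => (avg r P fun y => ‖f y ω‖ₑ).toReal

lemma cellAvg_apply {Ω 𝕜 : Type*} [RCLike 𝕜] (σ : SimpleFunc (Fin d → ℝ) (Set (Fin d → ℝ)))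
    (r : ℝ) (f : (Fin d → ℝ) → Ω → 𝕜) (x : Fin d → ℝ) :
    cellAvg σ r f x = lift 𝕜 fun ω => (avg r (σ x) fun y => ‖f y ω‖ₑ).toReal := rfl

section

variable {X : FnSpace Ω 𝕜} {τ : Fin d → ℝ} {Q : Set (Fin d → ℝ)}
  {σ : SimpleFunc (Fin d → ℝ) (Set (Fin d → ℝ))} {r : ℝ} {f : (Fin d → ℝ) → Ω → 𝕜}

lemma eNrmPos_avg_cell_le (hX : IsQBFS μ X) (hr : 0 < r) (hσ : IsCellMap τ Q σ) {B : ℝ≥0∞}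
    (hB : ∀ y ∈ Q, eNrmPos μ X (fun ω => avg r (σ y) fun z => ‖f z ω‖ₑ) ≤ B) (y : Fin d → ℝ) :
    eNrmPos μ X (fun ω => avg r (σ y) fun z => ‖f z ω‖ₑ) ≤ Q.indicator (fun _ => B) y := by
  by_cases hy : y ∈ Q
  · rw [indicator_of_mem hy]
    exact hB y hy
  · -- the average over the empty cell is `(0 / 0) ^ (1 / r) = 0`
    have h0 : ∀ ω, avg r (σ y) (fun z => ‖f z ω‖ₑ) = 0 := fun ω => by
      simp [avg, hσ.eq_empty y hy, hr]
    simp only [h0, hX.eNrmPos_zero, zero_le]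

lemma memBochner_cellAvg [SFinite μ] (hX : IsQBFS μ X) (hr : 0 < r) (hσ : IsCellMap τ Q σ)
    (hQ : volume Q ≠ ∞) {B : ℝ≥0∞} (hBt : B ≠ ∞)
    (hB : ∀ y ∈ Q, eNrmPos μ X (fun ω => avg r (σ y) fun z => ‖f z ω‖ₑ) ≤ B) (p : ℝ≥0∞) :
    MemBochner μ X p (fun x => cellAvg σ r f x) ∧
      bochnerNorm X p (fun x => cellAvg σ r f x) ≤ B * volume Q ^ (1 / p.toReal) := by
  have hle := eNrmPos_avg_cell_le hX hr hσ hB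
  have hfin : ∀ y, eNrmPos μ X (fun ω => avg r (σ y) fun z => ‖f z ω‖ₑ) ≠ ∞ := fun y => by
    refine ((hle y).trans_lt ?_).ne
    by_cases hy : y ∈ Q
    · simpa [hy] using hBt.lt_top
    · simp [hy]
  have hmem : ∀ x, cellAvg σ r f x ∈ X.carrier := fun x => mem_of_eNrmPos (hfin x)
  have hnorm : bochnerNorm X p (fun x => cellAvg σ r f x) ≤ B * volume Q ^ (1 / p.toReal) := by
    refine le_trans (eLpNorm_mono_enorm fun x => ?_) (eLpNorm_indicator_const_le B p)
    simp only [enorm_eq_self]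
    refine le_trans (le_of_eq ?_) (hle x)
    rw [eNrmPos, if_pos (ae_lt_top_of_eNrmPos (hfin x))]
    rfl
  refine ⟨⟨⟨?_, ae_of_all _ hmem, fun _ => cellAvg σ r f, fun _ => hmem, ?_⟩, ?_⟩, hnorm⟩
  · exact aestronglyMeasurable_uncurry_simpleFunc _ fun x => hX.meas _ (hmem x)
  · refine ae_of_all _ fun x => ?_
    simp only [sub_self]
    rw [(hX.nrm_eq_zero _ hX.zero_mem).2 (ae_eq_refl _)]
    exact tendsto_const_nhds
  · refine hnorm.trans_lt (ENNReal.mul_lt_top hBt.lt_top ?_)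
    exact ENNReal.rpow_lt_top_of_nonneg (by positivity) hQ

end

/-- At a point all of whose cubes in `D` are unions of cells, the lattice maximal function does not
see the difference between `f` and its averages over the cells. -/
lemma ae_latticeMax_le_cellAvg {X : Fin m → FnSpace Ω 𝕜}
    {r : Fin m → ℝ} (hr : ∀ j, 0 < r j) {τ : Fin d → ℝ} {Q : Set (Fin d → ℝ)}
    {σ : Fin m → SimpleFunc (Fin d → ℝ) (Set (Fin d → ℝ))} (hσ : ∀ j, IsCellMap τ Q (σ j))
    {f : Fin m → (Fin d → ℝ) → Ω → 𝕜} {B : Fin m → ℝ≥0∞} (hBt : ∀ j, B j ≠ ∞)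
    (hB : ∀ j, ∀ y ∈ Q, eNrmPos μ (X j) (fun ω => avg (r j) (σ j y) fun z => ‖f j z ω‖ₑ) ≤ B j)
    {D : Finset (Set (Fin d → ℝ))} (hDc : (D : Set (Set (Fin d → ℝ))) ⊆ cubes d)
    (hDQ : ∀ R ∈ D, R ⊆ Q) {x : Fin d → ℝ}
    (hx : ∀ j, ∀ R ∈ D, x ∈ R → ∀ y ∈ R, σ j y ⊆ R) :
    ∀ᵐ ω ∂μ, latticeMax (D : Set (Set (Fin d → ℝ))) r f x ω
      ≤ latticeMax (D : Set (Set (Fin d → ℝ))) r (fun j y => cellAvg (σ j) (r j) (f j) y) x ω := by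
  have hfin : ∀ᵐ ω ∂μ, ∀ j, ∀ P ∈ (σ j).range, P.Nonempty →
      avg (r j) P (fun z => ‖f j z ω‖ₑ) < ∞ := by
    refine ae_all_iff.2 fun j => (ae_ball_iff (Finset.countable_toSet _)).2 fun P hP => ?_
    obtain ⟨y, rfl⟩ := SimpleFunc.mem_range.1 hP
    by_cases hy : y ∈ Q
    · filter_upwards [ae_lt_top_of_eNrmPos ((hB j y hy).trans_lt (hBt j).lt_top).ne] with ω hω _
        using hω
    · exact ae_of_all _ fun ω hne => absurd hne (by simp [(hσ j).eq_empty y hy])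
  filter_upwards [hfin] with ω hω
  refine multiMax_le fun R hR hxR => ?_
  refine le_trans (le_of_eq (Finset.prod_congr rfl fun j _ => ?_)) (le_multiMax hR hxR)
  rw [← (hσ j).avg_avg (hDQ R hR) (hx j R hR hxR) (hr j)]
  have hRm : ∀ y ∈ R, avg (r j) (σ j y) (fun z => ‖f j z ω‖ₑ)
      = ‖cellAvg (σ j) (r j) (f j) y ω‖ₑ := fun y hy => by
    rw [cellAvg_apply, enorm_lift_toReal, ENNReal.ofReal_toReal]
    exact (hω j _ (SimpleFunc.mem_range_self _ y)
      ⟨y, (hσ j).mem_self y (hDQ R hR hy)⟩).ne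
  rw [avg, avg]
  congr 2
  exact setLIntegral_congr_fun (measurableSet_of_mem_cubes (hDc hR)) fun y hy => by
    simp only [hRm y hy]

/-- The norm of the lattice maximal function over a finite family of cubes takes finitely many
values, on measurable sets. -/
lemma measurable_eNrmPos_latticeMax (Y : FnSpace Ω 𝕜) (r : Fin m → ℝ)
    (f : Fin m → (Fin d → ℝ) → Ω → 𝕜) {D : Finset (Set (Fin d → ℝ))}
    (hD : (D : Set (Set (Fin d → ℝ))) ⊆ cubes d) :
    Measurable fun x => eNrmPos μ Y (latticeMax (D : Set (Set (Fin d → ℝ))) r f x) := by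
  classical
  obtain ⟨T, hT⟩ := exists_simpleFunc_filter_mem D fun R hR => measurableSet_of_mem_cubes (hD hR)
  have : (fun x => eNrmPos μ Y (latticeMax (D : Set (Set (Fin d → ℝ))) r f x))
      = T.map fun S => eNrmPos μ Y fun ω =>
        S.sup fun R => ∏ j, avg (r j) R fun y => ‖f j y ω‖ₑ := by
    ext x
    rw [SimpleFunc.map_apply, hT]
    congr 1
    ext ω
    exact multiMax_finset_eq_sup D r (fun j y => ‖f j y ω‖ₑ) x
  rw [this]
  exact SimpleFunc.measurable _

end

/-! ### The weak-type step -/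

section

variable {Ω 𝕜 : Type*} [MeasurableSpace Ω] [RCLike 𝕜] {μ : Measure Ω} {d m : ℕ}

/-- The weak-type step of the sparse construction: on at least half of `Q` the norm of the lattice
maximal function over cubes inside `Q` is controlled by the product of the averages of the scalar
functions `‖f j‖` over `Q`. Outside the Calderón–Zygmund stopping cubes of the `‖f j‖` the maximal
function does not change when each `f j` is averaged over its stopping cells. These averages are
bounded by integral convexity, so Chebyshev's inequality applies to the assumed strong bound. -/
theorem exists_volume_lt_latticeMax_le [SigmaFinite μ] {X : Fin m → FnSpace Ω 𝕜}
    (hX : IsQBFSTuple μ X) {r : Fin m → ℝ} (hr : ∀ j, 0 < r j) (hHL : HL μ d X r) :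
    ∃ A : ℝ≥0, ∀ (τ : Fin d → ℝ) (f : Fin m → (Fin d → ℝ) → Ω → 𝕜),
      (∀ j, StronglyMeas μ (X j) (f j)) → ∀ Q ∈ grid τ,
      (∀ j, avg (r j) Q (fun y => eNrm (X j) (f j y)) ≠ ∞) →
      ∀ D : Finset (Set (Fin d → ℝ)), (D : Set (Set (Fin d → ℝ))) ⊆ grid τ → (∀ R ∈ D, R ⊆ Q) →
        volume {x ∈ Q | A * ∏ j, avg (r j) Q (fun y => eNrm (X j) (f j y))
          < eNrmPos μ (prodSpace μ X) (latticeMax (D : Set (Set (Fin d → ℝ))) r f x)}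
        ≤ volume Q / 2 := by
  classical
  obtain ⟨hconv, p, hp, C, hC⟩ := hHL
  choose c hc using fun j => exists_eNrmPos_avg_le (d := d) (hX.1 j) (hr j) (hconv j)
  set P : ℝ≥0∞ := (∑ j, (p j)⁻¹)⁻¹ with hP
  have hp0 : ∀ j, p j ≠ 0 := fun j => (zero_le.trans_lt (hp j)).ne'
  have hpinv : ∀ j, (p j)⁻¹ ≠ ∞ := fun j => ENNReal.inv_ne_top.2 (hp0 j)
  have hP0 : P ≠ 0 := ENNReal.inv_ne_zero.2 (ENNReal.sum_ne_top.2 fun j _ => hpinv j)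
  -- this remains true for infinite exponents, as `1 / ∞.toReal = 1 / 0 = 0`
  have hPe : 1 / P.toReal = ∑ j, 1 / (p j).toReal := by
    rw [hP, ENNReal.toReal_inv, one_div, inv_inv, ENNReal.toReal_sum fun j _ => hpinv j]
    exact Finset.sum_congr rfl fun j _ => by rw [ENNReal.toReal_inv, one_div]
  set e : ℝ := 1 / P.toReal with he
  have he0 : 0 ≤ e := by positivity
  -- the stopping height of `‖f j‖` relative to its average over `Q`
  set t : Fin m → ℝ≥0 := fun j => (4 * m : ℝ≥0) ^ (1 / r j) with ht
  set b : Fin m → ℝ≥0 := fun j => c j * ((2 ^ d) ^ (1 / r j) * t j) with hb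
  -- the bound given by Chebyshev's inequality on a subset of `Q` of measure `volume Q / 4`
  set A₀ : ℝ≥0 := C * (∏ j, b j) * 4 ^ e with hA₀
  refine ⟨A₀ + 1, fun τ f hf Q hQ hfin D hD hDQ => ?_⟩
  have hQc := grid_subset_cubes τ hQ
  have hDc : (D : Set (Set (Fin d → ℝ))) ⊆ cubes d := hD.trans (grid_subset_cubes τ)
  have hQ0 := volume_ne_zero_of_mem_cubes hQc
  have hQt := volume_ne_top_of_mem_cubes hQc
  have hQm := measurableSet_of_mem_cubes hQc
  set F : Fin m → (Fin d → ℝ) → ℝ≥0∞ := fun j y => eNrm (X j) (f j y) with hF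
  set a : Fin m → ℝ≥0∞ := fun j => avg (r j) Q (F j) with ha
  by_cases hzero : ∃ j, a j = 0
  · obtain ⟨j, hj⟩ := hzero
    have h0 : eNrmPos μ (X j) (fun ω => avg (r j) Q fun y => ‖f j y ω‖ₑ) = 0 := by
      have := hc j (f j) (hf j) Q hQ0 hQt
      change _ ≤ (c j : ℝ≥0∞) * a j at this
      rw [hj, mul_zero] at this
      exact le_antisymm this zero_le
    have := eNrmPos_latticeMax_eq_zero hX hr (fun j => (hf j).1) hQc h0 D hDQ
    simp [this]
  push Not at hzero
  have hprod0 : ∏ j, a j ≠ 0 := Finset.prod_ne_zero_iff.2 fun j _ => hzero j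
  have hprodt : ∏ j, a j ≠ ∞ := ENNReal.prod_ne_top fun j _ => hfin j
  have ht1 : ∀ j, 1 ≤ t j := fun j => by
    have hm : (1 : ℝ≥0) ≤ m := by exact_mod_cast (Fin.pos j)
    refine NNReal.one_le_rpow ?_ (by have := hr j; positivity)
    calc (1 : ℝ≥0) ≤ 4 * 1 := by norm_num
      _ ≤ 4 * m := by gcongr
  obtain ⟨k, x₀, rfl⟩ := hQ
  set Q := gridCube τ k x₀
  obtain ⟨N, hN⟩ := exists_level_bound k D hD
  choose σ hσ hσF hσR using fun j => exists_cellMap τ k x₀ N (hr j) (F j)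
    (θ := t j * a j) (le_mul_of_one_le_left' (by exact_mod_cast ht1 j))
  set B : Fin m → ℝ≥0∞ := fun j => b j * a j with hBdef
  have hBt : ∀ j, B j ≠ ∞ := fun j => ENNReal.mul_ne_top ENNReal.coe_ne_top (hfin j)
  have hB : ∀ j, ∀ y ∈ Q,
      eNrmPos μ (X j) (fun ω => avg (r j) (σ j y) fun z => ‖f j z ω‖ₑ) ≤ B j := by
    intro j y hy
    have hcube := grid_subset_cubes τ ((hσ j).mem_grid y hy)
    refine (hc j (f j) (hf j) _ (volume_ne_zero_of_mem_cubes hcube)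
      (volume_ne_top_of_mem_cubes hcube)).trans ?_
    refine (mul_le_mul_right (hσF j y hy) _).trans (le_of_eq ?_)
    have h2 : (((2 ^ d : ℝ≥0) ^ (1 / r j) : ℝ≥0) : ℝ≥0∞) = (2 ^ d) ^ (1 / r j) := by
      rw [ENNReal.coe_rpow_of_nonneg _ (by have := hr j; positivity)]
      push_cast
      rfl
    simp only [hBdef, hb]
    push_cast
    rw [h2]
    ring
  set g : Fin m → (Fin d → ℝ) → Ω → 𝕜 := fun j y => cellAvg (σ j) (r j) (f j) y with hg
  have hgB := fun j => memBochner_cellAvg (hX.1 j) (hr j) (hσ j) hQt (hBt j) (hB j) (p j)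
  have hHLg := hC D hDc g fun j => (hgB j).1
  set G : Set (Fin d → ℝ) := {x ∈ Q | ∀ j, avg (r j) (σ j x) (F j) ≤ t j * a j} with hG
  have hGle : ∀ x ∈ G, eNrmPos μ (prodSpace μ X) (latticeMax (D : Set (Set (Fin d → ℝ))) r f x)
      ≤ eNrmPos μ (prodSpace μ X) (latticeMax (D : Set (Set (Fin d → ℝ))) r g x) := by
    intro x hx
    refine hX.2.eNrmPos_mono (aemeasurable_latticeMax (fun j => (hf j).1) r D.countable_toSet x) ?_
    refine ae_latticeMax_le_cellAvg hr hσ hBt hB hDc hDQ fun j R hR hxR => ?_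
    obtain ⟨l, hl, z, rfl⟩ := hN R hR
    exact hσR j l hl z (hDQ _ hR) x hxR (hx.2 j)
  set Bd := {x ∈ Q | ((A₀ + 1 : ℝ≥0) : ℝ≥0∞) * ∏ j, a j
    < eNrmPos μ (prodSpace μ X) (latticeMax (D : Set (Set (Fin d → ℝ))) r f x)} with hBd
  change volume Bd ≤ volume Q / 2
  have hGm : MeasurableSet G := by
    have : G = Q ∩ ⋂ j, (σ j) ⁻¹' {P | avg (r j) P (F j) ≤ t j * a j} := by
      ext x
      simp [hG]
    rw [this]
    exact hQm.inter (MeasurableSet.iInter fun j => (σ j).measurableSet_preimage _)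
  have hBdm : MeasurableSet Bd :=
     hQm.inter (measurableSet_lt measurable_const
      (measurable_eNrmPos_latticeMax (prodSpace μ X) r f hDc))
  -- outside the stopping cubes the assumed bound for the averaged functions applies
  have hE : volume (Bd ∩ G) ≤ volume Q / 4 := by
    by_contra hlt
    push Not at hlt
    have hne : volume (Bd ∩ G) ≠ 0 := (zero_le.trans_lt hlt).ne'
    set L : ℝ≥0∞ := ((A₀ + 1 : ℝ≥0) : ℝ≥0∞) * ∏ j, a j with hL
    have h1 : L * volume (Bd ∩ G) ^ e
        ≤ C * ∏ j, (B j * volume Q ^ (1 / (p j).toReal)) := by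
      have h2 := eLpNorm_indicator_const' (c := L) (hBdm.inter hGm) hne hP0
      rw [enorm_eq_self] at h2
      rw [← h2]
      refine (eLpNorm_mono_enorm fun x => ?_).trans (hHLg.trans ?_)
      · simp only [enorm_eq_self]
        by_cases hx : x ∈ Bd ∩ G
        · rw [indicator_of_mem hx]
          exact hx.1.2.le.trans (hGle x hx.2)
        · rw [indicator_of_notMem hx]; exact zero_le
      · gcongr with j
        exact (hgB j).2
    rw [Finset.prod_mul_distrib, ennreal_prod_rpow_eq_rpow_sum _ fun j _ => by positivity, ← hPe,
      Finset.prod_mul_distrib] at h1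
    have h3 : ((A₀ + 1 : ℝ≥0) : ℝ≥0∞) * ((∏ j, a j) * volume Q ^ e)
        ≤ A₀ * ((∏ j, a j) * volume Q ^ e) := by
      calc ((A₀ + 1 : ℝ≥0) : ℝ≥0∞) * ((∏ j, a j) * volume Q ^ e)
          = 4 ^ e * (L * (volume Q / 4) ^ e) := by
            have h44 : (4 : ℝ≥0∞) ^ e * (volume Q ^ e / 4 ^ e) = volume Q ^ e :=
              ENNReal.mul_div_cancel (ENNReal.rpow_pos (by simp) (by simp)).ne'
                (ENNReal.rpow_ne_top_of_nonneg he0 (by simp))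
            rw [ENNReal.div_rpow_of_nonneg _ _ he0, hL,
              mul_left_comm ((4 : ℝ≥0∞) ^ e), h44, mul_assoc]
        _ ≤ 4 ^ e * (L * volume (Bd ∩ G) ^ e) := by gcongr
        _ ≤ 4 ^ e * (C * ((∏ j, (b j : ℝ≥0∞)) * (∏ j, a j) * volume Q ^ e)) := by gcongr
        _ = A₀ * ((∏ j, a j) * volume Q ^ e) := by
            rw [hA₀, ENNReal.coe_mul, ENNReal.coe_mul, ENNReal.coe_rpow_of_nonneg _ he0]
            push_cast
            ring
    have h4 := (ENNReal.mul_le_mul_iff_left (c := (∏ j, a j) * volume Q ^ e)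
      (mul_ne_zero hprod0 (ENNReal.rpow_pos (pos_iff_ne_zero.2 hQ0) hQt).ne')
      (ENNReal.mul_ne_top hprodt (ENNReal.rpow_ne_top_of_nonneg he0 hQt))).1 h3
    have h5 : A₀ + 1 ≤ A₀ := by exact_mod_cast h4
    exact absurd h5 (not_le.2 (lt_add_one A₀))
  -- the stopping cubes of each `‖f j‖` cover at most the fraction `1 / (4 m)` of `Q`
  have hO : ∀ j, volume {x ∈ Q | t j * a j < avg (r j) (σ j x) (F j)} ≤ volume Q / (4 * m) := by
    intro j
    have h1 := (hσ j).volume_bad_le hQm (hr j) (F j) (t j * a j)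
    rw [← avg_rpow_mul_volume (hr j) hQc, ENNReal.mul_rpow_of_nonneg _ _ (hr j).le] at h1
    have h2 : (t j : ℝ≥0∞) ^ r j = 4 * m := by
      rw [← ENNReal.coe_rpow_of_nonneg _ (hr j).le]
      simp only [ht]
      rw [← NNReal.rpow_mul, one_div_mul_cancel (hr j).ne', NNReal.rpow_one]
      push_cast
      rfl
    have hm0 : (m : ℝ≥0∞) ≠ 0 := by exact_mod_cast (Fin.pos j).ne'
    have h3 : a j ^ r j ≠ 0 := (ENNReal.rpow_pos (pos_iff_ne_zero.2 (hzero j)) (hfin j)).ne'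
    have h4 : a j ^ r j ≠ ∞ := ENNReal.rpow_ne_top_of_nonneg (hr j).le (hfin j)
    rw [h2, mul_comm (4 * (m : ℝ≥0∞)), mul_assoc] at h1
    have h5 := (ENNReal.mul_le_mul_iff_right h3 h4).1 h1
    rw [ENNReal.le_div_iff_mul_le (Or.inl (by simp [hm0]))
      (Or.inl (ENNReal.mul_ne_top (by simp) (by simp))), mul_comm]
    exact h5
  have hsub : Bd ⊆ (Bd ∩ G) ∪ ⋃ j, {x ∈ Q | t j * a j < avg (r j) (σ j x) (F j)} := by
    intro x hx
    by_cases hxG : x ∈ G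
    · exact Or.inl ⟨hx, hxG⟩
    · right
      have : ¬ ∀ j, avg (r j) (σ j x) (F j) ≤ t j * a j := fun h => hxG ⟨hx.1, h⟩
      push Not at this
      obtain ⟨j, hj⟩ := this
      exact mem_iUnion.2 ⟨j, hx.1, hj⟩
  have hsum : ∑ _j : Fin m, volume Q / (4 * m) ≤ volume Q / 4 := by
    rw [Finset.sum_const, Finset.card_univ, Fintype.card_fin, nsmul_eq_mul]
    rcases Nat.eq_zero_or_pos m with h | h
    · simp [h]
    · have hm0 : (m : ℝ≥0∞) ≠ 0 := by exact_mod_cast h.ne'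
      rw [mul_comm 4, ← mul_div_assoc, ENNReal.mul_div_mul_left _ _ hm0 (by simp)]
  calc volume Bd ≤ volume (Bd ∩ G)
        + ∑ j, volume {x ∈ Q | t j * a j < avg (r j) (σ j x) (F j)} :=
        (measure_mono hsub).trans ((measure_union_le _ _).trans
          (add_le_add le_rfl (measure_iUnion_fintype_le _ _)))
    _ ≤ volume Q / 4 + volume Q / 4 :=
        add_le_add hE ((Finset.sum_le_sum fun j _ => hO j).trans hsum)
    _ = volume Q / 2 := by
        rw [ENNReal.div_add_div_same, ← two_mul, show (4 : ℝ≥0∞) = 2 * 2 by norm_num,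
          ENNReal.mul_div_mul_left _ _ (by simp) (by simp)]

end

/-! ### Sparse domination -/

section

variable {Ω 𝕜 : Type*} [MeasurableSpace Ω] [RCLike 𝕜] {μ : Measure Ω} {d m : ℕ}

/-- Sparse domination from the weak-type step. By induction on the family: `Q₀` is a maximal cube,
`B` the set where the maximal function over the cubes inside `Q₀` is large, and the cubes inside
`Q₀` which are not contained in `B` are removed. At every point of `Q₀` the maximal function over
the removed cubes agrees with that at a point outside `B` which lies in all of these cubes. -/
theorem exists_sparse_eNrmPos_latticeMax_le [SFinite μ] {X : Fin m → FnSpace Ω 𝕜}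
    (hX : IsQBFSTuple μ X) {r : Fin m → ℝ} {A : ℝ≥0} {τ : Fin d → ℝ}
    {f : Fin m → (Fin d → ℝ) → Ω → 𝕜}
    (hf : ∀ j, AEStronglyMeasurable (Function.uncurry (f j))
      ((volume : Measure (Fin d → ℝ)).prod μ))
    (hA : ∀ Q ∈ grid τ, ∀ D : Finset (Set (Fin d → ℝ)), (D : Set (Set (Fin d → ℝ))) ⊆ grid τ →
      (∀ R ∈ D, R ⊆ Q) →
        volume {x ∈ Q | A * ∏ j, avg (r j) Q (fun y => eNrm (X j) (f j y))
          < eNrmPos μ (prodSpace μ X) (latticeMax (D : Set (Set (Fin d → ℝ))) r f x)}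
        ≤ volume Q / 2)
    {q : ℝ} (hq : 0 < q) (hconv : PConvex (prodSpace μ X) q)
    (D : Finset (Set (Fin d → ℝ))) (hD : (D : Set (Set (Fin d → ℝ))) ⊆ grid τ) :
    ∃ S ⊆ D, IsSparse (S : Set (Set (Fin d → ℝ))) ∧
      ∀ x, eNrmPos μ (prodSpace μ X) (latticeMax (D : Set (Set (Fin d → ℝ))) r f x)
        ≤ A * (∑ Q ∈ S, Q.indicator
            (fun _ => (∏ j, avg (r j) Q (fun y => eNrm (X j) (f j y))) ^ q) x) ^ (1 / q) := by
  classical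
  induction D using Finset.strongInduction with
  | H D ih =>
  rcases D.eq_empty_or_nonempty with rfl | hne
  · refine ⟨∅, Finset.Subset.refl _, ⟨fun _ => ∅, by simp, by simp⟩, fun x => ?_⟩
    have : latticeMax ((∅ : Finset (Set (Fin d → ℝ))) : Set (Set (Fin d → ℝ))) r f x
        = fun _ : Ω => 0 := by
      ext ω; simp [latticeMax, multiMax]
    rw [this, hX.2.eNrmPos_zero]
    exact zero_le
  obtain ⟨Q₀, hQ₀, hmax⟩ := D.exists_maximal hne
  have hQg := hD hQ₀
  have hQc := grid_subset_cubes τ hQg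
  have hQt := volume_ne_top_of_mem_cubes hQc
  have hQ0 := volume_ne_zero_of_mem_cubes hQc
  set c : Set (Fin d → ℝ) → ℝ≥0∞ := fun Q => ∏ j, avg (r j) Q (fun y => eNrm (X j) (f j y))
  set N : Finset (Set (Fin d → ℝ)) → (Fin d → ℝ) → ℝ≥0∞ := fun D x =>
    eNrmPos μ (prodSpace μ X) (latticeMax (D : Set (Set (Fin d → ℝ))) r f x) with hN
  set D₀ := D.filter (· ⊆ Q₀) with hD₀
  have hD₀D : D₀ ⊆ D := Finset.filter_subset _ _
  set B := {x ∈ Q₀ | A * c Q₀ < N D₀ x} with hB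
  have hBvol : volume B ≤ volume Q₀ / 2 :=
    hA Q₀ hQg D₀ (fun R hR => hD (hD₀D hR)) fun R hR => (Finset.mem_filter.1 hR).2
  have hBm : MeasurableSet B := (measurableSet_of_mem_cubes hQc).inter
    (measurableSet_lt measurable_const (measurable_eNrmPos_latticeMax (prodSpace μ X) r f
      fun R hR => grid_subset_cubes τ (hD (hD₀D hR))))
  set D' := D.filter (fun R => ¬ R ⊆ Q₀ ∨ R ⊆ B) with hD'
  have hD'D : D' ⊆ D := Finset.filter_subset _ _
  have hQ₀D' : Q₀ ∉ D' := by
    intro h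
    rcases (Finset.mem_filter.1 h).2 with h | h
    · exact h subset_rfl
    · have h1 := (measure_mono (μ := volume) h).trans hBvol
      exact absurd h1 (not_le.2 (ENNReal.half_lt_self hQ0 hQt))
  -- the remaining cubes do not meet `Q₀ \ B`
  have hdisj : ∀ R ∈ D', Disjoint (Q₀ \ B) R := by
    intro R hR
    rw [Set.disjoint_left]
    intro x hx hxR
    obtain ⟨hRD, h⟩ := Finset.mem_filter.1 hR
    rcases h with h | h
    · rcases grid_nested hQg (hD hRD) hx.1 hxR with h1 | h1
      · exact h (hmax hRD h1)
      · exact h h1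
    · exact hx.2 (h hxR)
  obtain ⟨S', hS'D', ⟨E', hE', hE'd⟩, hS'⟩ := ih D'
    (Finset.ssubset_iff_subset_ne.2 ⟨hD'D, fun h => hQ₀D' (h ▸ hQ₀)⟩) fun R hR => hD (hD'D hR)
  have hQ₀S' : Q₀ ∉ S' := fun h => hQ₀D' (hS'D' h)
  refine ⟨insert Q₀ S', Finset.insert_subset hQ₀ (hS'D'.trans hD'D),
    ⟨fun Q => if Q = Q₀ then Q₀ \ B else E' Q, ?_, ?_⟩, fun x => ?_⟩
  · intro Q hQ
    rcases Finset.mem_insert.1 (Finset.mem_coe.1 hQ) with rfl | hQS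
    · simp only [if_true]
      refine ⟨(measurableSet_of_mem_cubes hQc).diff hBm, sdiff_subset, ?_⟩
      have h1 : volume Q ≤ volume (Q \ B) + volume B := by
        refine (measure_mono ?_).trans (measure_union_le _ _)
        rw [sdiff_union_self]
        exact subset_union_left
      have h2 : volume Q / 2 + volume Q / 2 ≤ volume (Q \ B) + volume Q / 2 := by
        rw [ENNReal.add_halves]
        exact h1.trans (add_le_add le_rfl hBvol)
      exact (ENNReal.add_le_add_iff_right (ENNReal.div_ne_top hQt (by simp))).1 h2
    · have : Q ≠ Q₀ := fun h => hQ₀S' (h ▸ hQS)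
      simp only [this, if_false]
      exact hE' Q hQS
  · rw [Finset.coe_insert]
    refine (pairwiseDisjoint_insert_of_notMem (by simpa using hQ₀S')).2 ⟨?_, ?_⟩
    · intro P hP R hR hPR
      have h1 : P ≠ Q₀ := fun h => hQ₀S' (h ▸ hP)
      have h2 : R ≠ Q₀ := fun h => hQ₀S' (h ▸ hR)
      simpa only [Function.onFun, h1, h2, if_false] using hE'd hP hR hPR
    · intro Q hQ
      have : Q ≠ Q₀ := fun h => hQ₀S' (h ▸ hQ)
      simp only [this, if_false, if_true]
      exact (hdisj Q (hS'D' hQ)).mono_right (hE' Q hQ).2.1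
  · rw [Finset.sum_insert hQ₀S']
    have hvm : ∀ D : Finset (Set (Fin d → ℝ)), AEMeasurable
        (latticeMax (D : Set (Set (Fin d → ℝ))) r f x) μ := fun D =>
      aemeasurable_latticeMax hf r D.countable_toSet x
    -- the cubes that have been removed
    set D₁ := D.filter (fun R => R ⊆ Q₀ ∧ ¬ R ⊆ B) with hD₁
    have hsplit : ∀ ω, latticeMax (D : Set (Set (Fin d → ℝ))) r f x ω
        ≤ (∑ i : Fin 2, (latticeMax ((![D₁, D'] i : Finset _) : Set (Set (Fin d → ℝ))) r f x ω) ^ q)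
          ^ (1 / q) := by
      intro ω
      refine multiMax_le fun R hR hxR => ?_
      have hle : ∀ i : Fin 2, R ∈ ![D₁, D'] i → ∏ j, avg (r j) R (fun y => ‖f j y ω‖ₑ)
          ≤ (∑ i : Fin 2, (latticeMax ((![D₁, D'] i : Finset _) : Set (Set (Fin d → ℝ)))
            r f x ω) ^ q) ^ (1 / q) := by
        intro i hi
        have h1 : ∏ j, avg (r j) R (fun y => ‖f j y ω‖ₑ)
            ≤ latticeMax ((![D₁, D'] i : Finset _) : Set (Set (Fin d → ℝ))) r f x ω :=
          le_multiMax (Finset.mem_coe.2 hi) hxR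
        rw [← ENNReal.rpow_le_rpow_iff hq, ← ENNReal.rpow_mul, one_div_mul_cancel hq.ne',
          ENNReal.rpow_one]
        exact (ENNReal.rpow_le_rpow h1 hq.le).trans (Finset.single_le_sum
          (f := fun i => (latticeMax ((![D₁, D'] i : Finset _) : Set (Set (Fin d → ℝ)))
            r f x ω) ^ q) (fun _ _ => zero_le) (Finset.mem_univ i))
      by_cases h : R ⊆ Q₀ ∧ ¬ R ⊆ B
      · exact hle 0 (Finset.mem_filter.2 ⟨hR, h⟩)
      · refine hle 1 (Finset.mem_filter.2 ⟨hR, ?_⟩)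
        tauto
    have h1 : N D x ≤ (N D₁ x ^ q + N D' x ^ q) ^ (1 / q) := by
      refine (hX.2.eNrmPos_mono (hvm D) (ae_of_all _ hsplit)).trans ?_
      refine (hX.2.eNrmPos_sum_rpow_le hq hconv Finset.univ fun i _ => hvm _).trans ?_
      rw [Fin.sum_univ_two]
      rfl
    have h2 : N D₁ x ^ q ≤ (A : ℝ≥0∞) ^ q * Q₀.indicator (fun _ => c Q₀ ^ q) x := by
      rcases (D₁.filter (x ∈ ·)).eq_empty_or_nonempty with he | hne'
      · have h0 : latticeMax (D₁ : Set (Set (Fin d → ℝ))) r f x = fun _ => 0 := by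
          ext ω
          refine le_antisymm (multiMax_le fun R hR hxR => ?_) zero_le
          have : R ∈ D₁.filter (x ∈ ·) := Finset.mem_filter.2 ⟨hR, hxR⟩
          rw [he] at this
          exact absurd this (Finset.notMem_empty R)
        simp only [hN, h0, hX.2.eNrmPos_zero, ENNReal.zero_rpow_of_pos hq, zero_le]
      · obtain ⟨R, hR, hmin⟩ := (D₁.filter (x ∈ ·)).exists_minimal hne'
        obtain ⟨hRD₁, hxR⟩ := Finset.mem_filter.1 hR
        obtain ⟨hRD, hRQ, hRB⟩ := Finset.mem_filter.1 hRD₁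
        obtain ⟨y, hyR, hyB⟩ := not_subset.1 hRB
        have hy : N D₀ y ≤ A * c Q₀ := by
          by_contra hlt
          exact hyB ⟨hRQ hyR, not_le.1 hlt⟩
        rw [indicator_of_mem (hRQ hxR), ← ENNReal.mul_rpow_of_nonneg _ _ hq.le]
        refine ENNReal.rpow_le_rpow (le_trans ?_ hy) hq.le
        refine hX.2.eNrmPos_mono (hvm D₁) (ae_of_all _ fun ω => multiMax_le fun P hP hxP => ?_)
        obtain ⟨hPD, hPQ, hPB⟩ := Finset.mem_filter.1 (Finset.mem_coe.1 hP)
        have hRP : R ⊆ P := by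
          rcases grid_nested (hD hRD) (hD hPD) hxR hxP with h | h
          · exact h
          · exact hmin (Finset.mem_filter.2 ⟨hP, hxP⟩) h
        exact le_multiMax (Finset.mem_coe.2 (Finset.mem_filter.2 ⟨hPD, hPQ⟩)) (hRP hyR)
    have h3 : N D' x ^ q ≤ (A : ℝ≥0∞) ^ q * ∑ Q ∈ S', Q.indicator (fun _ => c Q ^ q) x := by
      refine (ENNReal.rpow_le_rpow (hS' x) hq.le).trans (le_of_eq ?_)
      rw [ENNReal.mul_rpow_of_nonneg _ _ hq.le, ← ENNReal.rpow_mul, one_div_mul_cancel hq.ne',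
        ENNReal.rpow_one]
    refine h1.trans ((ENNReal.rpow_le_rpow (add_le_add h2 h3) (by positivity)).trans ?_)
    rw [← mul_add, ENNReal.mul_rpow_of_nonneg _ _ (by positivity), ← ENNReal.rpow_mul,
      mul_one_div_cancel hq.ne', ENNReal.rpow_one]

end

/-! ### Reduction to countably many cubes and to translated grids -/

section

variable {d n : ℕ}

/-- The translations `0` and `2 ^ N / 3` in each coordinate, selected by `b`. -/
noncomputable def thirdShift (N : ℤ) (b : Fin d → Bool) : Fin d → ℝ :=
  fun i => if b i then 2 ^ N / 3 else 0

/-- The one-third trick on the line: no interval of length at most `1 / 3` contains both an integer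
and a point of `ℤ + 2 ^ j / 3` in its interior. -/
lemma exists_floor_eq_floor (j : ℕ) (α l : ℝ) (hl : l ≤ 1 / 3) :
    ∃ b : Bool, ∀ u, α ≤ u → u < α + l →
      ⌊u - (if b then 2 ^ j / 3 else 0)⌋ = ⌊α - (if b then 2 ^ j / 3 else 0 : ℝ)⌋ := by
  have key : ∀ s : ℝ, α - s + l ≤ ⌊α - s⌋ + 1 → ∀ u, α ≤ u → u < α + l → ⌊u - s⌋ = ⌊α - s⌋ := by
    intro s hs u h1 h2
    rw [Int.floor_eq_iff]
    exact ⟨(Int.floor_le _).trans (by linarith), by linarith⟩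
  by_cases h0 : α - 0 + l ≤ ⌊α - 0⌋ + 1
  · exact ⟨false, by simpa using key 0 h0⟩
  by_cases h1 : α - 2 ^ j / 3 + l ≤ ⌊α - 2 ^ j / 3⌋ + 1
  · exact ⟨true, by simpa using key _ h1⟩
  exfalso
  push Not at h0 h1
  rw [sub_zero] at h0
  have h2 := Int.lt_floor_add_one α
  have h3 := Int.lt_floor_add_one (α - 2 ^ j / 3 : ℝ)
  set a := ⌊α⌋
  set c := ⌊(α - 2 ^ j / 3 : ℝ)⌋
  have h4 : ((3 * (a - c) - 2 ^ j : ℤ) : ℝ) < 1 := by push_cast; linarith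
  have h5 : (-1 : ℝ) < ((3 * (a - c) - 2 ^ j : ℤ) : ℝ) := by push_cast; linarith
  have h6 : (3 * (a - c) - 2 ^ j : ℤ) < 1 := by exact_mod_cast h4
  have h7 : (-1 : ℤ) < 3 * (a - c) - 2 ^ j := by exact_mod_cast h5
  have h8 : (3 : ℤ) ∣ 2 ^ j := ⟨a - c, by omega⟩
  have h9 := Int.prime_three.dvd_of_dvd_pow h8
  norm_num at h9

/-- Every cube is contained in a comparable cube of one of the `2 ^ d` translated dyadic grids. -/
lemma exists_grid_superset {Q : Set (Fin d → ℝ)} (hQ : Q ∈ cubes d) :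
    ∃ N₀ : ℤ, ∀ N ≥ N₀, ∃ b : Fin d → Bool, ∃ R ∈ grid (thirdShift N b),
      Q ⊆ R ∧ volume R ≤ 6 ^ d * volume Q := by
  obtain ⟨a, l, hl, rfl⟩ := hQ
  obtain ⟨k, hk1, hk2⟩ := exists_mem_Ioc_zpow (x := 3 * l) (by positivity) (one_lt_two (α := ℝ))
  refine ⟨k + 1, fun N hN => ?_⟩
  obtain ⟨j, hj⟩ := Int.le.dest hN
  have hpos : (0 : ℝ) < 2 ^ (-(k + 1)) := by positivity
  have hmul : (2 : ℝ) ^ (-(k + 1)) * 2 ^ (k + 1) = 1 := by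
    rw [← zpow_add₀ two_ne_zero]; simp
  have hs : (2 : ℝ) ^ (-(k + 1)) * 2 ^ N = 2 ^ j := by
    rw [← zpow_add₀ two_ne_zero, ← zpow_natCast]
    congr 1
    omega
  have hl' : (2 : ℝ) ^ (-(k + 1)) * l ≤ 1 / 3 := by
    have := mul_le_mul_of_nonneg_left hk2 hpos.le
    rw [hmul] at this
    linarith
  choose b hb using fun i => exists_floor_eq_floor j (2 ^ (-(k + 1)) * a i) _ hl'
  refine ⟨b, gridCube (thirdShift N b) (-(k + 1)) a, ⟨_, _, rfl⟩, fun x hx => ?_, ?_⟩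
  · change gridIdx _ _ x = gridIdx _ _ a
    ext i
    have hxi := hx i (mem_univ i)
    have h1 : (2 : ℝ) ^ (-(k + 1)) * thirdShift N b i = if b i then 2 ^ j / 3 else 0 := by
      simp only [thirdShift]
      split_ifs
      · rw [← hs]; ring
      · simp
    simp only [gridIdx, mul_sub, h1]
    refine hb i _ (mul_le_mul_of_nonneg_left hxi.1 hpos.le) ?_
    rw [← mul_add]
    exact mul_lt_mul_of_pos_left hxi.2 hpos
  · rw [volume_gridCube, volume_pi_pi]
    simp only [Real.volume_Ico, add_sub_cancel_left, Finset.prod_const, Finset.card_univ,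
      Fintype.card_fin, neg_neg]
    rw [← mul_pow]
    gcongr
    have h6 : (6 : ℝ≥0∞) = ENNReal.ofReal 6 := by simp
    rw [h6, ← ENNReal.ofReal_mul (by norm_num)]
    refine ENNReal.ofReal_le_ofReal ?_
    rw [zpow_add_one₀ two_ne_zero]
    linarith

/-- A finite collection of cubes can be enlarged, cube by cube, to finite subcollections of `2 ^ d`
translated dyadic grids. -/
lemma exists_shifted_grids {D : Finset (Set (Fin d → ℝ))}
    (hD : (D : Set (Set (Fin d → ℝ))) ⊆ cubes d) :
    ∃ (τ : (Fin d → Bool) → Fin d → ℝ) (D' : (Fin d → Bool) → Finset (Set (Fin d → ℝ))),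
      (∀ b, (D' b : Set (Set (Fin d → ℝ))) ⊆ grid (τ b)) ∧
      ∀ Q ∈ D, ∃ b, ∃ R ∈ D' b, Q ⊆ R ∧ volume R ≤ 6 ^ d * volume Q := by
  classical
  choose! N₀ hN₀ using fun Q (hQ : Q ∈ D) => exists_grid_superset (hD (Finset.mem_coe.2 hQ))
  obtain ⟨N, hN⟩ := (D.image N₀).exists_le
  choose! b R hR hQR hvol using fun Q (hQ : Q ∈ D) =>
    hN₀ Q hQ N (hN _ (Finset.mem_image_of_mem _ hQ))
  refine ⟨thirdShift N, fun c => (D.filter (b · = c)).image R, fun c P hP => ?_, fun Q hQ => ?_⟩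
  · obtain ⟨Q, hQ, rfl⟩ := Finset.mem_image.1 (Finset.mem_coe.1 hP)
    obtain ⟨hQD, rfl⟩ := Finset.mem_filter.1 hQ
    exact hR Q hQD
  · exact ⟨b Q, R Q, Finset.mem_image_of_mem _ (Finset.mem_filter.2 ⟨hQ, rfl⟩), hQR Q hQ,
      hvol Q hQ⟩

/-- The cubes with rational corners and rational side length. -/
def ratCubes (d : ℕ) : Set (Set (Fin d → ℝ)) :=
  {Q | ∃ (a : Fin d → ℚ) (l : ℚ), 0 < l ∧
    Q = univ.pi fun i => Ico (a i : ℝ) ((a i : ℝ) + (l : ℝ))}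

lemma ratCubes_subset_cubes : ratCubes d ⊆ cubes d := by
  rintro _ ⟨a, l, hl, rfl⟩
  exact ⟨fun i => a i, l, by exact_mod_cast hl, rfl⟩

lemma countable_ratCubes : (ratCubes d).Countable := by
  refine (countable_range fun z : (Fin d → ℚ) × ℚ =>
    univ.pi fun i => Ico (z.1 i : ℝ) ((z.1 i : ℝ) + (z.2 : ℝ))).mono ?_
  rintro _ ⟨a, l, -, rfl⟩
  exact ⟨(a, l), rfl⟩

lemma nonempty_ratCubes : (ratCubes d).Nonempty := ⟨_, 0, 1, one_pos, rfl⟩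

lemma exists_ratCube_superset {Q : Set (Fin d → ℝ)} (hQ : Q ∈ cubes d) {δ : ℝ} (hδ : 0 < δ) :
    ∃ R ∈ ratCubes d, Q ⊆ R ∧ volume R ≤ ENNReal.ofReal ((1 + δ) ^ d) * volume Q := by
  obtain ⟨a, l, hl, rfl⟩ := hQ
  have hδl : 0 < δ * l := by positivity
  choose a' ha1 ha2 using fun i => exists_rat_btwn (show a i - δ * l / 2 < a i by linarith)
  obtain ⟨l', hl1, hl2⟩ := exists_rat_btwn (show l + δ * l / 2 < l + δ * l by linarith)
  have hl'pos : (0 : ℝ) < l' := by linarith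
  refine ⟨_, ⟨a', l', by exact_mod_cast hl'pos, rfl⟩, ?_, ?_⟩
  · refine Set.pi_mono fun i _ => Ico_subset_Ico (ha2 i).le ?_
    linarith [ha1 i]
  · rw [volume_pi_pi, volume_pi_pi]
    simp only [Real.volume_Ico, add_sub_cancel_left, Finset.prod_const, Finset.card_univ,
      Fintype.card_fin]
    rw [ENNReal.ofReal_pow (by positivity), ← mul_pow, ← ENNReal.ofReal_mul (by positivity)]
    gcongr
    linarith

/-- Enlarging cubes slightly shows that the maximal operator over all cubes is the one over
rational cubes. -/
lemma multiMax_cubes_eq_ratCubes {s : Fin n → ℝ} (hs : ∀ j, 0 < s j)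
    (h : Fin n → (Fin d → ℝ) → ℝ≥0∞) (x : Fin d → ℝ) :
    multiMax (cubes d) s h x = multiMax (ratCubes d) s h x := by
  refine le_antisymm (multiMax_le fun Q hQ hx => ?_) (multiMax_mono ratCubes_subset_cubes s h x)
  set M := multiMax (ratCubes d) s h x
  have hle : ∀ δ : ℝ, 0 < δ → ∏ j, avg (s j) Q (h j)
      ≤ ENNReal.ofReal ((1 + δ) ^ d) ^ (∑ j, 1 / s j) * M := by
    intro δ hδ
    obtain ⟨R, hR, hQR, hvol⟩ := exists_ratCube_superset hQ hδ
    rw [← ennreal_prod_rpow_eq_rpow_sum _ fun j _ => (one_div_pos.2 (hs j)).le]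
    refine le_trans ?_ (mul_le_mul_right (le_multiMax hR (hQR hx)) _)
    rw [← Finset.prod_mul_distrib]
    refine Finset.prod_le_prod' fun j _ => avg_le_of_subset (hs j) hQR ?_ ENNReal.ofReal_ne_top
      hvol (h j)
    rw [ne_eq, ENNReal.ofReal_eq_zero, not_le]
    positivity
  have h1 : Tendsto (fun δ : ℝ => ENNReal.ofReal ((1 + δ) ^ d)) (𝓝[>] 0) (𝓝 1) := by
    have hc : Continuous fun δ : ℝ => ENNReal.ofReal ((1 + δ) ^ d) :=
      ENNReal.continuous_ofReal.comp (by fun_prop)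
    have := hc.tendsto 0
    simp only [add_zero, one_pow, ENNReal.ofReal_one] at this
    exact this.mono_left nhdsWithin_le_nhds
  have h2 : Tendsto (fun δ : ℝ => ENNReal.ofReal ((1 + δ) ^ d) ^ (∑ j, 1 / s j) * M) (𝓝[>] 0)
      (𝓝 (1 ^ (∑ j, 1 / s j) * M)) :=
    ENNReal.Tendsto.mul_const
      ((ENNReal.continuous_rpow_const.tendsto _).comp h1) (Or.inl (by simp))
  rw [ENNReal.one_rpow, one_mul] at h2
  refine ge_of_tendsto h2 ?_
  filter_upwards [self_mem_nhdsWithin] with δ hδ using hle δ hδ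

/-- The maximal operator over all cubes is the increasing limit of maximal operators over finite
collections of cubes. -/
lemma exists_finset_iSup_multiMax (d : ℕ) : ∃ D : ℕ → Finset (Set (Fin d → ℝ)), Monotone D ∧
    (∀ k, (D k : Set (Set (Fin d → ℝ))) ⊆ cubes d) ∧
    ∀ (n : ℕ) (s : Fin n → ℝ), (∀ j, 0 < s j) → ∀ (h : Fin n → (Fin d → ℝ) → ℝ≥0∞)
      (x : Fin d → ℝ), multiMax (cubes d) s h x
        = ⨆ k, multiMax (D k : Set (Set (Fin d → ℝ))) s h x := by
  classical
  obtain ⟨e, he⟩ := (countable_ratCubes (d := d)).exists_eq_range nonempty_ratCubes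
  have hsub : ∀ k, (((Finset.range k).image e : Finset _) : Set (Set (Fin d → ℝ))) ⊆ cubes d := by
    intro k Q hQ
    obtain ⟨i, -, rfl⟩ := Finset.mem_image.1 (Finset.mem_coe.1 hQ)
    exact ratCubes_subset_cubes (he ▸ mem_range_self i)
  refine ⟨fun k => (Finset.range k).image e, fun k l hkl =>
    Finset.image_subset_image (Finset.range_mono hkl), hsub, fun n s hs h x => ?_⟩
  refine le_antisymm ?_ (iSup_le fun k => multiMax_mono (hsub k) s h x)
  rw [multiMax_cubes_eq_ratCubes hs]
  refine multiMax_le fun Q hQ hx => ?_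
  rw [he] at hQ
  obtain ⟨i, rfl⟩ := hQ
  refine le_iSup_of_le (i + 1) (le_multiMax ?_ hx)
  exact Finset.mem_coe.2 (Finset.mem_image_of_mem _ (by simp))

end

/-! ### The weighted estimate -/

section

variable {d : ℕ}

lemma exists_isCompact_superset {Q : Set (Fin d → ℝ)} (hQ : Q ∈ cubes d) :
    ∃ K, IsCompact K ∧ Q ⊆ K := by
  obtain ⟨a, l, hl, rfl⟩ := hQ
  exact ⟨univ.pi fun i => Icc (a i) (a i + l), isCompact_univ_pi fun i => isCompact_Icc,
    Set.pi_mono fun i _ => Ico_subset_Icc_self⟩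

lemma eLpNorm_ofReal {α : Type*} [MeasurableSpace α] {ρ : Measure α} {q : ℝ} (hq : 0 < q)
    (F : α → ℝ≥0∞) : eLpNorm F (ENNReal.ofReal q) ρ = (∫⁻ x, F x ^ q ∂ρ) ^ (1 / q) := by
  rw [eLpNorm_eq_lintegral_rpow_enorm_toReal (by simpa using hq) ENNReal.ofReal_ne_top,
    ENNReal.toReal_ofReal hq.le]
  simp

lemma avg_eNrm_ne_top {Ω 𝕜 : Type*} [MeasurableSpace Ω] [RCLike 𝕜] {μ : Measure Ω}
    {X : FnSpace Ω 𝕜} {r : ℝ} (hr : 0 < r) {f : (Fin d → ℝ) → Ω → 𝕜}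
    (hf : MemBochnerLoc μ X (ENNReal.ofReal r) f) {Q : Set (Fin d → ℝ)} (hQ : Q ∈ cubes d) :
    avg r Q (fun y => eNrm X (f y)) ≠ ∞ := by
  obtain ⟨K, hK, hQK⟩ := exists_isCompact_superset hQ
  have h := hf.2 K hK
  rw [eLpNorm_ofReal hr, ENNReal.rpow_lt_top_iff_of_pos (by positivity)] at h
  refine ENNReal.rpow_ne_top_of_nonneg (by positivity) (ENNReal.div_ne_top ?_
    (volume_ne_zero_of_mem_cubes hQ))
  exact ((lintegral_mono_set hQK).trans_lt h).ne

/-- The weighted maximal operator on the right-hand side of the estimates dominates a weighted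
sparse sum: on the disjoint sets `E Q` it is at least the corresponding product of averages. -/
lemma lintegral_sparse_mul_le {m : ℕ} {r : Fin m → ℝ} {q : ℝ} (hq : 0 < q)
    (h : Fin m → (Fin d → ℝ) → ℝ≥0∞) {G : (Fin d → ℝ) → ℝ≥0∞} (hG : AEMeasurable G)
    {S : Finset (Set (Fin d → ℝ))} (hS : (S : Set (Set (Fin d → ℝ))) ⊆ cubes d)
    (hsp : IsSparse (S : Set (Set (Fin d → ℝ)))) :
    ∫⁻ x, (∑ Q ∈ S, Q.indicator (fun _ => (∏ j, avg (r j) Q (h j)) ^ q) x) * G x ^ q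
      ≤ 2 * ∫⁻ x, multiMax (cubes d) (Fin.snoc (α := fun _ => ℝ) r q)
          (Fin.snoc (α := fun _ => (Fin d → ℝ) → ℝ≥0∞) h G) x ^ q := by
  obtain ⟨E, hE, hEd⟩ := hsp
  set M := multiMax (cubes d) (Fin.snoc (α := fun _ => ℝ) r q)
    (Fin.snoc (α := fun _ => (Fin d → ℝ) → ℝ≥0∞) h G) with hM
  have hterm : ∀ Q ∈ S, ∫⁻ x, Q.indicator (fun _ => (∏ j, avg (r j) Q (h j)) ^ q) x * G x ^ q
      ≤ 2 * ∫⁻ x in E Q, M x ^ q := by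
    intro Q hQ
    have hQc := hS hQ
    have hQm := measurableSet_of_mem_cubes hQc
    obtain ⟨hEm, hEQ, hEv⟩ := hE Q hQ
    have hMle : ∀ x ∈ Q, (∏ j, avg (r j) Q (h j)) * avg q Q G ≤ M x := by
      intro x hx
      refine le_trans (le_of_eq ?_) (le_multiMax hQc hx)
      rw [Fin.prod_univ_castSucc]
      simp
    calc ∫⁻ x, Q.indicator (fun _ => (∏ j, avg (r j) Q (h j)) ^ q) x * G x ^ q
        = ∫⁻ x in Q, (∏ j, avg (r j) Q (h j)) ^ q * G x ^ q := by
          rw [← lintegral_indicator hQm]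
          refine lintegral_congr fun x => ?_
          by_cases hx : x ∈ Q <;> simp [hx]
      _ = (∏ j, avg (r j) Q (h j)) ^ q * ∫⁻ x in Q, G x ^ q :=
          lintegral_const_mul'' _ ((hG.pow_const q).restrict)
      _ = ((∏ j, avg (r j) Q (h j)) * avg q Q G) ^ q * volume Q := by
          rw [← avg_rpow_mul_volume hq hQc, ENNReal.mul_rpow_of_nonneg _ _ hq.le, mul_assoc]
      _ ≤ ((∏ j, avg (r j) Q (h j)) * avg q Q G) ^ q * (2 * volume (E Q)) := by
          gcongr
          rw [mul_comm]
          exact (ENNReal.div_le_iff (by simp) (by simp)).1 hEv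
      _ = 2 * ∫⁻ _ in E Q, ((∏ j, avg (r j) Q (h j)) * avg q Q G) ^ q := by
          rw [setLIntegral_const]; ring
      _ ≤ 2 * ∫⁻ x in E Q, M x ^ q := by
          gcongr 2 * ?_
          exact setLIntegral_mono' hEm fun x hx =>
            ENNReal.rpow_le_rpow (hMle x (hEQ hx)) hq.le
  have hmeas : ∀ Q ∈ S, AEMeasurable (fun x =>
      Q.indicator (fun _ => (∏ j, avg (r j) Q (h j)) ^ q) x * G x ^ q) := fun Q hQ =>
    (aemeasurable_const.indicator (measurableSet_of_mem_cubes (hS hQ))).mul (hG.pow_const q)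
  simp only [Finset.sum_mul]
  rw [lintegral_finsetSum' _ hmeas]
  refine (Finset.sum_le_sum hterm).trans ?_
  rw [← Finset.mul_sum, ← lintegral_biUnion_finset hEd fun Q hQ => (hE Q hQ).1]
  exact mul_le_mul_right (setLIntegral_le_lintegral _ _) _

variable {Ω 𝕜 : Type*} [MeasurableSpace Ω] [RCLike 𝕜] {μ : Measure Ω} {m : ℕ}

/-- By the one-third trick, the lattice maximal function over a finite family of cubes is controlled
by those over finite families of translated dyadic cubes; `q`-convexity passes to the norms. -/
lemma eNrmPos_latticeMax_le_sum_shifted [SFinite μ] {X : Fin m → FnSpace Ω 𝕜}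
    (hX : IsQBFSTuple μ X) {r : Fin m → ℝ} (hr : ∀ j, 0 < r j) {q : ℝ} (hq : 0 < q)
    (hconv : PConvex (prodSpace μ X) q) {f : Fin m → (Fin d → ℝ) → Ω → 𝕜}
    (hf : ∀ j, AEStronglyMeasurable (Function.uncurry (f j))
      ((volume : Measure (Fin d → ℝ)).prod μ))
    {ι : Type*} [Fintype ι] {D : Finset (Set (Fin d → ℝ))} {D' : ι → Finset (Set (Fin d → ℝ))}
    (hDD' : ∀ Q ∈ D, ∃ b, ∃ R ∈ D' b, Q ⊆ R ∧ volume R ≤ 6 ^ d * volume Q) (x : Fin d → ℝ) :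
    eNrmPos μ (prodSpace μ X) (latticeMax (D : Set (Set (Fin d → ℝ))) r f x) ^ q
      ≤ (((6 ^ d : ℝ≥0) ^ (∑ j, 1 / r j) : ℝ≥0) : ℝ≥0∞) ^ q * ∑ b,
        eNrmPos μ (prodSpace μ X) (latticeMax (D' b : Set (Set (Fin d → ℝ))) r f x) ^ q := by
  set κ : ℝ≥0 := (6 ^ d : ℝ≥0) ^ (∑ j, 1 / r j)
  have hκ : (κ : ℝ≥0∞) = (6 ^ d) ^ (∑ j, 1 / r j) := by
    rw [ENNReal.coe_rpow_of_nonneg _ (Finset.sum_nonneg fun j _ => (one_div_pos.2 (hr j)).le)]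
    push_cast
    rfl
  have hvm : ∀ D : Finset (Set (Fin d → ℝ)), AEMeasurable
      (latticeMax (D : Set (Set (Fin d → ℝ))) r f x) μ := fun D =>
    aemeasurable_latticeMax hf r D.countable_toSet x
  have hpt : ∀ ω, latticeMax (D : Set (Set (Fin d → ℝ))) r f x ω ≤ κ *
      (∑ b, latticeMax (D' b : Set (Set (Fin d → ℝ))) r f x ω ^ q) ^ (1 / q) := by
    intro ω
    refine multiMax_le fun Q hQ hx => ?_
    obtain ⟨b, R, hR, hQR, hvol⟩ := hDD' Q hQ
    have h1 : ∏ j, avg (r j) R (fun y => ‖f j y ω‖ₑ)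
        ≤ latticeMax (D' b : Set (Set (Fin d → ℝ))) r f x ω :=
      le_multiMax (Finset.mem_coe.2 hR) (hQR hx)
    calc ∏ j, avg (r j) Q (fun y => ‖f j y ω‖ₑ)
        ≤ ∏ j, ((6 ^ d : ℝ≥0∞) ^ (1 / r j) * avg (r j) R (fun y => ‖f j y ω‖ₑ)) :=
          Finset.prod_le_prod' fun j _ => avg_le_of_subset (hr j) hQR (by simp)
            (ENNReal.pow_ne_top (by simp)) hvol _
      _ = κ * ∏ j, avg (r j) R (fun y => ‖f j y ω‖ₑ) := by
          rw [Finset.prod_mul_distrib,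
            ennreal_prod_rpow_eq_rpow_sum _ fun j _ => (one_div_pos.2 (hr j)).le, hκ]
      _ ≤ _ := by
          gcongr
          rw [← ENNReal.rpow_le_rpow_iff hq, ← ENNReal.rpow_mul, one_div_mul_cancel hq.ne',
            ENNReal.rpow_one]
          exact (ENNReal.rpow_le_rpow h1 hq.le).trans (Finset.single_le_sum
            (f := fun b => latticeMax (D' b : Set (Set (Fin d → ℝ))) r f x ω ^ q)
            (fun _ _ => zero_le) (Finset.mem_univ b))
  have h2 := (hX.2.eNrmPos_mono (hvm D) (ae_of_all _ hpt)).trans_eq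
    (hX.2.eNrmPos_const_mul κ _)
  have h3 := h2.trans (mul_le_mul_right
    (hX.2.eNrmPos_sum_rpow_le hq hconv Finset.univ fun b _ => hvm (D' b)) _)
  refine (ENNReal.rpow_le_rpow h3 hq.le).trans (le_of_eq ?_)
  rw [ENNReal.mul_rpow_of_nonneg _ _ hq.le, ← ENNReal.rpow_mul, one_div_mul_cancel hq.ne',
    ENNReal.rpow_one]

lemma eNrmPos_latticeMax_cubes_eq_iSup [SFinite μ] {X : Fin m → FnSpace Ω 𝕜}
    (hX : IsQBFSTuple μ X) {r : Fin m → ℝ} (hr : ∀ j, 0 < r j)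
    {f : Fin m → (Fin d → ℝ) → Ω → 𝕜}
    (hf : ∀ j, AEStronglyMeasurable (Function.uncurry (f j))
      ((volume : Measure (Fin d → ℝ)).prod μ))
    {D : ℕ → Finset (Set (Fin d → ℝ))} (hDmono : Monotone D)
    (hDsup : ∀ (n : ℕ) (s : Fin n → ℝ), (∀ j, 0 < s j) → ∀ (h : Fin n → (Fin d → ℝ) → ℝ≥0∞)
      (x : Fin d → ℝ), multiMax (cubes d) s h x
        = ⨆ k, multiMax (D k : Set (Set (Fin d → ℝ))) s h x) (x : Fin d → ℝ) :
    eNrmPos μ (prodSpace μ X) (latticeMax (cubes d) r f x)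
      = ⨆ k, eNrmPos μ (prodSpace μ X) (latticeMax (D k : Set (Set (Fin d → ℝ))) r f x) := by
  have h1 : latticeMax (cubes d) r f x
      = fun ω => ⨆ k, latticeMax (D k : Set (Set (Fin d → ℝ))) r f x ω := by
    ext ω
    exact hDsup m r hr _ x
  rw [h1, hX.2.eNrmPos_iSup fun k => aemeasurable_latticeMax hf r (D k).countable_toSet x]
  exact ae_of_all _ fun ω i j hij => multiMax_mono (Finset.coe_subset.2 (hDmono hij)) _ _ _

/-- The weighted estimate for the lattice maximal operator over all cubes, from sparse domination
in translated dyadic grids. -/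
theorem eLpNorm_eNrmPos_latticeMax_mul_le [SFinite μ] {X : Fin m → FnSpace Ω 𝕜}
    (hX : IsQBFSTuple μ X) {r : Fin m → ℝ} (hr : ∀ j, 0 < r j) {q : ℝ} (hq : 0 < q)
    (hconv : PConvex (prodSpace μ X) q) {A : ℝ≥0} {f : Fin m → (Fin d → ℝ) → Ω → 𝕜}
    (hf : ∀ j, AEStronglyMeasurable (Function.uncurry (f j))
      ((volume : Measure (Fin d → ℝ)).prod μ))
    (hA : ∀ τ : Fin d → ℝ, ∀ D : Finset (Set (Fin d → ℝ)),
      (D : Set (Set (Fin d → ℝ))) ⊆ grid τ → ∃ S ⊆ D, IsSparse (S : Set (Set (Fin d → ℝ))) ∧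
      ∀ x, eNrmPos μ (prodSpace μ X) (latticeMax (D : Set (Set (Fin d → ℝ))) r f x)
        ≤ A * (∑ Q ∈ S, Q.indicator
            (fun _ => (∏ j, avg (r j) Q (fun y => eNrm (X j) (f j y))) ^ q) x) ^ (1 / q))
    {G : (Fin d → ℝ) → ℝ≥0∞} (hG : AEMeasurable G) :
    eLpNorm (fun x => eNrmPos μ (prodSpace μ X) (latticeMax (cubes d) r f x) * G x)
        (ENNReal.ofReal q) volume
      ≤ (((6 ^ d : ℝ≥0) ^ (∑ j, 1 / r j) : ℝ≥0) : ℝ≥0∞) * A * (2 ^ (d + 1)) ^ (1 / q) *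
        eLpNorm (multiMax (cubes d) (Fin.snoc (α := fun _ => ℝ) r q)
          (Fin.snoc (α := fun _ => (Fin d → ℝ) → ℝ≥0∞) (fun j y => eNrm (X j) (f j y)) G))
          (ENNReal.ofReal q) volume := by
  set κ : ℝ≥0 := (6 ^ d : ℝ≥0) ^ (∑ j, 1 / r j)
  set I := ∫⁻ x, multiMax (cubes d) (Fin.snoc (α := fun _ => ℝ) r q)
          (Fin.snoc (α := fun _ => (Fin d → ℝ) → ℝ≥0∞) (fun j y => eNrm (X j) (f j y)) G) x ^ q
    with hI
  set N : Set (Set (Fin d → ℝ)) → (Fin d → ℝ) → ℝ≥0∞ := fun 𝒬 x =>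
    eNrmPos μ (prodSpace μ X) (latticeMax 𝒬 r f x) with hN
  have hgrid : ∀ τ : Fin d → ℝ, ∀ D : Finset (Set (Fin d → ℝ)),
      (D : Set (Set (Fin d → ℝ))) ⊆ grid τ →
        ∫⁻ x, N D x ^ q * G x ^ q ≤ (A : ℝ≥0∞) ^ q * (2 * I) := by
    intro τ D hD
    obtain ⟨S, hSD, hS, hle⟩ := hA τ D hD
    have hSc : (S : Set (Set (Fin d → ℝ))) ⊆ cubes d := fun Q hQ =>
      grid_subset_cubes τ (hD (hSD hQ))
    refine le_trans ?_ (mul_le_mul_right (lintegral_sparse_mul_le hq _ hG hSc hS) _)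
    rw [← lintegral_const_mul' _ _ (ENNReal.rpow_ne_top_of_nonneg hq.le ENNReal.coe_ne_top)]
    refine lintegral_mono fun x => ?_
    rw [← mul_assoc]
    gcongr
    refine (ENNReal.rpow_le_rpow (hle x) hq.le).trans (le_of_eq ?_)
    rw [ENNReal.mul_rpow_of_nonneg _ _ hq.le, ← ENNReal.rpow_mul, one_div_mul_cancel hq.ne',
      ENNReal.rpow_one]
  have hfinite : ∀ D : Finset (Set (Fin d → ℝ)), (D : Set (Set (Fin d → ℝ))) ⊆ cubes d →
      ∫⁻ x, N D x ^ q * G x ^ q ≤ (κ : ℝ≥0∞) ^ q * (2 ^ d * ((A : ℝ≥0∞) ^ q * (2 * I))) := by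
    intro D hD
    obtain ⟨τ, D', hD', hDD'⟩ := exists_shifted_grids hD
    have hm : ∀ b, AEMeasurable fun x => N (D' b) x ^ q * G x ^ q := fun b =>
      ((measurable_eNrmPos_latticeMax (prodSpace μ X) r f
        ((hD' b).trans (grid_subset_cubes _))).pow_const q).aemeasurable.mul (hG.pow_const q)
    calc ∫⁻ x, N D x ^ q * G x ^ q
        ≤ ∫⁻ x, (κ : ℝ≥0∞) ^ q * ∑ b, N (D' b) x ^ q * G x ^ q := by
          refine lintegral_mono fun x => ?_
          rw [← Finset.sum_mul, ← mul_assoc]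
          gcongr
          exact eNrmPos_latticeMax_le_sum_shifted hX hr hq hconv hf hDD' x
      _ = (κ : ℝ≥0∞) ^ q * ∑ b, ∫⁻ x, N (D' b) x ^ q * G x ^ q := by
          rw [lintegral_const_mul' _ _ (ENNReal.rpow_ne_top_of_nonneg hq.le ENNReal.coe_ne_top),
            lintegral_finsetSum' _ fun b _ => hm b]
      _ ≤ (κ : ℝ≥0∞) ^ q * ∑ _b : Fin d → Bool, (A : ℝ≥0∞) ^ q * (2 * I) := by
          gcongr with b
          exact hgrid (τ b) (D' b) (hD' b)
      _ = _ := by simp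
  obtain ⟨D, hDmono, hDc, hDsup⟩ := exists_finset_iSup_multiMax d
  have hsup := eNrmPos_latticeMax_cubes_eq_iSup hX hr hf hDmono hDsup
  have hNmono : ∀ x, Monotone fun k => N (D k) x := fun x i j hij =>
    hX.2.eNrmPos_mono (aemeasurable_latticeMax hf r (D i).countable_toSet x)
      (ae_of_all _ fun ω => multiMax_mono (Finset.coe_subset.2 (hDmono hij)) _ _ _)
  have hall : ∫⁻ x, (N (cubes d) x * G x) ^ q
      ≤ (κ : ℝ≥0∞) ^ q * (2 ^ d * ((A : ℝ≥0∞) ^ q * (2 * I))) := by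
    have h1 : ∀ x, (N (cubes d) x * G x) ^ q = ⨆ k, N (D k) x ^ q * G x ^ q := by
      intro x
      simp only [hN]
      rw [ENNReal.mul_rpow_of_nonneg _ _ hq.le, hsup, ← ENNReal.iSup_mul]
      congr 1
      exact (ENNReal.orderIsoRpow q hq).map_iSup _
    simp only [h1]
    rw [lintegral_iSup']
    · exact iSup_le fun k => hfinite (D k) (hDc k)
    · exact fun k => ((measurable_eNrmPos_latticeMax (prodSpace μ X) r f
        (hDc k)).pow_const q).aemeasurable.mul (hG.pow_const q)
    · exact ae_of_all _ fun x i j hij =>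
        mul_le_mul_left (ENNReal.rpow_le_rpow (hNmono x hij) hq.le) _
  rw [eLpNorm_ofReal hq, eLpNorm_ofReal hq]
  refine (ENNReal.rpow_le_rpow hall (by positivity)).trans (le_of_eq ?_)
  have hq' : 0 ≤ 1 / q := by positivity
  rw [show (κ : ℝ≥0∞) ^ q * (2 ^ d * ((A : ℝ≥0∞) ^ q * (2 * I)))
      = (κ : ℝ≥0∞) ^ q * (A : ℝ≥0∞) ^ q * 2 ^ (d + 1) * I by ring,
    ENNReal.mul_rpow_of_nonneg _ _ hq', ENNReal.mul_rpow_of_nonneg _ _ hq',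
    ENNReal.mul_rpow_of_nonneg _ _ hq', ← ENNReal.rpow_mul, ← ENNReal.rpow_mul,
    mul_one_div_cancel hq.ne', ENNReal.rpow_one, ENNReal.rpow_one]

end

/-! ### Membership in the Bochner space -/

section

variable {Ω 𝕜 : Type*} [MeasurableSpace Ω] [RCLike 𝕜] {μ : Measure Ω} {d m : ℕ}

/-- The values of the lattice maximal function over finitely many cubes lie in the product space. -/
lemma eNrmPos_latticeMax_finset_ne_top [SFinite μ] {X : Fin m → FnSpace Ω 𝕜}
    (hX : IsQBFSTuple μ X) {r : Fin m → ℝ} {q : ℝ} (hq : 0 < q)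
    (hconv : PConvex (prodSpace μ X) q) {f : Fin m → (Fin d → ℝ) → Ω → 𝕜}
    (hf : ∀ j, AEStronglyMeasurable (Function.uncurry (f j))
      ((volume : Measure (Fin d → ℝ)).prod μ))
    (hfin : ∀ j, ∀ Q ∈ cubes d, eNrmPos μ (X j) (fun ω => avg (r j) Q fun y => ‖f j y ω‖ₑ) ≠ ∞)
    {D : Finset (Set (Fin d → ℝ))} (hD : (D : Set (Set (Fin d → ℝ))) ⊆ cubes d)
    (x : Fin d → ℝ) :
    eNrmPos μ (prodSpace μ X) (latticeMax (D : Set (Set (Fin d → ℝ))) r f x) ≠ ∞ := by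
  have hpt : ∀ ω, latticeMax (D : Set (Set (Fin d → ℝ))) r f x ω
      ≤ (∑ Q ∈ D, (∏ j, avg (r j) Q fun y => ‖f j y ω‖ₑ) ^ q) ^ (1 / q) := by
    intro ω
    refine multiMax_le fun Q hQ _ => ?_
    rw [← ENNReal.rpow_le_rpow_iff hq, ← ENNReal.rpow_mul, one_div_mul_cancel hq.ne',
      ENNReal.rpow_one]
    exact Finset.single_le_sum (f := fun Q => (∏ j, avg (r j) Q fun y => ‖f j y ω‖ₑ) ^ q)
      (fun _ _ => zero_le) (Finset.mem_coe.1 hQ)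
  refine ((hX.2.eNrmPos_mono (aemeasurable_latticeMax hf r D.countable_toSet x)
    (ae_of_all _ hpt)).trans (hX.2.eNrmPos_sum_rpow_le hq hconv D fun Q _ =>
      aemeasurable_prod_avg hf r Q)).trans_lt ?_ |>.ne
  refine ENNReal.rpow_lt_top_of_nonneg (by positivity) (ENNReal.sum_ne_top.2 fun Q hQ => ?_)
  refine ENNReal.rpow_ne_top_of_nonneg hq.le ?_
  refine ((eNrmPos_prod_le hX (fun j => aemeasurable_avg (hf j) (r j) Q)
    fun j => hfin j Q (hD hQ)).trans_lt ?_).ne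
  exact ENNReal.prod_lt_top fun j _ => (hfin j Q (hD hQ)).lt_top

lemma aemeasurable_uncurry_latticeMax [SFinite μ] {r : Fin m → ℝ} (hr : ∀ j, 0 < r j)
    {f : Fin m → (Fin d → ℝ) → Ω → 𝕜}
    (hf : ∀ j, AEStronglyMeasurable (Function.uncurry (f j))
      ((volume : Measure (Fin d → ℝ)).prod μ)) :
    AEMeasurable (Function.uncurry (latticeMax (cubes d) r f))
      ((volume : Measure (Fin d → ℝ)).prod μ) := by
  have h : Function.uncurry (latticeMax (cubes d) r f) = fun z : (Fin d → ℝ) × Ω =>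
      ⨆ Q ∈ ratCubes d, (Q ×ˢ (univ : Set Ω)).indicator
        (fun z => ∏ j, avg (r j) Q fun y => ‖f j y z.2‖ₑ) z := by
    ext ⟨x, ω⟩
    change multiMax (cubes d) r _ x = _
    rw [multiMax_cubes_eq_ratCubes hr]
    refine iSup_congr fun Q => iSup_congr fun _ => ?_
    by_cases hx : x ∈ Q <;> simp [hx]
  rw [h]
  refine AEMeasurable.biSup _ countable_ratCubes fun Q hQ => ?_
  exact ((aemeasurable_prod_avg hf r Q).comp_quasiMeasurePreserving
    Measure.quasiMeasurePreserving_snd).indicator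
    ((measurableSet_of_mem_cubes (ratCubes_subset_cubes hQ)).prod MeasurableSet.univ)

/-- If the norm of the lattice maximal function, multiplied by `g`, is in `L^q`, then the product is
strongly measurable: by order-continuity, the maximal functions over finite collections of cubes,
which are simple, approximate it. -/
theorem memBochner_smul_latticeMax [SFinite μ] {X : Fin m → FnSpace Ω 𝕜}
    (hX : IsQBFSTuple μ X) (hoc : OrderContinuous μ (prodSpace μ X)) {r : Fin m → ℝ}
    (hr : ∀ j, 0 < r j) {q : ℝ} (hq : 0 < q) (hconv : PConvex (prodSpace μ X) q)
    {f : Fin m → (Fin d → ℝ) → Ω → 𝕜}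
    (hf : ∀ j, AEStronglyMeasurable (Function.uncurry (f j))
      ((volume : Measure (Fin d → ℝ)).prod μ))
    (hfin : ∀ j, ∀ Q ∈ cubes d, eNrmPos μ (X j) (fun ω => avg (r j) Q fun y => ‖f j y ω‖ₑ) ≠ ∞)
    {g : (Fin d → ℝ) → 𝕜} (hg : AEStronglyMeasurable g)
    (hlt : eLpNorm (fun x => eNrmPos μ (prodSpace μ X) (latticeMax (cubes d) r f x) * ‖g x‖ₑ)
      (ENNReal.ofReal q) volume < ∞) :
    MemBochner μ (prodSpace μ X) (ENNReal.ofReal q)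
      (fun x => g x • lift 𝕜 fun ω => (latticeMax (cubes d) r f x ω).toReal) := by
  classical
  obtain ⟨D, hDmono, hDc, hDsup⟩ := exists_finset_iSup_multiMax d
  have hsup := eNrmPos_latticeMax_cubes_eq_iSup hX hr hf hDmono hDsup
  set Y := prodSpace μ X with hY
  have hFm : Measurable fun x => eNrmPos μ Y (latticeMax (cubes d) r f x) := by
    simp only [hsup]
    exact Measurable.iSup fun k => measurable_eNrmPos_latticeMax Y r f (hDc k)
  have hae : ∀ᵐ x, g x = 0 ∨ eNrmPos μ Y (latticeMax (cubes d) r f x) ≠ ∞ := by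
    rw [eLpNorm_ofReal hq, ENNReal.rpow_lt_top_iff_of_pos (by positivity)] at hlt
    filter_upwards [ae_lt_top' ((hFm.aemeasurable.mul hg.enorm).pow_const q) hlt.ne] with x hx
    rw [ENNReal.rpow_lt_top_iff_of_pos hq] at hx
    by_contra hcon
    push Not at hcon
    rw [Pi.mul_apply, hcon.2, ENNReal.top_mul (by simpa using hcon.1)] at hx
    exact lt_irrefl _ hx
  set v : (Fin d → ℝ) → Ω → 𝕜 := fun x => lift 𝕜 fun ω => (latticeMax (cubes d) r f x ω).toReal
    with hv
  have hDfin : ∀ k x, eNrmPos μ Y (latticeMax (D k : Set (Set (Fin d → ℝ))) r f x) ≠ ∞ := fun k x =>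
    eNrmPos_latticeMax_finset_ne_top hX hq hconv hf hfin (hDc k) x
  -- the maximal functions over finite collections as simple functions
  choose T hT using fun k => exists_simpleFunc_filter_mem (D k) fun R hR =>
    measurableSet_of_mem_cubes (hDc k hR)
  set V : ℕ → SimpleFunc (Fin d → ℝ) (Ω → 𝕜) := fun k => (T k).map fun S => lift 𝕜 fun ω =>
    (S.sup fun R => ∏ j, avg (r j) R fun y => ‖f j y ω‖ₑ).toReal with hV
  have hVx : ∀ k x, V k x = lift 𝕜 fun ω =>
      (latticeMax (D k : Set (Set (Fin d → ℝ))) r f x ω).toReal := by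
    intro k x
    rw [hV, SimpleFunc.map_apply, hT]
    congr 1
    ext ω
    rw [← multiMax_finset_eq_sup]
    rfl
  have hVmem : ∀ k x, V k x ∈ Y.carrier := fun k x => by
    rw [hVx]
    exact mem_of_eNrmPos (hDfin k x)
  have hg' := hg.stronglyMeasurable_mk
  have hsupp : MeasurableSet {x | hg.mk g x ≠ 0} :=
    (hg'.measurable (measurableSet_singleton 0)).compl
  set γ : ℕ → SimpleFunc (Fin d → ℝ) 𝕜 := fun k => (hg'.approx k).restrict {x | hg.mk g x ≠ 0}
  have hγ : ∀ k x, γ k x = {x | hg.mk g x ≠ 0}.indicator (hg'.approx k) x := fun k x =>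
    SimpleFunc.restrict_apply _ hsupp x
  have hmem : ∀ᵐ x, g x • v x ∈ Y.carrier := by
    filter_upwards [hae] with x hx
    rcases hx with hx | hx
    · rw [hx, zero_smul]; exact hX.2.zero_mem
    · exact hX.2.smul_mem _ _ (mem_of_eNrmPos hx)
  have hnrm0 : Y.nrm 0 = 0 := (hX.2.nrm_eq_zero _ hX.2.zero_mem).2 (ae_eq_refl _)
  refine ⟨⟨?_, hmem, fun k => ((γ k).pair (V k)).map fun p => p.1 • p.2, fun k x => ?_, ?_⟩, ?_⟩
  · have h1 := (aemeasurable_uncurry_latticeMax (μ := μ) hr hf).ennreal_toReal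
    exact hg.comp_fst.smul (aestronglyMeasurable_lift (𝕜 := 𝕜) h1)
  · exact hX.2.smul_mem _ _ (hVmem k x)
  · obtain ⟨K, hK⟩ := hX.2.nrm_add
    filter_upwards [hae, hg.ae_eq_mk] with x hx hgx
    simp only [SimpleFunc.map_apply, SimpleFunc.pair_apply]
    -- where `g` vanishes the maximal function need not be in the space, so the simple functions
    -- approximating `g` were chosen to vanish there as well
    by_cases hg0 : g x = 0
    · have : ∀ k, γ k x = 0 := fun k => by
        rw [hγ, indicator_of_notMem]
        simp [← hgx, hg0]
      simp only [this, hg0, zero_smul, sub_self, hnrm0, tendsto_const_nhds]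
    have hF := hx.resolve_left hg0
    have hvmem : v x ∈ Y.carrier := mem_of_eNrmPos hF
    have hγx : Tendsto (fun k => γ k x) atTop (𝓝 (g x)) := by
      rw [hgx]
      refine (hg'.tendsto_approx x).congr fun k => ?_
      rw [hγ, indicator_of_mem]
      rw [Set.mem_ofPred_eq, ← hgx]
      exact hg0
    have hltop := ae_lt_top_of_eNrmPos hF
    have hmono : ∀ ω, Monotone fun k => latticeMax (D k : Set (Set (Fin d → ℝ))) r f x ω :=
      fun ω i j hij => multiMax_mono (Finset.coe_subset.2 (hDmono hij)) _ _ _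
    have hsub : ∀ k ω, latticeMax (D k : Set (Set (Fin d → ℝ))) r f x ω
        ≤ latticeMax (cubes d) r f x ω := fun k ω => multiMax_mono (hDc k) _ _ _
    have hlat : ∀ ω, Tendsto (fun k => latticeMax (D k : Set (Set (Fin d → ℝ))) r f x ω) atTop
        (𝓝 (latticeMax (cubes d) r f x ω)) := fun ω => by
      have := tendsto_atTop_iSup (hmono ω)
      rwa [show (⨆ k, latticeMax (D k : Set (Set (Fin d → ℝ))) r f x ω)
        = latticeMax (cubes d) r f x ω from (hDsup m r hr _ x).symm] at this
    have hconvg : Tendsto (fun k => Y.nrm (V k x - v x)) atTop (𝓝 0) := by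
      simp only [hVx]
      refine hoc _ _ ⟨fun k => ?_, ?_, ?_⟩ hvmem
      · exact (aemeasurable_latticeMax hf r
          (D k).countable_toSet x).ennreal_toReal.aestronglyMeasurable
      · have h1 : AEMeasurable (latticeMax (cubes d) r f x) μ := by
          have : latticeMax (cubes d) r f x = latticeMax (ratCubes d) r f x := by
            ext ω; exact multiMax_cubes_eq_ratCubes hr _ x
          rw [this]
          exact aemeasurable_latticeMax hf r countable_ratCubes x
        exact h1.ennreal_toReal.aestronglyMeasurable
      · filter_upwards [hltop] with ω hω
        refine ⟨ENNReal.toReal_nonneg, fun i j hij => ENNReal.toReal_mono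
          ((hsub j ω).trans_lt hω).ne (hmono ω hij), ?_⟩
        exact (ENNReal.tendsto_toReal hω.ne).comp (hlat ω)
    have hVle : ∀ k, Y.nrm (V k x) ≤ Y.nrm (v x) := fun k => by
      refine hX.2.compat _ (hVmem k x) _ hvmem ?_
      filter_upwards [hltop] with ω hω
      rw [hVx, norm_lift, norm_lift, abs_of_nonneg ENNReal.toReal_nonneg,
        abs_of_nonneg ENNReal.toReal_nonneg]
      exact ENNReal.toReal_mono hω.ne (hsub k ω)
    have hbound : Tendsto (fun k => |K| * (‖γ k x - g x‖ * Y.nrm (v x)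
        + ‖g x‖ * Y.nrm (V k x - v x))) atTop (𝓝 0) := by
      have h1 := (tendsto_iff_norm_sub_tendsto_zero.1 hγx).mul_const (Y.nrm (v x))
      have h2 := hconvg.const_mul ‖g x‖
      have h3 := (h1.add h2).const_mul |K|
      simpa using h3
    have hdm := fun k => hX.2.sub_mem (hVmem k x) hvmem
    refine squeeze_zero (fun k => ?_) (fun k => ?_) hbound
    · exact hX.2.nrm_nonneg _ (hX.2.sub_mem (hX.2.smul_mem _ _ (hVmem k x))
        (hX.2.smul_mem _ _ hvmem))
    · have heq : γ k x • V k x - g x • v x = (γ k x - g x) • V k x + g x • (V k x - v x) := by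
        rw [sub_smul, smul_sub]; abel
      have h1 := hK _ (hX.2.smul_mem (γ k x - g x) _ (hVmem k x)) _
        (hX.2.smul_mem (g x) _ (hdm k))
      rw [← heq, hX.2.nrm_smul _ _ (hVmem k x), hX.2.nrm_smul _ _ (hdm k)] at h1
      have h2 := hX.2.nrm_nonneg _ (hVmem k x)
      have h3 := hX.2.nrm_nonneg _ (hdm k)
      refine h1.trans ((mul_le_mul_of_nonneg_right (le_abs_self K) (by positivity)).trans ?_)
      gcongr
      exact hVle k
  · refine lt_of_le_of_lt (eLpNorm_mono_enorm_ae ?_) hlt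
    filter_upwards [hae] with x hx
    simp only [enorm_eq_self]
    rcases hx with hx | hx
    · rw [hx, zero_smul, eNrm_of_mem hX.2.zero_mem, hnrm0]
      simp
    · have hvm : v x ∈ Y.carrier := mem_of_eNrmPos hx
      rw [eNrm_of_mem (hX.2.smul_mem _ _ hvm), hX.2.nrm_smul _ _ hvm,
        ENNReal.ofReal_mul (norm_nonneg _), ofReal_norm,
        eNrmPos_of_mem (ae_lt_top_of_eNrmPos hx) hvm, mul_comm]

end

end SparseHL

open SparseHL
theorem mainTheorem3 {Ω 𝕜 : Type*} [MeasurableSpace Ω] [RCLike 𝕜] (μ : Measure Ω) [SigmaFinite μ]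
    (d m : ℕ) (hd : 0 < d) (hm : 0 < m) (X : Fin m → FnSpace Ω 𝕜) (hX : IsQBFSTuple μ X)
    (r : Fin m → ℝ) (hr : ∀ j, 0 < r j) (hHL : HL μ d X r)
    (hoc : OrderContinuous μ (prodSpace μ X)) :
    ∃ C : ℝ≥0, ∀ q : ℝ, (∑ j, (r j)⁻¹)⁻¹ ≤ q → PConvex (prodSpace μ X) q →
      ∀ f : Fin m → (Fin d → ℝ) → Ω → 𝕜,
        (∀ j, MemBochnerLoc μ (X j) (ENNReal.ofReal (r j)) (f j)) →
        -- the estimate with a weight function `g`, for the norm of `M_{(r,q)}(‖f‖, g)`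
        (∀ g : (Fin d → ℝ) → 𝕜, MemLpLoc (ENNReal.ofReal q) g →
          eLpNorm (fun x => eNrmPos μ (prodSpace μ X) (latticeMax (cubes d) r f x) * ‖g x‖ₑ)
              (ENNReal.ofReal q) volume
            ≤ C * eLpNorm (multiMax (cubes d) (Fin.snoc (α := fun _ => ℝ) r q)
                (Fin.snoc (α := fun _ => (Fin d → ℝ) → ℝ≥0∞)
                  (fun j y => eNrm (X j) (f j y)) (fun y => ‖g y‖ₑ)))
              (ENNReal.ofReal q) volume ∧
          (eLpNorm (multiMax (cubes d) (Fin.snoc (α := fun _ => ℝ) r q)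
                (Fin.snoc (α := fun _ => (Fin d → ℝ) → ℝ≥0∞)
                  (fun j y => eNrm (X j) (f j y)) (fun y => ‖g y‖ₑ)))
              (ENNReal.ofReal q) volume < ∞ →
            MemBochner μ (prodSpace μ X) (ENNReal.ofReal q)
              (fun x => g x • lift 𝕜 fun ω => (latticeMax (cubes d) r f x ω).toReal))) ∧
        -- the estimate without `g`
        (eLpNorm (fun x => eNrmPos μ (prodSpace μ X) (latticeMax (cubes d) r f x))
              (ENNReal.ofReal q) volume
            ≤ C * eLpNorm (multiMax (cubes d) r (fun j y => eNrm (X j) (f j y)))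
              (ENNReal.ofReal q) volume ∧
          (eLpNorm (multiMax (cubes d) r (fun j y => eNrm (X j) (f j y)))
              (ENNReal.ofReal q) volume < ∞ →
            MemBochner μ (prodSpace μ X) (ENNReal.ofReal q)
              (fun x => lift 𝕜 fun ω => (latticeMax (cubes d) r f x ω).toReal))) ∧
        -- the pointwise sparse bound for finite collections of dyadic cubes
        (∀ D : Finset (Set (Fin d → ℝ)), (D : Set (Set (Fin d → ℝ))) ⊆ dyadicCubes d →
          ∃ S ⊆ D, IsSparse (S : Set (Set (Fin d → ℝ))) ∧
            ∀ x, eNrmPos μ (prodSpace μ X) (latticeMax (D : Set (Set (Fin d → ℝ))) r f x)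
              ≤ C * (∑ Q ∈ S, Q.indicator
                  (fun _ => (∏ j, avg (r j) Q (fun y => eNrm (X j) (f j y))) ^ q) x) ^ (1 / q)) := by
  have : Nonempty (Fin m) := ⟨⟨0, hm⟩⟩
  obtain ⟨A, hA⟩ := exists_volume_lt_latticeMax_le hX hr hHL
  -- the constant of the one-third trick
  set κ : ℝ≥0 := (6 ^ d : ℝ≥0) ^ (∑ j, 1 / r j) with hκ
  set E : ℝ := ∑ j, (r j)⁻¹ with hE
  have hEpos : 0 < E := Finset.sum_pos (fun j _ => inv_pos.2 (hr j)) Finset.univ_nonempty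
  set L : ℝ≥0 := (2 ^ (d + 1) : ℝ≥0) ^ E with hL
  have hκ1 : 1 ≤ κ := NNReal.one_le_rpow (one_le_pow₀ (by norm_num))
    (Finset.sum_nonneg fun j _ => (one_div_pos.2 (hr j)).le)
  have hL1 : 1 ≤ L := NNReal.one_le_rpow (one_le_pow₀ (by norm_num)) hEpos.le
  refine ⟨κ * A * L, fun q hrq hconv f hf => ?_⟩
  have hq : 0 < q := (inv_pos.2 hEpos).trans_le hrq
  have hfm := fun j => (hf j).1.1
  have hsparse : ∀ τ : Fin d → ℝ, ∀ D : Finset (Set (Fin d → ℝ)),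
      (D : Set (Set (Fin d → ℝ))) ⊆ grid τ → ∃ S ⊆ D, IsSparse (S : Set (Set (Fin d → ℝ))) ∧
      ∀ x, eNrmPos μ (prodSpace μ X) (latticeMax (D : Set (Set (Fin d → ℝ))) r f x)
        ≤ A * (∑ Q ∈ S, Q.indicator
            (fun _ => (∏ j, avg (r j) Q (fun y => eNrm (X j) (f j y))) ^ q) x) ^ (1 / q) :=
    fun τ => exists_sparse_eNrmPos_latticeMax_le hX hfm (fun Q hQ D hD hDQ =>
      hA τ f (fun j => (hf j).1) Q hQ
        (fun j => avg_eNrm_ne_top (hr j) (hf j) (grid_subset_cubes τ hQ)) D hD hDQ) hq hconv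
  have hfin : ∀ j, ∀ Q ∈ cubes d,
      eNrmPos μ (X j) (fun ω => avg (r j) Q fun y => ‖f j y ω‖ₑ) ≠ ∞ := by
    intro j Q hQ
    obtain ⟨c, hc⟩ := exists_eNrmPos_avg_le (d := d) (hX.1 j) (hr j) (hHL.1 j)
    refine ((hc (f j) (hf j).1 Q (volume_ne_zero_of_mem_cubes hQ)
      (volume_ne_top_of_mem_cubes hQ)).trans_lt ?_).ne
    exact ENNReal.mul_lt_top ENNReal.coe_lt_top (avg_eNrm_ne_top (hr j) (hf j) hQ).lt_top
  -- since `1 / q ≤ E`, the number of grids enters with a constant independent of `q`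
  have hL2 : ((2 : ℝ≥0∞) ^ (d + 1)) ^ (1 / q) ≤ L := by
    rw [hL, ENNReal.coe_rpow_of_nonneg _ hEpos.le]
    push_cast
    refine ENNReal.rpow_le_rpow_of_exponent_le (one_le_pow₀ (by norm_num)) ?_
    rw [one_div]
    exact inv_le_of_inv_le₀ hEpos hrq
  have hweighted : ∀ g : (Fin d → ℝ) → 𝕜, AEStronglyMeasurable g volume →
      eLpNorm (fun x => eNrmPos μ (prodSpace μ X) (latticeMax (cubes d) r f x) * ‖g x‖ₑ)
          (ENNReal.ofReal q) volume
        ≤ ((κ * A * L : ℝ≥0) : ℝ≥0∞) * eLpNorm (multiMax (cubes d)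
            (Fin.snoc (α := fun _ => ℝ) r q) (Fin.snoc (α := fun _ => (Fin d → ℝ) → ℝ≥0∞)
              (fun j y => eNrm (X j) (f j y)) (fun y => ‖g y‖ₑ))) (ENNReal.ofReal q) volume := by
    intro g hg
    refine (eLpNorm_eNrmPos_latticeMax_mul_le hX hr hq hconv hfm hsparse hg.enorm).trans ?_
    push_cast
    gcongr
  have hone : multiMax (cubes d) (Fin.snoc (α := fun _ => ℝ) r q)
      (Fin.snoc (α := fun _ => (Fin d → ℝ) → ℝ≥0∞)
        (fun j y => eNrm (X j) (f j y)) (fun _ => ‖(1 : 𝕜)‖ₑ))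
      = multiMax (cubes d) r (fun j y => eNrm (X j) (f j y)) := by
    ext x
    refine iSup_congr fun Q => iSup_congr fun hQ => ?_
    have h1 : avg q Q (fun _ => ‖(1 : 𝕜)‖ₑ) = 1 := by
      simp [avg, ENNReal.div_self (volume_ne_zero_of_mem_cubes hQ)
        (volume_ne_top_of_mem_cubes hQ)]
    rw [Fin.prod_univ_castSucc]
    simp only [Fin.snoc_castSucc, Fin.snoc_last, h1, mul_one]
  refine ⟨fun g hg => ⟨hweighted g hg.1, fun hlt => ?_⟩, ⟨?_, fun hlt => ?_⟩, fun D hD => ?_⟩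
  · exact memBochner_smul_latticeMax hX hoc hr hq hconv hfm hfin hg.1
      ((hweighted g hg.1).trans_lt (ENNReal.mul_lt_top ENNReal.coe_lt_top hlt))
  · have h := hweighted (fun _ => 1) aestronglyMeasurable_const
    rw [hone] at h
    simpa only [enorm_one, mul_one] using h
  · have h := hweighted (fun _ => 1) aestronglyMeasurable_const
    rw [hone] at h
    have h2 := memBochner_smul_latticeMax hX hoc hr hq hconv hfm hfin
      (g := fun _ => 1) aestronglyMeasurable_const
      (h.trans_lt (ENNReal.mul_lt_top ENNReal.coe_lt_top hlt))
    simpa only [one_smul] using h2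
  · obtain ⟨S, hSD, hS, hle⟩ := hsparse 0 D (hD.trans dyadicCubes_subset_grid)
    refine ⟨S, hSD, hS, fun x => (hle x).trans ?_⟩
    gcongr
    calc A = 1 * A * 1 := by simp
      _ ≤ κ * A * L := by gcongr
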